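/- Let $V=\coprod_{n\in\mathbb{Z}}V_{(n)}$ be a vertex operator algebra, with vertex operators $Y(u,x)=\sum_{n\in\mathbb Z}u_nx^{-n-1}$. A discretely $\mathbb{R}$-graded $V$-module is an $\mathbb{R}$-graded $V$-module $W=\coprod_{r\in\mathbb{R}}W_{(r)}$ such that for every $r\in\mathbb R$ the subspace spanned by the vectors of weight at most $r$ is finite-dimensional; $W'$ denotes its contragredient module. $W$ is $C_1$-cofinite if $\dim W/C_1(W)<\infty$, where $C_1(W)$ is the span of all $u_{-1}w$ with $u\in V_+=\coprod_{n>0}V_{(n)}$ and $w\in W$. Let $$R=\mathbb{C}[z_1^{\pm1},z_2^{\pm1},(z_1-z_2)^{-1}].$$ **Theorem.** Let $W_0,W_1,W_2,W_3$ be $C_1$-cofinite discretely $\mathbb{R}$-graded $V$-modules and let $w_i\in W_i$ for $i=0,1,2,3$. Prescribe any one of the following possible singular points: $$z_1=0,\quad z_2=0,\quad z_1=\infty,\quad z_2=\infty,\quad z_1=z_2,\quad z_1^{-1}(z_1-z_2)=0,\quad z_2^{-1}(z_1-z_2)=0.$$ Then there exist $m,n\ge1$ and $a_k,b_l\in R$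 ($1\le k\le m$, $1\le l\le n$) such that the system $$\frac{\partial^m\varphi}{\partial z_1^m}+\sum_{k=1}^m a_k(z_1,z_2)\frac{\partial^{m-k}\varphi}{\partial z_1^{m-k}}=0,\qquad \frac{\partial^n\varphi}{\partial z_2^n}+\sum_{l=1}^n b_l(z_1,z_2)\frac{\partial^{n-l}\varphi}{\partial z_2^{n-l}}=0$$ has the following two properties. 1. For all discretely $\mathbb{R}$-graded $V$-modules $W_4,W_5,W_6$ and all intertwining operators $\mathcal Y_1,\dots,\mathcal Y_6$ of types $\binom{W_0'}{W_1W_4}$, $\binom{W_4}{W_2W_3}$, $\binom{W_5}{W_1W_2}$, $\binom{W_0'}{W_5W_3}$, $\binom{W_0'}{W_2W_6}$, $\binom{W_6}{W_1W_3}$, respectively, the formal series $$\langle w_0,\mathcal Y_1(w_1,z_1)\mathcal Y_2(w_2,z_2)w_3\rangle,\quad \langle w_0,\mathcal Y_4(\mathcal Y_3(w_1,z_1-z_2)w_2,z_2)w_3\rangle,\quad \langle w_0,\mathcal Y_5(w_2,z_2)\mathcal Y_6(w_1,z_1)w_3\rangle$$ satisfy the expansions of the system in the regions $|z_1|>|z_2|>0$,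 $|z_2|>|z_1-z_2|>0$ and $|z_2|>|z_1|>0$, respectively. 2. The prescribed singular point of the system is regular, in the following sense: for all $1\le k\le m$ and $1\le l\le n$, the functions $e_1^ka_k$ and $e_2^lb_l$ lie in the algebra $\mathcal O$, where $e_1,e_2\in R$ and the subalgebra $\mathcal O\subset R$ of functions without pole at the singular point are - $e_1=e_2=z_1$ and $\mathcal O=\mathbb C[z_1,z_2^{\pm1},(z_1-z_2)^{-1}]$ for $z_1=0$; - $e_1=e_2=z_2$ and $\mathcal O=\mathbb C[z_1^{\pm1},z_2,(z_1-z_2)^{-1}]$ for $z_2=0$; - $e_1=z_1$, $e_2=z_1^{-1}$ and $\mathcal O=\mathbb C[z_1^{-1},z_2^{\pm1},(1-z_2/z_1)^{-1}]$ for $z_1=\infty$; - $e_1=z_2^{-1}$, $e_2=z_2$ and $\mathcal O=\mathbb C[z_1^{\pm1},z_2^{-1},(1-z_1/z_2)^{-1}]$ for $z_2=\infty$; - $e_1=e_2=z_1-z_2$ and $\mathcal O=\mathbb C[z_1^{\pm1},z_2^{\pm1}]$ for $z_1=z_2$; - $e_1=e_2=z_1-z_2$ and $\mathcal O=\mathbb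 C[(z_1/z_2)^{\pm1}]$ for $z_1^{-1}(z_1-z_2)=0$ and for $z_2^{-1}(z_1-z_2)=0$. In other words, in local coordinates at the singular point the coefficient of the derivative of order $k$ less than the leading one has a pole of order at most $k$ there, in both equations; and in the last case, with $\zeta=z_2^{-1}(z_1-z_2)$ or $\zeta=z_1^{-1}(z_1-z_2)$, the coefficients are, up to a power of $z_2$ or $z_1$, functions of $\zeta$ alone. -/

import Mathlib

noncomputable section

namespace VOA

open scoped LaurentPolynomial

/-! ### Vertex operator algebras, modules, intertwining operators

A vertex operator `Y(u, x) = ∑ u_n x^{-n-1}` is encoded by the family of its modes `u_n`. -/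

/-- The Jacobi identity
`x₀⁻¹ δ((x₁ - x₂)/x₀) Y₃(u, x₁) I(a, x₂) b - x₀⁻¹ δ((x₂ - x₁)/(-x₀)) I(a, x₂) Y₂(u, x₁) b
  = x₂⁻¹ δ((x₁ - x₀)/x₂) I(Y₁(u, x₀) a, x₂) b`,
written out as the equality of the coefficients of `x₀^{-l-1} x₁^{-m-1} x₂^{-n-1}`.
The mode index of `I` runs over `ι` (which is `ℤ` for algebras and modules, and `ℂ` for
intertwining operators).  By lower truncation, only finitely many terms of each sum are nonzero. -/
def JacobiIdentity {ι V W₁ W₂ W₃ : Type*} [AddGroupWithOne ι]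
    [AddCommGroup W₁] [Module ℂ W₁] [AddCommGroup W₂] [Module ℂ W₂]
    [AddCommGroup W₃] [Module ℂ W₃]
    (Y₁ : V → ℤ → Module.End ℂ W₁) (Y₂ : V → ℤ → Module.End ℂ W₂)
    (Y₃ : V → ℤ → Module.End ℂ W₃) (I : W₁ → ι → W₂ →ₗ[ℂ] W₃) : Prop :=
  ∀ (u : V) (a : W₁) (b : W₂) (l m : ℤ) (n : ι),
    ∑ᶠ i : ℕ, ((Ring.choose m i : ℤ) : ℂ) • I (Y₁ u (l + i) a) ((m : ι) + n - (i : ι)) b =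
      ∑ᶠ i : ℕ, ((-1 : ℂ) ^ i * ((Ring.choose l i : ℤ) : ℂ)) •
        (Y₃ u (l + m - i) (I a (n + (i : ι)) b) -
          (-1 : ℂ) ^ l • I a ((l : ι) + n - (i : ι)) (Y₂ u (m + i) b))

/-- The Virasoro relations of central charge `c` for the operators `L n`. -/
def VirasoroRelations {W : Type*} [AddCommGroup W] [Module ℂ W]
    (L : ℤ → Module.End ℂ W) (c : ℂ) : Prop :=
  ∀ m n : ℤ, L m * L n - L n * L m =
    ((m - n : ℤ) : ℂ) • L (m + n) +
      (if m + n = 0 then ((m : ℂ) ^ 3 - m) / 12 * c else 0) • (1 : Module.End ℂ W)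

/-- A vertex operator algebra.  The conformal element is `ω`, with modes `ω_{n+1} = L(n)`.
Since `L(0)` acts on the homogeneous subspace `V_(n)` as multiplication by `n` and
`V = ∐_{n ∈ ℤ} V_(n)`, the subspace `V_(n)` is the eigenspace of `L(0)` for the eigenvalue `n`. -/
structure VertexOperatorAlgebra (V : Type*) [AddCommGroup V] [Module ℂ V] where
  /-- `Y u n` is the mode `u_n`. -/
  Y : V →ₗ[ℂ] (ℤ → Module.End ℂ V)
  /-- the vacuum -/
  vac : V
  /-- the conformal element -/
  ω : V
  /-- the central charge -/
  c : ℂ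
  isInternal : DirectSum.IsInternal fun n : ℤ => (Y ω 1).eigenspace (n : ℂ)
  finite_weight : ∀ n : ℤ, FiniteDimensional ℂ ((Y ω 1).eigenspace (n : ℂ))
  lower_bounded : ∃ N : ℤ, ∀ n : ℤ, n < N → (Y ω 1).eigenspace (n : ℂ) = ⊥
  truncation : ∀ u v : V, ∃ N : ℤ, ∀ n : ℤ, N ≤ n → Y u n v = 0
  vac_mem : vac ∈ (Y ω 1).eigenspace ((0 : ℤ) : ℂ)
  ω_mem : ω ∈ (Y ω 1).eigenspace ((2 : ℤ) : ℂ)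
  vacuum : ∀ n : ℤ, Y vac n = if n = -1 then 1 else 0
  creation : ∀ v : V, Y v (-1) vac = v ∧ ∀ n : ℤ, 0 ≤ n → Y v n vac = 0
  jacobi : JacobiIdentity (fun u => Y u) (fun u => Y u) (fun u => Y u) (fun u => Y u)
  virasoro : VirasoroRelations (fun n => Y ω (n + 1)) c
  derivative : ∀ (v : V) (n : ℤ), Y (Y ω 0 v) n = (-(n : ℂ)) • Y v (n - 1)

namespace VertexOperatorAlgebra

variable {V : Type*} [AddCommGroup V] [Module ℂ V] (𝒱 : VertexOperatorAlgebra V)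

/-- The homogeneous subspace `V_(n)`. -/
def weightSpace (n : ℤ) : Submodule ℂ V := (𝒱.Y 𝒱.ω 1).eigenspace (n : ℂ)

/-- `V₊ = ∐_{n > 0} V_(n)`. -/
def positivePart : Submodule ℂ V := ⨆ n : {n : ℤ // 0 < n}, 𝒱.weightSpace n

/-- The homogeneous components of a vector. -/
def decompose : V ≃ₗ[ℂ] DirectSum ℤ (fun n : ℤ => 𝒱.weightSpace n) :=
  (LinearEquiv.ofBijective
    (DirectSum.coeLinearMap fun n : ℤ => 𝒱.weightSpace n) 𝒱.isInternal).symm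

end VertexOperatorAlgebra

/-- A discretely `ℝ`-graded module for a vertex operator algebra: an `ℝ`-graded module
`W = ∐_{r ∈ ℝ} W_(r)` in which the vectors of weight at most `r` span a finite-dimensional
subspace, for every `r`.  Again `W_(r)` is the eigenspace of `L(0)` for the eigenvalue `r`. -/
structure DiscreteModule {V : Type*} [AddCommGroup V] [Module ℂ V]
    (𝒱 : VertexOperatorAlgebra V) (W : Type*) [AddCommGroup W] [Module ℂ W] where
  /-- `Y u n` is the mode `u_n` acting on `W`. -/
  Y : V →ₗ[ℂ] (ℤ → Module.End ℂ W)
  isInternal : DirectSum.IsInternal fun r : ℝ => (Y 𝒱.ω 1).eigenspace (r : ℂ)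
  discrete : ∀ r : ℝ, FiniteDimensional ℂ
    (⨆ s : {s : ℝ // s ≤ r}, (Y 𝒱.ω 1).eigenspace ((s : ℝ) : ℂ) : Submodule ℂ W)
  truncation : ∀ (u : V) (w : W), ∃ N : ℤ, ∀ n : ℤ, N ≤ n → Y u n w = 0
  vacuum : ∀ n : ℤ, Y 𝒱.vac n = if n = -1 then 1 else 0
  jacobi : JacobiIdentity (fun u => 𝒱.Y u) (fun u => Y u) (fun u => Y u) (fun u => Y u)
  virasoro : VirasoroRelations (fun n => Y 𝒱.ω (n + 1)) 𝒱.c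
  derivative : ∀ (v : V) (n : ℤ), Y (𝒱.Y 𝒱.ω 0 v) n = (-(n : ℂ)) • Y v (n - 1)

/-- The commutator formula `[L(0), v_n] = (L(0) v)_n + (L(-1) v)_{n+1}`
makes `v_n` an operator of weight `wt v - n - 1`. -/
theorem mode_mem_eigenspace {V W : Type*} [AddCommGroup V] [Module ℂ V]
    [AddCommGroup W] [Module ℂ W] (𝒱 : VertexOperatorAlgebra V)
    (Y : V →ₗ[ℂ] (ℤ → Module.End ℂ W))
    (jac : JacobiIdentity (fun u => 𝒱.Y u) (fun u => Y u) (fun u => Y u) (fun u => Y u))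
    (der : ∀ (v : V) (n : ℤ), Y (𝒱.Y 𝒱.ω 0 v) n = (-(n : ℂ)) • Y v (n - 1))
    {v : V} {h : ℂ} (hv : v ∈ (𝒱.Y 𝒱.ω 1).eigenspace h)
    {w : W} {r : ℂ} (hw : w ∈ (Y 𝒱.ω 1).eigenspace r) (n : ℤ) :
    Y v n w ∈ (Y 𝒱.ω 1).eigenspace (r + h - n - 1) := by
  rw [Module.End.mem_eigenspace_iff] at *
  have key := jac 𝒱.ω v w 0 1 n
  rw [finsum_eq_sum_of_support_subset (s := Finset.range 2),
    finsum_eq_sum_of_support_subset (s := Finset.range 1)] at key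
  · simp [Finset.sum_range_succ, hv, hw, der] at key
    have h2 := sub_eq_iff_eq_add.mp key.symm
    rw [h2]
    module
  · intro i hi
    by_contra hi'
    apply hi
    have : i ≠ 0 := by simpa using hi'
    obtain ⟨j, rfl⟩ := Nat.exists_eq_succ_of_ne_zero this
    have h0 : Ring.choose (0 : ℤ) (j + 1) = 0 := by
      exact Ring.choose_zero_succ ℤ j
    simp [h0]
  · intro i hi
    by_contra hi'
    apply hi
    have h2 : 1 < i := by simpa using hi'
    have : Ring.choose (1 : ℤ) i = 0 := by
      have := Ring.choose_natCast (R := ℤ) 1 i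
      rw [Nat.choose_eq_zero_of_lt h2] at this
      simpa using this
    simp [this]

namespace DiscreteModule

variable {V : Type*} [AddCommGroup V] [Module ℂ V] {𝒱 : VertexOperatorAlgebra V}
  {W : Type*} [AddCommGroup W] [Module ℂ W] (M : DiscreteModule 𝒱 W)

/-- The homogeneous subspace `W_(r)`. -/
def weightSpace (r : ℝ) : Submodule ℂ W := (M.Y 𝒱.ω 1).eigenspace (r : ℂ)

/-- `C₁(W)`, the span of the vectors `u_{-1} w` with `u ∈ V₊` and `w ∈ W`. -/
def C₁ : Submodule ℂ W :=
  Submodule.span ℂ {x | ∃ u ∈ 𝒱.positivePart, ∃ w : W, x = M.Y u (-1) w}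

/-- The `C₁`-cofiniteness condition `dim W / C₁(W) < ∞`. -/
def C₁Cofinite : Prop := FiniteDimensional ℂ (W ⧸ M.C₁)

/-- The modes of the opposite vertex operator
`Y(e^{x L(1)} (-x^{-2})^{L(0)} u, x^{-1})`.  On the component `u_h ∈ V_(h)` of `u`, the
coefficient of `x^{-n-1}` is `∑ i, ((-1)^h / i!) (L(1)^i u_h)_{2h-n-i-2}`, a finite sum. -/
def oppositeMode (u : V) (n : ℤ) : Module.End ℂ W :=
  ∑ᶠ p : ℤ × ℕ, ((-1 : ℂ) ^ p.1 / (p.2.factorial : ℂ)) •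
    M.Y (((𝒱.Y 𝒱.ω 2) ^ p.2) (𝒱.decompose u p.1 : V)) (2 * p.1 - n - p.2 - 2)

/-- The graded dual `∐_{r ∈ ℝ} W_(r)^*`: the linear functionals on `W` that vanish on all but
finitely many of the subspaces `W_(r)`. -/
def gradedDual : Submodule ℂ (Module.Dual ℂ W) where
  carrier := {f | ∃ S : Finset ℝ, ∀ r : ℝ, r ∉ S → ∀ w ∈ M.weightSpace r, f w = 0}
  zero_mem' := ⟨∅, by simp⟩
  add_mem' := by
    rintro f g ⟨S, hS⟩ ⟨T, hT⟩
    classical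
    refine ⟨S ∪ T, fun r hr w hw => ?_⟩
    rw [Finset.mem_union, not_or] at hr
    simp [hS r hr.1 w hw, hT r hr.2 w hw]
  smul_mem' := by
    rintro a f ⟨S, hS⟩
    exact ⟨S, fun r hr w hw => by simp [hS r hr w hw]⟩

theorem L_one_pow_mem {v : V} {h : ℤ} (hv : v ∈ 𝒱.weightSpace h) (i : ℕ) :
    ((𝒱.Y 𝒱.ω 2) ^ i) v ∈ 𝒱.weightSpace (h - i) := by
  induction i with
  | zero => simpa using hv
  | succ i ih =>
    rw [pow_succ', Module.End.mul_apply]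
    have := mode_mem_eigenspace 𝒱 𝒱.Y 𝒱.jacobi 𝒱.derivative 𝒱.ω_mem ih 2
    unfold VertexOperatorAlgebra.weightSpace
    convert this using 2
    push_cast
    ring

theorem oppositeMode_preserves (u : V) (n : ℤ) (f : Module.Dual ℂ W) (hf : f ∈ M.gradedDual) :
    (M.oppositeMode u n).dualMap f ∈ M.gradedDual := by
  classical
  obtain ⟨S, hS⟩ := hf
  refine ⟨((𝒱.decompose u).support ×ˢ S).image fun p => p.2 + (p.1 : ℝ) - n - 1,
    fun r hr w hw => ?_⟩
  rw [LinearMap.dualMap_apply]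
  unfold oppositeMode
  refine finsum_induction (fun A : Module.End ℂ W => f (A w) = 0) (by simp)
    (fun A B hA hB => by simp [hA, hB]) ?_
  rintro ⟨h, i⟩
  by_cases hh : 𝒱.decompose u h = 0
  · simp [hh]
  · have h1 := L_one_pow_mem (𝒱 := 𝒱) (𝒱.decompose u h).2 i
    have h2 := mode_mem_eigenspace 𝒱 M.Y M.jacobi M.derivative h1 hw (2 * h - n - i - 2)
    have h3 : f (M.Y (((𝒱.Y 𝒱.ω 2) ^ i) (𝒱.decompose u h : V)) (2 * h - n - i - 2) w) = 0 := by
      apply hS (r - h + n + 1)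
      · intro hmem
        apply hr
        rw [Finset.mem_image]
        refine ⟨(h, r - h + n + 1), ?_, by ring⟩
        rw [Finset.mem_product]
        exact ⟨DFinsupp.mem_support_toFun _ _ |>.mpr hh, hmem⟩
      · unfold weightSpace
        convert h2 using 2
        push_cast
        ring
    simp [h3]

/-- The vertex operator map of the contragredient module `W'` (the graded dual), given by
`⟨Y'(u, x) f, w⟩ = ⟨f, Y(e^{x L(1)} (-x^{-2})^{L(0)} u, x^{-1}) w⟩`. -/
def contragredient (u : V) (n : ℤ) : Module.End ℂ M.gradedDual :=
  (M.oppositeMode u n).dualMap.restrict (M.oppositeMode_preserves u n)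

end DiscreteModule

/-- An intertwining operator of type `(W₃ over W₁ W₂)`, for the vertex operator maps `Y₁`, `Y₂`,
`Y₃` of three modules: `I(w, x) = ∑_{n ∈ ℂ} w_n x^{-n-1}` with lower truncation, the Jacobi
identity and the `L(-1)`-derivative property. -/
structure IntertwiningOperator {V : Type*} [AddCommGroup V] [Module ℂ V]
    (𝒱 : VertexOperatorAlgebra V)
    {W₁ : Type*} [AddCommGroup W₁] [Module ℂ W₁] (Y₁ : V → ℤ → Module.End ℂ W₁)
    {W₂ : Type*} [AddCommGroup W₂] [Module ℂ W₂] (Y₂ : V → ℤ → Module.End ℂ W₂)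
    {W₃ : Type*} [AddCommGroup W₃] [Module ℂ W₃] (Y₃ : V → ℤ → Module.End ℂ W₃) where
  /-- `mode w n` is the operator `w_n`. -/
  mode : W₁ →ₗ[ℂ] (ℂ → W₂ →ₗ[ℂ] W₃)
  truncation : ∀ (a : W₁) (b : W₂) (n : ℂ), ∃ N : ℕ, ∀ k : ℕ, N ≤ k → mode a (n + k) b = 0
  jacobi : JacobiIdentity Y₁ Y₂ Y₃ (fun a => mode a)
  derivative : ∀ (a : W₁) (n : ℂ), mode (Y₁ 𝒱.ω 0 a) n = (-n) • mode a (n - 1)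

/-! ### The ring of coefficients and its expansions -/

/-- The ring `ℂ[z₁^{±1}, z₂^{±1}, (z₁ - z₂)⁻¹]`. -/
abbrev CoeffRing : Type :=
  Localization.Away (MvPolynomial.X 0 * MvPolynomial.X 1 *
    (MvPolynomial.X 0 - MvPolynomial.X 1) : MvPolynomial (Fin 2) ℂ)

/-- The polynomials, as elements of the coefficient ring. -/
abbrev ofPoly : MvPolynomial (Fin 2) ℂ →ₐ[ℂ] CoeffRing := Algebra.algHom ℂ _ _

theorem isUnit_prod : IsUnit (ofPoly (MvPolynomial.X 0) * ofPoly (MvPolynomial.X 1) *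
    ofPoly (MvPolynomial.X 0 - MvPolynomial.X 1)) := by
  rw [← map_mul, ← map_mul]
  exact IsLocalization.Away.algebraMap_isUnit _

/-- `z₁` as a unit of the coefficient ring. -/
def z₁ : CoeffRingˣ := (isUnit_of_mul_isUnit_left (isUnit_of_mul_isUnit_left isUnit_prod)).unit

/-- `z₂` as a unit of the coefficient ring. -/
def z₂ : CoeffRingˣ := (isUnit_of_mul_isUnit_right (isUnit_of_mul_isUnit_left isUnit_prod)).unit

/-- `z₁ - z₂` as a unit of the coefficient ring. -/
def z₁₂ : CoeffRingˣ := (isUnit_of_mul_isUnit_right isUnit_prod).unit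

/-- Laurent series in `y` whose coefficients are Laurent polynomials in `x`.  This ring contains
`ℂ[[y/x]][x^{±1}, y^{±1}]`, where the expansions in a region `|x| > |y| > 0` live. -/
abbrev ExpansionRing : Type := LaurentSeries ℂ[T;T⁻¹]

/-- The variable `x`. -/
def varX : ExpansionRing := HahnSeries.C (LaurentPolynomial.T 1)

/-- The variable `y`. -/
def varY : ExpansionRing := HahnSeries.single 1 1

theorem isUnit_varX : IsUnit varX := (LaurentPolynomial.isUnit_T 1).map HahnSeries.C

theorem isUnit_varY : IsUnit varY :=
  IsUnit.of_mul_eq_one (HahnSeries.single (-1) 1) (by simp [varY])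

theorem isUnit_varX_add (a : ℂ[T;T⁻¹]) : IsUnit (varX + HahnSeries.single 1 a) := by
  have h : IsUnit (HahnSeries.C (LaurentPolynomial.T (-1)) * (varX + HahnSeries.single 1 a) :
      ExpansionRing) := by
    apply HahnSeries.isUnit_of_orderTop_pos
    have : (HahnSeries.C (LaurentPolynomial.T (-1)) * (varX + HahnSeries.single 1 a) - 1 :
        ExpansionRing) = HahnSeries.single 1 (LaurentPolynomial.T (-1) * a) := by
      rw [mul_add, varX, ← map_mul, ← LaurentPolynomial.T_add]
      simp
    rw [this]
    exact HahnSeries.lt_orderTop_single Int.one_pos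
  exact isUnit_of_mul_isUnit_right h

theorem isUnit_varX_add_varY : IsUnit (varX + varY) := isUnit_varX_add 1

theorem isUnit_varX_sub_varY : IsUnit (varX - varY) := by
  have := isUnit_varX_add (-1)
  rwa [HahnSeries.single_neg, ← sub_eq_add_neg] at this

/-- The expansion homomorphism that sends `z₁` to `p` and `z₂` to `q`. -/
def expand (p q : ExpansionRing) (h : IsUnit (p * q * (p - q))) : CoeffRing →+* ExpansionRing :=
  IsLocalization.Away.lift (MvPolynomial.X 0 * MvPolynomial.X 1 *
    (MvPolynomial.X 0 - MvPolynomial.X 1) : MvPolynomial (Fin 2) ℂ)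
    (g := (MvPolynomial.aeval ![p, q] : MvPolynomial (Fin 2) ℂ →ₐ[ℂ] ExpansionRing).toRingHom)
    (by simpa using h)

/-- Expansion in `|z₁| > |z₂| > 0`, with `x = z₁`, `y = z₂`. -/
def expandProd : CoeffRing →+* ExpansionRing :=
  expand varX varY ((isUnit_varX.mul isUnit_varY).mul isUnit_varX_sub_varY)

/-- Expansion in `|z₂| > |z₁ - z₂| > 0`, with `x = z₂`, `y = z₁ - z₂`. -/
def expandIter : CoeffRing →+* ExpansionRing :=
  expand (varX + varY) varX
    ((isUnit_varX_add_varY.mul isUnit_varX).mul (by simpa using isUnit_varY))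

/-- Expansion in `|z₂| > |z₁| > 0`, with `x = z₂`, `y = z₁`. -/
def expandProd' : CoeffRing →+* ExpansionRing :=
  expand varY varX
    ((isUnit_varY.mul isUnit_varX).mul (by simpa using isUnit_varX_sub_varY.neg))

/-! ### Formal series and systems of differential equations -/

/-- Formal series `∑_{α, β ∈ ℂ} φ(α, β) x^α y^β` with complex exponents. -/
abbrev FormalSeries : Type := ℂ → ℂ → ℂ

/-- `∂/∂x` -/
def dX (φ : FormalSeries) : FormalSeries := fun α β => (α + 1) * φ (α + 1) β

/-- `∂/∂y` -/
def dY (φ : FormalSeries) : FormalSeries := fun α β => (β + 1) * φ α (β + 1)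

/-- The product of an expansion `s = ∑_{p, q ∈ ℤ} s_{p,q} x^p y^q` and a formal series `φ`.
The `y`-exponents `q` of `s` are bounded below and every `q` comes with finitely many `p`.  Hence
the sum has finitely many nonzero terms whenever the `y`-exponents of `φ` in each class modulo `ℤ`
are bounded below, which is so for all the series below by lower truncation. -/
def act (s : ExpansionRing) (φ : FormalSeries) : FormalSeries := fun α β =>
  ∑ᶠ p : ℤ × ℤ, (s.coeff p.2).coeff p.1 * φ (α - p.1) (β - p.2)

/-- The series `φ` satisfies the expansion (along `ι`) of the equation
`D^m φ + a_1 D^{m-1} φ + ⋯ + a_m φ = 0`. -/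
def SatisfiesEquation (ι : CoeffRing →+* ExpansionRing) (D : FormalSeries → FormalSeries)
    (m : ℕ) (a : ℕ → CoeffRing) (φ : FormalSeries) : Prop :=
  D^[m] φ + ∑ k ∈ Finset.Icc 1 m, act (ι (a k)) (D^[m - k] φ) = 0

section Correlators

variable {V : Type*} [AddCommGroup V] [Module ℂ V] {𝒱 : VertexOperatorAlgebra V}
  {W₀ : Type*} [AddCommGroup W₀] [Module ℂ W₀] {W₁ : Type*} [AddCommGroup W₁] [Module ℂ W₁]
  {W₂ : Type*} [AddCommGroup W₂] [Module ℂ W₂] {W₃ : Type*} [AddCommGroup W₃] [Module ℂ W₃]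
  {U : Type*} [AddCommGroup U] [Module ℂ U]
  {Y₁ : V → ℤ → Module.End ℂ W₁} {Y₂ : V → ℤ → Module.End ℂ W₂} {Y₃ : V → ℤ → Module.End ℂ W₃}
  {YU : V → ℤ → Module.End ℂ U} {M₀ : DiscreteModule 𝒱 W₀}

/-- The series `⟨w₀, I(w₁, x) J(w₂, y) w₃⟩`. -/
def prodSeries (I : IntertwiningOperator 𝒱 Y₁ YU M₀.contragredient)
    (J : IntertwiningOperator 𝒱 Y₂ Y₃ YU) (w₀ : W₀) (w₁ : W₁) (w₂ : W₂) (w₃ : W₃) :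
    FormalSeries := fun α β =>
  (I.mode w₁ (-α - 1) (J.mode w₂ (-β - 1) w₃) : Module.Dual ℂ W₀) w₀

/-- The series `⟨w₀, I(J(w₁, y) w₂, x) w₃⟩`. -/
def iterSeries (J : IntertwiningOperator 𝒱 Y₁ Y₂ YU)
    (I : IntertwiningOperator 𝒱 YU Y₃ M₀.contragredient) (w₀ : W₀) (w₁ : W₁) (w₂ : W₂) (w₃ : W₃) :
    FormalSeries := fun α β =>
  (I.mode (J.mode w₁ (-β - 1) w₂) (-α - 1) w₃ : Module.Dual ℂ W₀) w₀

end Correlators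

/-- The system
`∂^m φ/∂z₁^m + ∑_{k=1}^m a_k ∂^{m-k} φ/∂z₁^{m-k} = 0`,
`∂^n φ/∂z₂^n + ∑_{l=1}^n b_l ∂^{n-l} φ/∂z₂^{n-l} = 0`. -/
structure DiffSystem where
  m : ℕ
  n : ℕ
  m_pos : 0 < m
  n_pos : 0 < n
  a : ℕ → CoeffRing
  b : ℕ → CoeffRing

namespace DiffSystem

variable (E : DiffSystem)

/-- `φ` satisfies the expansion of the system in `|z₁| > |z₂| > 0` (`x = z₁`, `y = z₂`). -/
def SatisfiedByProd (φ : FormalSeries) : Prop :=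
  SatisfiesEquation expandProd dX E.m E.a φ ∧ SatisfiesEquation expandProd dY E.n E.b φ

/-- `φ` satisfies the expansion of the system in `|z₂| > |z₁ - z₂| > 0`
(`x = z₂`, `y = z₁ - z₂`, so that `∂/∂z₁ = ∂/∂y` and `∂/∂z₂ = ∂/∂x - ∂/∂y`). -/
def SatisfiedByIter (φ : FormalSeries) : Prop :=
  SatisfiesEquation expandIter dY E.m E.a φ ∧
    SatisfiesEquation expandIter (fun ψ => dX ψ - dY ψ) E.n E.b φ

/-- `φ` satisfies the expansion of the system in `|z₂| > |z₁| > 0` (`x = z₂`, `y = z₁`). -/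
def SatisfiedByProd' (φ : FormalSeries) : Prop :=
  SatisfiesEquation expandProd' dY E.m E.a φ ∧ SatisfiesEquation expandProd' dX E.n E.b φ

end DiffSystem

/-! ### Regular singular points -/

/-- The possible singular points. -/
inductive SingularPoint : Type
  /-- `z₁ = 0` -/
  | z₁_zero
  /-- `z₂ = 0` -/
  | z₂_zero
  /-- `z₁ = ∞` -/
  | z₁_infty
  /-- `z₂ = ∞` -/
  | z₂_infty
  /-- `z₁ = z₂` -/
  | z₁_eq_z₂
  /-- `z₁⁻¹ (z₁ - z₂) = 0` -/
  | z₁_ratio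
  /-- `z₂⁻¹ (z₁ - z₂) = 0` -/
  | z₂_ratio

namespace SingularPoint

/-- The functions in the coefficient ring that are regular at the singular point, i.e. have no
pole along it.  For the points `ζ = 0` with `ζ = z₂⁻¹ (z₁ - z₂)` or `ζ = z₁⁻¹ (z₁ - z₂)`,
the equations are to become ordinary differential equations in the variable `ζ`, so these are
the functions of `ζ` alone without pole at `ζ = 0`, that is the Laurent polynomials in
`z₁ z₂⁻¹`, which is `1 + ζ`, respectively `(1 - ζ)⁻¹`. -/
def regularFunctions : SingularPoint → Subalgebra ℂ CoeffRing
  | z₁_zero => Algebra.adjoin ℂ {↑z₁, ↑z₂, ↑z₂⁻¹, ↑z₁₂⁻¹}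
  | z₂_zero => Algebra.adjoin ℂ {↑z₁, ↑z₁⁻¹, ↑z₂, ↑z₁₂⁻¹}
  | z₁_infty => Algebra.adjoin ℂ {↑z₁⁻¹, ↑z₂, ↑z₂⁻¹, ↑(z₁ * z₁₂⁻¹)}
  | z₂_infty => Algebra.adjoin ℂ {↑z₁, ↑z₁⁻¹, ↑z₂⁻¹, ↑(z₂ * z₁₂⁻¹)}
  | z₁_eq_z₂ => Algebra.adjoin ℂ {↑z₁, ↑z₁⁻¹, ↑z₂, ↑z₂⁻¹}
  | z₁_ratio => Algebra.adjoin ℂ {↑(z₁ * z₂⁻¹), ↑(z₂ * z₁⁻¹)}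
  | z₂_ratio => Algebra.adjoin ℂ {↑(z₁ * z₂⁻¹), ↑(z₂ * z₁⁻¹)}

/-- The factor `e` such that, in local coordinates at the singular point, `∂/∂z₁` multiplied
by `e` becomes the derivative in these coordinates multiplied by the equation of the singular
point (up to factors that are regular and nonzero there).  At `z₁ = ∞` the coordinate is
`t = z₁⁻¹`, and `z₁ ∂/∂z₁ = - t ∂/∂t`.  At `ζ = z₂⁻¹ (z₁ - z₂) = 0`, one has
`(z₁ - z₂) ∂/∂z₁ = ζ ∂/∂ζ` in the coordinates `(ζ, z₂)`, and at `ζ = z₁⁻¹ (z₁ - z₂) = 0`, one has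
`(z₁ - z₂) ∂/∂z₁ = ζ (z₁ ∂/∂z₁ + (1 - ζ) ∂/∂ζ)` in the coordinates `(ζ, z₁)`. -/
def scale₁ : SingularPoint → CoeffRingˣ
  | z₁_zero => z₁
  | z₂_zero => z₂
  | z₁_infty => z₁
  | z₂_infty => z₂⁻¹
  | z₁_eq_z₂ => z₁₂
  | z₁_ratio => z₁₂
  | z₂_ratio => z₁₂

/-- The same for `∂/∂z₂`. -/
def scale₂ : SingularPoint → CoeffRingˣ
  | z₁_zero => z₁
  | z₂_zero => z₂
  | z₁_infty => z₁⁻¹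
  | z₂_infty => z₂
  | z₁_eq_z₂ => z₁₂
  | z₁_ratio => z₁₂
  | z₂_ratio => z₁₂

end SingularPoint

/-- The singular point `S` of the system is regular: in local coordinates around `S`, the
coefficient that accompanies the derivative of order `k` less than the leading one has a pole of
order at most `k` along `S`, in both equations.  Equivalently, multiplied by `e^m` the first
equation is `e^m ∂^m φ + ∑ (e^k a_k) e^{m-k} ∂^{m-k} φ = 0` with all `e^k a_k` regular. -/
def DiffSystem.IsRegularAt (E : DiffSystem) (S : SingularPoint) : Prop :=
  (∀ k ∈ Finset.Icc 1 E.m, (S.scale₁ : CoeffRing) ^ k * E.a k ∈ S.regularFunctions) ∧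
    ∀ l ∈ Finset.Icc 1 E.n, (S.scale₂ : CoeffRing) ^ l * E.b l ∈ S.regularFunctions

end VOA

end

noncomputable section

namespace VOA

open scoped LaurentPolynomial

/-! ### The module of formal series over the expansion ring -/

/-! A correlator with `w₁`, `w₂`, `w₃` at `z₁`, `z₂`, `0` and `w₀` at infinity behaves like a
meromorphic function of the point `x` where a further vertex operator `Y(v, x)` is inserted, with
poles only at these four points. The residue theorem for its products with `(x - z₁)⁻¹`, `(x -
z₂)⁻¹` and `xⁿ` gives linear relations over `R` (`CorrelatorRelations`). Formally they are
consequences of the Jacobi identity (`prodCorrelator_relations`, `iterCorrelator_relations`), and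
nothing else about the intermediate modules enters the construction of the equations.

For `v` of weight `h > 0`, replacing `w₁` by `v₋₁ w₁` raises the total weight by `h`, while the
relations express the result by correlators whose total weight is raised by at most `h - 1`; the
same happens at the other three points. By `C₁`-cofiniteness every vector of large weight is a sum
of such `v₋₁ w`, so all correlators lie in the span of those below a fixed total weight
(`Reducible.exists_bound`), and this span is finitely generated (`boundedSpan_fg`).

To control poles, everything is done over the algebra `O` of functions regular at the singular
point. A correlator of homogeneous vectors of weights `rᵢ` is multiplied by the product of `sᵢ ^
⌊rᵢ⌋`, with units `sᵢ` adapted to the singular point (`SingularPoint.scales`), and then the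
relations have coefficients in `O` (`CorrelatorRelations.reducible_singularPoint`). The points at
infinity need a modified relation, `CorrelatorRelations.first_infinity`. Now `∂/∂z₁` acts as `L(-1)`
on `w₁` and raises the weight by one, so for homogeneous vectors the elements `s₁^k ∂^k φ`, up to a
fixed unit, lie in a finitely generated module over the Noetherian ring `O`. Hence one of them is an
`O`-combination of its predecessors (`exists_recurrence`), which is the equation together with its
pole bounds.

The argument is applied once, to the product of all series that satisfy the relations
(`universalCorrelator`). Therefore one system serves all intertwining operators and all three
regions. -/

/-- Formal series in `x` with complex exponents. -/
def XSeries : Type := ℂ → ℂ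

instance : AddCommGroup XSeries := inferInstanceAs (AddCommGroup (ℂ → ℂ))

instance : Module ℂ XSeries := inferInstanceAs (Module ℂ (ℂ → ℂ))

namespace XSeries

/-- Multiplication by the powers of `x`. -/
def shift : Multiplicative ℤ →* Module.End ℂ XSeries where
  toFun k := { toFun := fun f α => f (α - (k.toAdd : ℤ)), map_add' := fun _ _ => rfl,
               map_smul' := fun _ _ => rfl }
  map_one' := by
    ext f
    funext α
    show f (α - ((0 : ℤ) : ℂ)) = f α
    simp
  map_mul' k l := by
    ext f
    funext α
    show f (α - ((k.toAdd + l.toAdd : ℤ) : ℂ)) = f (α - (k.toAdd : ℤ) - (l.toAdd : ℤ))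
    congr 1
    push_cast
    ring

/-- The action of Laurent polynomials on formal series in `x`. -/
def laurentAction : ℂ[T;T⁻¹] →ₐ[ℂ] Module.End ℂ XSeries := AddMonoidAlgebra.lift ℂ _ ℤ shift

instance : Module ℂ[T;T⁻¹] XSeries := Module.compHom XSeries laurentAction.toRingHom

theorem smul_def (a : ℂ[T;T⁻¹]) (f : XSeries) : a • f = laurentAction a f := rfl

theorem smul_apply (a : ℂ[T;T⁻¹]) (f : XSeries) (α : ℂ) :
    (a • f) α = a.coeff.sum fun p c => c * f (α - (p : ℂ)) := by
  rw [smul_def, laurentAction, AddMonoidAlgebra.lift_apply, Finsupp.sum, LinearMap.sum_apply]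
  rw [Finsupp.sum]
  have h := Finset.sum_apply α a.coeff.support
    (fun p : ℤ => (fun α : ℂ => a.coeff p * f (α - (p : ℂ)) : ℂ → ℂ))
  exact h

end XSeries

/-- The series whose `y`-exponents are bounded below in each class modulo `ℤ`, uniformly in `x`. -/
def lowerTruncated : Submodule ℂ FormalSeries where
  carrier := {φ | ∀ β : ℂ, ∃ N : ℕ, ∀ k : ℕ, N ≤ k → ∀ α : ℂ, φ α (β - k) = 0}
  zero_mem' := fun _ => ⟨0, fun _ _ _ => rfl⟩
  add_mem' := by
    intro φ ψ hφ hψ β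
    obtain ⟨N, hN⟩ := hφ β
    obtain ⟨N', hN'⟩ := hψ β
    refine ⟨max N N', fun k hk α => ?_⟩
    rw [Pi.add_apply, Pi.add_apply, hN k (le_of_max_le_left hk), hN' k (le_of_max_le_right hk),
      add_zero]
  smul_mem' := by
    intro c φ hφ β
    obtain ⟨N, hN⟩ := hφ β
    exact ⟨N, fun k hk α => by rw [Pi.smul_apply, Pi.smul_apply, hN k hk, smul_zero]⟩

/-- The part of a lower truncated series with `y`-exponents in `β + ℤ`, as a Hahn series in `y`. -/
def slice (φ : lowerTruncated) (β : ℂ) : HahnModule ℤ ℂ[T;T⁻¹] XSeries :=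
  HahnModule.of _
  { coeff := fun q α => φ.1 α (β + (q : ℂ))
    isPWO_support' := by
      obtain ⟨N, hN⟩ := φ.2 β
      refine (BddBelow.isWF ⟨-(N : ℤ), fun q hq => ?_⟩).isPWO
      by_contra hlt
      push Not at hlt
      apply hq
      funext α
      have h := hN (-q).toNat (by omega) α
      have h2 : (((-q).toNat : ℕ) : ℂ) = -(q : ℂ) := by
        have : (((-q).toNat : ℕ) : ℤ) = -q := by omega
        exact_mod_cast congrArg (Int.cast : ℤ → ℂ) this
      rw [h2, sub_neg_eq_add] at h
      exact h }

theorem slice_coeff (φ : lowerTruncated) (β : ℂ) (q : ℤ) (α : ℂ) :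
    ((HahnModule.of ℂ[T;T⁻¹]).symm (slice φ β)).coeff q α = φ.1 α (β + (q : ℂ)) := rfl

/-- The exponents of `s` are integers, so `act` preserves each class of `y`-exponents modulo `ℤ`,
and on such a class it is the scalar multiplication of Hahn series. The module axioms for `act` are
inherited from `HahnModule` in this way. -/
theorem act_eq_coeff (s : ExpansionRing) (φ : lowerTruncated) (α β : ℂ) (n : ℤ) :
    act s φ.1 α (β + (n : ℂ)) =
      ((HahnModule.of ℂ[T;T⁻¹]).symm (s • slice φ β)).coeff n α := by
  classical
  rw [HahnModule.coeff_smul]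
  set D := Finset.VAddAntidiagonal n (Set.VAddAntidiagonal.finite_of_isPWO s.isPWO_support
    ((HahnModule.of ℂ[T;T⁻¹]).symm (slice φ β)).isPWO_support n) with hD
  have hmem : ∀ p q : ℤ, (s.coeff q).coeff p * φ.1 (α - (p : ℂ)) (β + (n : ℂ) - (q : ℂ)) ≠ 0 →
      (q, n - q) ∈ D := by
    intro p q h
    rw [hD, Finset.mem_vaddAntidiagonal]
    refine ⟨?_, ?_, ?_⟩
    · intro h0
      apply h
      rw [h0]
      simp
    · intro h0
      apply h
      have h1 := slice_coeff φ β (n - q) (α - (p : ℂ))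
      rw [h0] at h1
      have h2 : β + (n : ℂ) - (q : ℂ) = β + ((n - q : ℤ) : ℂ) := by push_cast; ring
      rw [h2, ← h1]
      exact mul_zero _
    · simp
  have hfst : Set.InjOn Prod.fst (D : Set (ℤ × ℤ)) := by
    rintro ⟨a, b⟩ h ⟨a', b'⟩ h' (rfl : a = a')
    rw [Finset.mem_coe, hD, Finset.mem_vaddAntidiagonal] at h h'
    have h1 : a + b = n := h.2.2
    have h2 : a + b' = n := h'.2.2
    rw [Prod.mk.injEq]
    exact ⟨rfl, by omega⟩
  have hrhs : (∑ ij ∈ D, s.coeff ij.1 •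
        ((HahnModule.of ℂ[T;T⁻¹]).symm (slice φ β)).coeff ij.2) α =
      ∑ ij ∈ D, (s.coeff ij.1).coeff.sum
        fun p c => c * φ.1 (α - (p : ℂ)) (β + (n : ℂ) - (ij.1 : ℂ)) := by
    have h := Finset.sum_apply α D (fun ij : ℤ × ℤ => (s.coeff ij.1 •
        ((HahnModule.of ℂ[T;T⁻¹]).symm (slice φ β)).coeff ij.2 : ℂ → ℂ))
    refine h.trans (Finset.sum_congr rfl fun ij hij => ?_)
    rw [hD, Finset.mem_vaddAntidiagonal] at hij
    have h1 : ij.1 + ij.2 = n := hij.2.2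
    refine (XSeries.smul_apply _ _ _).trans (Finsupp.sum_congr fun p _ => ?_)
    rw [slice_coeff]
    have h2 : β + (ij.2 : ℂ) = β + (n : ℂ) - (ij.1 : ℂ) := by
      rw [← h1]
      push_cast
      ring
    rw [h2]
  rw [hrhs]
  -- Enlarging the range of `p` to the union of the supports adds only zeros and turns the iterated
  -- sum into a sum over a rectangle, which contains the support of the sum in `act`.
  set Q := D.image Prod.fst
  set P := Q.biUnion fun q => (s.coeff q).coeff.support
  have hsum : ∑ ij ∈ D, (s.coeff ij.1).coeff.sum
        (fun p c => c * φ.1 (α - (p : ℂ)) (β + (n : ℂ) - (ij.1 : ℂ))) =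
      ∑ q ∈ Q, ∑ p ∈ P, (s.coeff q).coeff p * φ.1 (α - (p : ℂ)) (β + (n : ℂ) - (q : ℂ)) := by
    rw [Finset.sum_image hfst]
    refine Finset.sum_congr rfl fun ij hij => ?_
    rw [Finsupp.sum]
    refine Finset.sum_subset ?_ fun p _ hp => ?_
    · exact Finset.subset_biUnion_of_mem (fun q => (s.coeff q).coeff.support)
        (Finset.mem_image_of_mem Prod.fst hij)
    · rw [Finsupp.notMem_support_iff.mp hp, zero_mul]
  rw [hsum, ← Finset.sum_product_right']
  unfold act
  refine finsum_eq_sum_of_support_subset _ ?_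
  rintro ⟨p, q⟩ h
  have h1 : q ∈ Q := Finset.mem_image_of_mem Prod.fst (hmem p q h)
  rw [Finset.mem_coe, Finset.mem_product]
  refine ⟨Finset.mem_biUnion.mpr ⟨q, h1, ?_⟩, h1⟩
  rw [Finsupp.mem_support_iff]
  exact left_ne_zero_of_mul h

theorem act_mem (s : ExpansionRing) (φ : lowerTruncated) : act s φ.1 ∈ lowerTruncated := by
  intro β
  -- `-k` is below the order of the product once `k ≥ 1 - order`, and this bound does not involve
  -- `α`.
  refine ⟨(1 - ((HahnModule.of ℂ[T;T⁻¹]).symm (s • slice φ β)).order).toNat, fun k hk α => ?_⟩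
  have h := act_eq_coeff s φ α β (-k)
  rw [HahnSeries.coeff_eq_zero_of_lt_order (by omega)] at h
  rw [sub_eq_add_neg]
  push_cast at h
  exact h

instance : SMul ExpansionRing lowerTruncated := ⟨fun s φ => ⟨act s φ.1, act_mem s φ⟩⟩

theorem coe_smul_expansion (s : ExpansionRing) (φ : lowerTruncated) :
    ((s • φ : lowerTruncated) : FormalSeries) = act s φ.1 := rfl

theorem slice_smul (s : ExpansionRing) (φ : lowerTruncated) (β : ℂ) :
    slice (s • φ) β = s • slice φ β := by
  refine HahnModule.ext _ _ ?_
  funext n α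
  rw [slice_coeff, coe_smul_expansion, act_eq_coeff]

theorem slice_add (φ ψ : lowerTruncated) (β : ℂ) : slice (φ + ψ) β = slice φ β + slice ψ β := rfl

theorem slice_zero (β : ℂ) : slice 0 β = 0 := rfl

theorem slice_ext {φ ψ : lowerTruncated} (h : ∀ β, slice φ β = slice ψ β) : φ = ψ := by
  refine Subtype.ext ?_
  funext α β
  have h1 := congrFun (congrFun (congrArg (fun x => ((HahnModule.of ℂ[T;T⁻¹]).symm x).coeff)
    (h β)) 0) α
  simpa [slice_coeff] using h1

instance : Module ExpansionRing lowerTruncated where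
  one_smul φ := slice_ext fun β => by rw [slice_smul, one_smul]
  mul_smul s t φ := slice_ext fun β => by simp only [slice_smul, mul_smul]
  smul_zero s := slice_ext fun β => by rw [slice_smul, slice_zero, smul_zero]
  smul_add s φ ψ := slice_ext fun β => by simp only [slice_smul, slice_add, smul_add]
  add_smul s t φ := slice_ext fun β => by simp only [slice_smul, slice_add, add_smul]
  zero_smul φ := slice_ext fun β => by rw [slice_smul, slice_zero, zero_smul]

theorem coeff_C_mul_T (c : ℂ) (k p : ℤ) :
    (LaurentPolynomial.C c * LaurentPolynomial.T k : ℂ[T;T⁻¹]).coeff p = if k = p then c else 0 := by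
  classical
  rw [← LaurentPolynomial.single_eq_C_mul_T, AddMonoidAlgebra.coeff_single, Finsupp.single_apply]

theorem single_smul_apply (n k : ℤ) (c : ℂ) (φ : lowerTruncated) (α β : ℂ) :
    ((HahnSeries.single n (LaurentPolynomial.C c * LaurentPolynomial.T k) : ExpansionRing) • φ).1
      α β = c * φ.1 (α - (k : ℂ)) (β - (n : ℂ)) := by
  rw [coe_smul_expansion]
  unfold act
  rw [finsum_eq_single _ (k, n)]
  · rw [HahnSeries.coeff_single_same, coeff_C_mul_T, if_pos rfl]
  · rintro ⟨p, q⟩ h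
    rcases eq_or_ne q n with rfl | hq
    · have hp : k ≠ p := by
        rintro rfl
        exact h rfl
      rw [HahnSeries.coeff_single_same, coeff_C_mul_T, if_neg hp, zero_mul]
    · rw [HahnSeries.coeff_single_of_ne hq]
      exact zero_mul _

/-- The expansion of `(x + c y)^n` in nonnegative powers of `y`. -/
def binomialSeries (c : ℂ) (n : ℤ) : ExpansionRing :=
  HahnSeries.ofSuppBddBelow
    (fun q : ℤ => if 0 ≤ q then LaurentPolynomial.C ((Ring.choose n q.toNat : ℤ) * c ^ q.toNat) *
      LaurentPolynomial.T (n - q) else 0)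
    ⟨0, fun q hq => by
      by_contra h
      exact hq (by simp only [if_neg h])⟩

theorem binomialSeries_coeff_nat (c : ℂ) (n : ℤ) (i : ℕ) :
    (binomialSeries c n).coeff i = LaurentPolynomial.C ((Ring.choose n i : ℤ) * c ^ i) *
      LaurentPolynomial.T (n - i) := by
  simp [binomialSeries]

theorem binomialSeries_coeff_neg (c : ℂ) (n : ℤ) {q : ℤ} (hq : q < 0) :
    (binomialSeries c n).coeff q = 0 := by
  simp [binomialSeries, hq.not_ge]

theorem binomialSeries_zero (c : ℂ) : binomialSeries c 0 = 1 := by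
  ext q : 2
  rcases lt_or_ge q 0 with hq | hq
  · rw [binomialSeries_coeff_neg c 0 hq, HahnSeries.coeff_one, if_neg hq.ne]
  · lift q to ℕ using hq
    rw [binomialSeries_coeff_nat, HahnSeries.coeff_one]
    cases q with
    | zero => simp
    | succ q =>
      rw [Ring.choose_zero_succ, if_neg (by omega)]
      simp

/-- Pascal's rule for `Ring.choose`, which holds for negative `n` as well. -/
theorem binomialSeries_succ (c : ℂ) (n : ℤ) :
    binomialSeries c (n + 1) =
      binomialSeries c n * (varX + HahnSeries.single 1 (LaurentPolynomial.C c)) := by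
  ext q : 2
  have h1 : ∀ q : ℤ, (binomialSeries c n * HahnSeries.single 1 (LaurentPolynomial.C c)).coeff q =
      (binomialSeries c n).coeff (q - 1) * LaurentPolynomial.C c := by
    intro q
    have := HahnSeries.coeff_mul_single_add (r := LaurentPolynomial.C c)
      (x := binomialSeries c n) (a := q - 1) (b := 1)
    rwa [sub_add_cancel] at this
  rw [mul_add, HahnSeries.coeff_add', Pi.add_apply, h1, varX, HahnSeries.C_apply,
    HahnSeries.coeff_mul_single_zero]
  rcases lt_or_ge q 0 with hq | hq
  · rw [binomialSeries_coeff_neg _ _ hq, binomialSeries_coeff_neg _ _ hq,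
      binomialSeries_coeff_neg _ _ (by omega)]
    simp
  · lift q to ℕ using hq
    rw [binomialSeries_coeff_nat, binomialSeries_coeff_nat]
    cases q with
    | zero =>
      rw [binomialSeries_coeff_neg _ _ (by simp)]
      rw [mul_assoc, ← LaurentPolynomial.T_add]
      simp
    | succ q =>
      have h2 : ((q + 1 : ℕ) : ℤ) - 1 = (q : ℤ) := by push_cast; ring
      rw [h2, binomialSeries_coeff_nat, Ring.choose_succ_succ, mul_assoc,
        ← LaurentPolynomial.T_add]
      have h3 : n - ((q + 1 : ℕ) : ℤ) + 1 = n - q := by push_cast; ring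
      have h4 : n + 1 - ((q + 1 : ℕ) : ℤ) = n - q := by push_cast; ring
      rw [h3, h4]
      push_cast
      simp only [map_add, map_mul, map_pow]
      ring

/-- The recursion runs in both directions because `x + c y` is a unit. Negative powers of `z₁ - z₂`,
or of `z₁ = x + y` for iterates, thus act by explicit binomial sums. -/
theorem binomialSeries_eq_zpow (c : ℂ) (u : ExpansionRingˣ)
    (hu : (u : ExpansionRing) = varX + HahnSeries.single 1 (LaurentPolynomial.C c)) (n : ℤ) :
    binomialSeries c n = ((u ^ n : ExpansionRingˣ) : ExpansionRing) := by
  induction n using Int.induction_on with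
  | zero => simp [binomialSeries_zero]
  | succ n ih => rw [binomialSeries_succ, ih, ← hu, zpow_add_one, Units.val_mul]
  | pred n ih =>
    have h := binomialSeries_succ c (-(n : ℤ) - 1)
    rw [sub_add_cancel, ih, ← hu] at h
    rw [zpow_sub_one, Units.val_mul, h, mul_assoc, Units.mul_inv, mul_one]

theorem binomialSeries_smul_apply (c : ℂ) (n : ℤ) (φ : lowerTruncated) (α β : ℂ) :
    (binomialSeries c n • φ).1 α β =
      ∑ᶠ i : ℕ, ((Ring.choose n i : ℤ) * c ^ i) *
        φ.1 (α - (n : ℂ) + (i : ℂ)) (β - (i : ℂ)) := by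
  rw [coe_smul_expansion]
  unfold act
  have hinj : Function.Injective fun i : ℕ => ((n - i, i) : ℤ × ℤ) := by
    intro i j h
    simpa using congrArg Prod.snd h
  rw [← finsum_mem_univ, finsum_mem_inter_support_eq' _ Set.univ
    (Set.range fun i : ℕ => ((n - i, i) : ℤ × ℤ)), finsum_mem_range hinj]
  · refine finsum_congr fun i => ?_
    rw [binomialSeries_coeff_nat, coeff_C_mul_T, if_pos rfl]
    have h : α - ((n - (i : ℤ) : ℤ) : ℂ) = α - (n : ℂ) + (i : ℂ) := by push_cast; ring
    rw [h]
    norm_cast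
  · rintro ⟨p, q⟩ h
    refine ⟨fun _ => ?_, fun _ => Set.mem_univ _⟩
    have h1 : (binomialSeries c n).coeff q ≠ 0 := by
      intro h0
      apply h
      simp only [h0]
      exact zero_mul _
    have hq : 0 ≤ q := by
      by_contra hq
      exact h1 (binomialSeries_coeff_neg c n (not_le.mp hq))
    lift q to ℕ using hq
    refine ⟨q, ?_⟩
    by_contra hne
    apply h
    have hp : n - (q : ℤ) ≠ p := fun h2 => hne (by rw [← h2])
    simp only [binomialSeries_coeff_nat, coeff_C_mul_T, if_neg hp]
    exact zero_mul _

end VOA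
end

noncomputable section

namespace VOA

open scoped LaurentPolynomial

theorem finsum_eq_sum_range {M : Type*} [AddCommMonoid M] {f : ℕ → M} {K : ℕ}
    (hf : ∀ i, K ≤ i → f i = 0) : ∑ᶠ i, f i = ∑ i ∈ Finset.range K, f i := by
  refine finsum_eq_sum_of_support_subset _ fun i hi => ?_
  rw [Finset.mem_coe, Finset.mem_range]
  by_contra h
  exact hi (hf i (not_lt.mp h))

/-! ### Formal series as a module over the coefficient ring -/

section Expand

variable (p q : ExpansionRing) (h : IsUnit (p * q * (p - q)))

theorem expand_ofPoly (f : MvPolynomial (Fin 2) ℂ) :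
    expand p q h (ofPoly f) = MvPolynomial.aeval ![p, q] f :=
  IsLocalization.Away.lift_eq _ _ _

theorem expand_z₁ : expand p q h z₁ = p := by
  refine (expand_ofPoly p q h (MvPolynomial.X 0)).trans ?_
  simp

theorem expand_z₂ : expand p q h z₂ = q := by
  refine (expand_ofPoly p q h (MvPolynomial.X 1)).trans ?_
  simp

theorem coe_z₁₂ : (z₁₂ : CoeffRing) = z₁ - z₂ :=
  map_sub ofPoly (MvPolynomial.X 0) (MvPolynomial.X 1)

theorem expand_z₁₂ : expand p q h z₁₂ = p - q := by
  rw [coe_z₁₂, map_sub, expand_z₁, expand_z₂]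

theorem expand_algebraMap (c : ℂ) :
    expand p q h (algebraMap ℂ CoeffRing c) = HahnSeries.single 0 (LaurentPolynomial.C c) := by
  have h1 := expand_ofPoly p q h (MvPolynomial.C c)
  have h2 : ofPoly (MvPolynomial.C c) = algebraMap ℂ CoeffRing c :=
    AlgHom.commutes ofPoly c
  rw [h2, MvPolynomial.aeval_C] at h1
  rw [h1, HahnSeries.algebraMap_apply', PowerSeries.algebraMap_apply, HahnSeries.ofPowerSeries_C]
  rfl

/-- The lower truncated series, on which the coefficient ring acts by its expansion. -/
def SeriesModule (_ : IsUnit (p * q * (p - q))) : Type := lowerTruncated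

instance : AddCommGroup (SeriesModule p q h) := inferInstanceAs (AddCommGroup lowerTruncated)

instance : Module ℂ (SeriesModule p q h) := inferInstanceAs (Module ℂ lowerTruncated)

instance : Module CoeffRing (SeriesModule p q h) := Module.compHom lowerTruncated (expand p q h)

variable {p q h}

namespace SeriesModule

/-- The underlying formal series. -/
def toSeries (φ : SeriesModule p q h) : FormalSeries := φ.1

variable (h) in
/-- A lower truncated series, as an element of the module. -/
def mk (f : FormalSeries) (hf : f ∈ lowerTruncated) : SeriesModule p q h := ⟨f, hf⟩

theorem toSeries_mk (f : FormalSeries) (hf : f ∈ lowerTruncated) : (mk h f hf).toSeries = f := rfl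

@[ext] theorem ext {φ ψ : SeriesModule p q h} (e : ∀ α β, φ.toSeries α β = ψ.toSeries α β) :
    φ = ψ := Subtype.ext (funext fun α => funext fun β => e α β)

theorem toSeries_add (φ ψ : SeriesModule p q h) (α β : ℂ) :
    (φ + ψ).toSeries α β = φ.toSeries α β + ψ.toSeries α β := rfl

theorem toSeries_smul (c : ℂ) (φ : SeriesModule p q h) (α β : ℂ) :
    (c • φ).toSeries α β = c * φ.toSeries α β := rfl

theorem toSeries_coeff_smul (a : CoeffRing) (φ : SeriesModule p q h) :
    (a • φ).toSeries = act (expand p q h a) φ.toSeries := rfl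

/-- Evaluation of a coefficient. -/
def coeffHom (α β : ℂ) : SeriesModule p q h →ₗ[ℂ] ℂ where
  toFun φ := φ.toSeries α β
  map_add' _ _ := rfl
  map_smul' _ _ := rfl

theorem toSeries_sum {ι : Type*} (s : Finset ι) (f : ι → SeriesModule p q h) (α β : ℂ) :
    (∑ i ∈ s, f i).toSeries α β = ∑ i ∈ s, (f i).toSeries α β := map_sum (coeffHom α β) f s

instance : IsScalarTower ℂ CoeffRing (SeriesModule p q h) :=
  IsScalarTower.of_algebraMap_smul fun c φ => by
    ext α β
    have h1 := single_smul_apply 0 0 c φ α β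
    rw [LaurentPolynomial.T_zero, mul_one, ← expand_algebraMap p q h, Int.cast_zero, sub_zero,
      sub_zero] at h1
    exact h1

theorem zpow_smul_of_binomial {u : CoeffRingˣ} {c : ℂ}
    (hu : expand p q h u = varX + HahnSeries.single 1 (LaurentPolynomial.C c))
    (n : ℤ) (φ : SeriesModule p q h) (α β : ℂ) :
    (u ^ n • φ).toSeries α β = ∑ᶠ i : ℕ, ((Ring.choose n i : ℤ) * c ^ i) *
        φ.toSeries (α - (n : ℂ) + (i : ℂ)) (β - (i : ℂ)) := by
  have h1 := binomialSeries_smul_apply c n φ α β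
  rw [binomialSeries_eq_zpow c (Units.map (expand p q h : CoeffRing →* ExpansionRing) u) hu n,
    ← map_zpow] at h1
  exact h1

theorem zpow_smul_of_varX {u : CoeffRingˣ} (hu : expand p q h u = varX)
    (n : ℤ) (φ : SeriesModule p q h) (α β : ℂ) :
    (u ^ n • φ).toSeries α β = φ.toSeries (α - (n : ℂ)) β := by
  -- `x` is the case `c = 0` of `x + c y`, where only the term `i = 0` survives.
  rw [zpow_smul_of_binomial (c := 0) (by simpa using hu), finsum_eq_single _ 0]
  · simp
  · intro i hi
    simp [hi]

theorem zpow_smul_of_varY {u : CoeffRingˣ} (hu : expand p q h u = varY)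
    (n : ℤ) (φ : SeriesModule p q h) (α β : ℂ) :
    (u ^ n • φ).toSeries α β = φ.toSeries α (β - (n : ℂ)) := by
  have h1 : expand p q h ((u ^ n : CoeffRingˣ) : CoeffRing) = HahnSeries.single n 1 := by
    induction n using Int.induction_on with
    | zero => simp
    | succ n ih =>
      rw [zpow_add_one, Units.val_mul, map_mul, ih, hu, varY, HahnSeries.single_mul_single, mul_one]
    | pred n ih =>
      have hv : IsUnit varY := isUnit_varY
      refine hv.mul_left_injective ?_
      beta_reduce
      nth_rewrite 1 [← hu]
      rw [← map_mul, ← Units.val_mul, ← zpow_add_one, sub_add_cancel, ih, varY,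
        HahnSeries.single_mul_single, mul_one, sub_add_cancel]
  have h2 := single_smul_apply n 0 1 φ α β
  rw [map_one, LaurentPolynomial.T_zero, mul_one, ← h1, one_mul, Int.cast_zero, sub_zero] at h2
  exact h2

/-- The coefficients, indexed like the modes of vertex operators. -/
def mode (φ : SeriesModule p q h) (N M : ℂ) : ℂ := φ.toSeries (-N - 1) (-M - 1)

theorem ext_mode {φ ψ : SeriesModule p q h} (e : ∀ N M, φ.mode N M = ψ.mode N M) : φ = ψ := by
  ext α β
  have := e (-α - 1) (-β - 1)
  simpa [mode] using this

theorem mode_add (φ ψ : SeriesModule p q h) (N M : ℂ) :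
    (φ + ψ).mode N M = φ.mode N M + ψ.mode N M := rfl

theorem mode_smul (c : ℂ) (φ : SeriesModule p q h) (N M : ℂ) :
    (c • φ).mode N M = c * φ.mode N M := rfl

theorem mode_sum {ι : Type*} (s : Finset ι) (f : ι → SeriesModule p q h) (N M : ℂ) :
    (∑ i ∈ s, f i).mode N M = ∑ i ∈ s, (f i).mode N M := toSeries_sum s f _ _

theorem mode_zpow_smul_of_varX {u : CoeffRingˣ} (hu : expand p q h u = varX)
    (n : ℤ) (φ : SeriesModule p q h) (N M : ℂ) : (u ^ n • φ).mode N M = φ.mode (N + n) M := by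
  rw [mode, zpow_smul_of_varX hu, mode]
  congr 1
  ring

theorem mode_zpow_smul_of_varY {u : CoeffRingˣ} (hu : expand p q h u = varY)
    (n : ℤ) (φ : SeriesModule p q h) (N M : ℂ) : (u ^ n • φ).mode N M = φ.mode N (M + n) := by
  rw [mode, zpow_smul_of_varY hu, mode]
  congr 1
  ring

theorem mode_zpow_smul_of_binomial {u : CoeffRingˣ} {c : ℂ}
    (hu : expand p q h u = varX + HahnSeries.single 1 (LaurentPolynomial.C c))
    (n : ℤ) (φ : SeriesModule p q h) (N M : ℂ) {K : ℕ}
    (hK : ∀ N, ∀ i : ℕ, K ≤ i → φ.mode N (M + i) = 0) :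
    (u ^ n • φ).mode N M = ∑ i ∈ Finset.range K, ((Ring.choose n i : ℤ) * c ^ i) *
      φ.mode (N + n - i) (M + i) := by
  rw [mode, zpow_smul_of_binomial hu]
  have e : ∀ i : ℕ, φ.toSeries (-N - 1 - (n : ℂ) + (i : ℂ)) (-M - 1 - (i : ℂ)) =
      φ.mode (N + n - i) (M + i) := by
    intro i
    rw [mode]
    congr 1 <;> ring
  simp only [e]
  exact finsum_eq_sum_range fun i hi => by rw [hK _ i hi, mul_zero]

end SeriesModule

end Expand

/-! ### The associator and commutator formulas -/

section Formulas

variable {V W₁ W₂ W₃ : Type*}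
  [AddCommGroup W₁] [Module ℂ W₁] [AddCommGroup W₂] [Module ℂ W₂]
  [AddCommGroup W₃] [Module ℂ W₃]
  {Y₁ : V → ℤ → Module.End ℂ W₁} {Y₂ : V → ℤ → Module.End ℂ W₂}
  {Y₃ : V → ℤ → Module.End ℂ W₃} {I : W₁ → ℂ → W₂ →ₗ[ℂ] W₃}

/-- The Jacobi identity at `m = 0`, where one term remains on the left. -/
theorem JacobiIdentity.associator (hI : JacobiIdentity Y₁ Y₂ Y₃ I) (u : V) (a : W₁) (b : W₂)
    (l : ℤ) (n : ℂ) {K : ℕ} (h₁ : ∀ i : ℕ, K ≤ i → I a (n + i) b = 0)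
    (h₂ : ∀ i : ℕ, K ≤ i → Y₂ u i b = 0) :
    I (Y₁ u l a) n b = ∑ i ∈ Finset.range K, ((-1 : ℂ) ^ i * ((Ring.choose l i : ℤ) : ℂ)) •
        (Y₃ u (l - i) (I a (n + i) b) - (-1 : ℂ) ^ l • I a (l + n - i) (Y₂ u i b)) := by
  have h := hI u a b l 0 n
  rw [finsum_eq_single _ 0, finsum_eq_sum_range (K := K)] at h
  · simpa using h
  · intro i hi
    simp [h₁ i hi, h₂ i hi]
  · intro i hi
    rw [Ring.choose_zero_pos ℤ (Nat.pos_of_ne_zero hi)]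
    simp

/-- The Jacobi identity at `l = 0`. Since `I` is a mere function of its first argument, `h₀` is
needed to discard the terms beyond `K`. -/
theorem JacobiIdentity.commutator (hI : JacobiIdentity Y₁ Y₂ Y₃ I) (u : V) (a : W₁) (b : W₂)
    (m : ℤ) (n : ℂ) {K : ℕ} (h₁ : ∀ i : ℕ, K ≤ i → Y₁ u i a = 0)
    (h₀ : ∀ n, I 0 n = 0) :
    Y₃ u m (I a n b) = I a n (Y₂ u m b) +
      ∑ i ∈ Finset.range K, ((Ring.choose m i : ℤ) : ℂ) • I (Y₁ u i a) (m + n - i) b := by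
  have h := hI u a b 0 m n
  rw [finsum_eq_sum_range (K := K), finsum_eq_single _ 0] at h
  · have h2 : ∑ i ∈ Finset.range K, ((Ring.choose m i : ℤ) : ℂ) • I (Y₁ u i a) (m + n - i) b =
        Y₃ u m (I a n b) - I a n (Y₂ u m b) := by simpa using h
    rw [h2]
    abel
  · intro i hi
    rw [Ring.choose_zero_pos ℤ (Nat.pos_of_ne_zero hi)]
    simp
  · intro i hi
    simp [h₁ i hi, h₀]

end Formulas

/-! ### The relations between correlators -/

section Relations

variable {V : Type*} [AddCommGroup V] [Module ℂ V] {𝒱 : VertexOperatorAlgebra V}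
  {W₀ : Type*} [AddCommGroup W₀] [Module ℂ W₀] (M₀ : DiscreteModule 𝒱 W₀)
  {W₁ : Type*} [AddCommGroup W₁] [Module ℂ W₁] (M₁ : DiscreteModule 𝒱 W₁)
  {W₂ : Type*} [AddCommGroup W₂] [Module ℂ W₂] (M₂ : DiscreteModule 𝒱 W₂)
  {W₃ : Type*} [AddCommGroup W₃] [Module ℂ W₃] (M₃ : DiscreteModule 𝒱 W₃)
  {R : Type*} [CommRing R]
  {Q : Type*} [AddCommGroup Q] [Module ℂ Q] [Module R Q]

/-- The relations satisfied by correlators with insertions at `ζ₁`, `ζ₂`, `0` and `∞`, which express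
that the residues of `(x - ζ₁)⁻¹ ⟨w₀, Y(v, x) ⋯⟩`, `(x - ζ₂)⁻¹ ⟨w₀, Y(v, x) ⋯⟩`
and `xⁿ ⟨w₀, Y(v, x) ⋯⟩` add up to zero; here `ζ₁₂ = ζ₁ - ζ₂`. -/
structure CorrelatorRelations (ζ₁ ζ₂ ζ₁₂ : Rˣ)
    (Φ : W₀ →ₗ[ℂ] W₁ →ₗ[ℂ] W₂ →ₗ[ℂ] W₃ →ₗ[ℂ] Q) : Prop where
  first : ∀ (v : V) (w₀ : W₀) (w₁ : W₁) (w₂ : W₂) (w₃ : W₃) (K : ℕ),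
    (∀ k : ℕ, K ≤ k → M₀.oppositeMode v (-1 - k) w₀ = 0) →
    (∀ k : ℕ, K ≤ k → M₂.Y v k w₂ = 0) → (∀ k : ℕ, K ≤ k → M₃.Y v k w₃ = 0) →
    Φ w₀ (M₁.Y v (-1) w₁) w₂ w₃ = ∑ k ∈ Finset.range K,
      (ζ₁ ^ (k : ℤ) • Φ (M₀.oppositeMode v (-1 - k) w₀) w₁ w₂ w₃ +
        ζ₁₂ ^ (-1 - k : ℤ) • Φ w₀ w₁ (M₂.Y v k w₂) w₃ +
        ζ₁ ^ (-1 - k : ℤ) • Φ w₀ w₁ w₂ (M₃.Y v k w₃))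
  second : ∀ (v : V) (w₀ : W₀) (w₁ : W₁) (w₂ : W₂) (w₃ : W₃) (K : ℕ),
    (∀ k : ℕ, K ≤ k → M₀.oppositeMode v (-1 - k) w₀ = 0) →
    (∀ k : ℕ, K ≤ k → M₁.Y v k w₁ = 0) → (∀ k : ℕ, K ≤ k → M₃.Y v k w₃ = 0) →
    Φ w₀ w₁ (M₂.Y v (-1) w₂) w₃ = ∑ k ∈ Finset.range K,
      (ζ₂ ^ (k : ℤ) • Φ (M₀.oppositeMode v (-1 - k) w₀) w₁ w₂ w₃ +
        (-ζ₁₂) ^ (-1 - k : ℤ) • Φ w₀ (M₁.Y v k w₁) w₂ w₃ +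
        ζ₂ ^ (-1 - k : ℤ) • Φ w₀ w₁ w₂ (M₃.Y v k w₃))
  outer : ∀ (v : V) (n : ℤ) (w₀ : W₀) (w₁ : W₁) (w₂ : W₂) (w₃ : W₃) (K : ℕ),
    (∀ k : ℕ, K ≤ k → M₁.Y v k w₁ = 0) → (∀ k : ℕ, K ≤ k → M₂.Y v k w₂ = 0) →
    Φ (M₀.oppositeMode v n w₀) w₁ w₂ w₃ = Φ w₀ w₁ w₂ (M₃.Y v n w₃) +
      ∑ j ∈ Finset.range K, ((Ring.choose n j : ℤ) : ℂ) •
        (ζ₁ ^ (n - j : ℤ) • Φ w₀ (M₁.Y v j w₁) w₂ w₃ +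
          ζ₂ ^ (n - j : ℤ) • Φ w₀ w₁ (M₂.Y v j w₂) w₃)

/-- A multilinear map in four variables. -/
def mkMultilinear (f : W₀ → W₁ → W₂ → W₃ → Q)
    (a₀ : ∀ x y w₁ w₂ w₃, f (x + y) w₁ w₂ w₃ = f x w₁ w₂ w₃ + f y w₁ w₂ w₃)
    (s₀ : ∀ (c : ℂ) x w₁ w₂ w₃, f (c • x) w₁ w₂ w₃ = c • f x w₁ w₂ w₃)
    (a₁ : ∀ x y w₀ w₂ w₃, f w₀ (x + y) w₂ w₃ = f w₀ x w₂ w₃ + f w₀ y w₂ w₃)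
    (s₁ : ∀ (c : ℂ) x w₀ w₂ w₃, f w₀ (c • x) w₂ w₃ = c • f w₀ x w₂ w₃)
    (a₂ : ∀ x y w₀ w₁ w₃, f w₀ w₁ (x + y) w₃ = f w₀ w₁ x w₃ + f w₀ w₁ y w₃)
    (s₂ : ∀ (c : ℂ) x w₀ w₁ w₃, f w₀ w₁ (c • x) w₃ = c • f w₀ w₁ x w₃)
    (a₃ : ∀ x y w₀ w₁ w₂, f w₀ w₁ w₂ (x + y) = f w₀ w₁ w₂ x + f w₀ w₁ w₂ y)
    (s₃ : ∀ (c : ℂ) x w₀ w₁ w₂, f w₀ w₁ w₂ (c • x) = c • f w₀ w₁ w₂ x) :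
    W₀ →ₗ[ℂ] W₁ →ₗ[ℂ] W₂ →ₗ[ℂ] W₃ →ₗ[ℂ] Q where
  toFun w₀ :=
    { toFun := fun w₁ => LinearMap.mk₂ ℂ (f w₀ w₁) (fun _ _ _ => a₂ _ _ _ _ _)
        (fun _ _ _ => s₂ _ _ _ _ _) (fun _ _ _ => a₃ _ _ _ _ _) (fun _ _ _ => s₃ _ _ _ _ _)
      map_add' := fun _ _ => LinearMap.ext₂ fun _ _ => a₁ _ _ _ _ _
      map_smul' := fun _ _ => LinearMap.ext₂ fun _ _ => s₁ _ _ _ _ _ }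
  map_add' := fun _ _ => LinearMap.ext fun _ => LinearMap.ext₂ fun _ _ => a₀ _ _ _ _ _
  map_smul' := fun _ _ => LinearMap.ext fun _ => LinearMap.ext₂ fun _ _ => s₀ _ _ _ _ _

variable {M₀ M₁ M₂ M₃}

/-- Interchanging the insertions at `ζ₁` and `ζ₂`. -/
theorem CorrelatorRelations.swap {ζ₁ ζ₂ ζ₁₂ : Rˣ} {Φ : W₀ →ₗ[ℂ] W₁ →ₗ[ℂ] W₂ →ₗ[ℂ] W₃ →ₗ[ℂ] Q}
    (h : CorrelatorRelations M₀ M₁ M₂ M₃ ζ₁ ζ₂ ζ₁₂ Φ) :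
    CorrelatorRelations M₀ M₂ M₁ M₃ ζ₂ ζ₁ (-ζ₁₂) (LinearMap.lflip.toLinearMap ∘ₗ Φ) where
  first v w₀ w₂ w₁ w₃ K h₀ h₁ h₃ := h.second v w₀ w₁ w₂ w₃ K h₀ h₁ h₃
  second v w₀ w₂ w₁ w₃ K h₀ h₂ h₃ := by
    rw [neg_neg]
    exact h.first v w₀ w₁ w₂ w₃ K h₀ h₂ h₃
  outer v n w₀ w₂ w₁ w₃ K h₂ h₁ := by
    refine (h.outer v n w₀ w₁ w₂ w₃ K h₁ h₂).trans ?_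
    congr 1
    exact Finset.sum_congr rfl fun j _ => by rw [add_comm]; rfl

end Relations

end VOA
end

/-! ### Binomial identities, and correlators as multilinear maps -/

noncomputable section

namespace VOA

open scoped LaurentPolynomial

theorem ringChoose_natCast (n k : ℕ) : Ring.choose (n : ℤ) k = (n.choose k : ℤ) := by
  simpa using Ring.choose_natCast (R := ℤ) n k

/-- Turns the coefficients of `(x + c y)^(-1-j)` into ordinary binomial coefficients up to sign, in
which form the double sums from the Jacobi identity can be compared. -/
theorem ringChoose_neg_one_sub (i j : ℕ) :
    Ring.choose (-1 - (j : ℤ)) i = (-1) ^ i * ((i + j).choose j : ℤ) := by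
  have h := Ring.choose_neg (1 + (j : ℤ)) i
  have h1 : -(1 + (j : ℤ)) = -1 - j := by ring
  have h2 : 1 + (j : ℤ) + i - 1 = ((i + j : ℕ) : ℤ) := by push_cast; ring
  rw [h1, h2, ringChoose_natCast, Nat.choose_symm_add] at h
  rw [h, Units.smul_def, Int.coe_negOnePow_natCast, smul_eq_mul]

theorem ringChoose_neg_one (i : ℕ) : Ring.choose (-1 : ℤ) i = (-1) ^ i := by
  have h := ringChoose_neg_one_sub i 0
  simpa using h

theorem neg_one_pow_mul_self (i : ℕ) : (-1 : ℂ) ^ i * (-1) ^ i = 1 := by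
  rw [← mul_pow]
  simp

theorem sum_choose_shift (f : ℕ → ℂ) {j T : ℕ} (hj : j ≤ T) :
    ∑ i ∈ Finset.range T, (i.choose j : ℂ) * f i =
      ∑ i ∈ Finset.range (T - j), ((i + j).choose j : ℂ) * f (i + j) := by
  have h := Finset.sum_range_add (fun i => (i.choose j : ℂ) * f i) j (T - j)
  rw [Nat.add_sub_cancel' hj] at h
  rw [h, Finset.sum_eq_zero, zero_add]
  · exact Finset.sum_congr rfl fun i _ => by rw [add_comm]
  · intro i hi
    rw [Nat.choose_eq_zero_of_lt (Finset.mem_range.mp hi)]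
    simp

theorem sum_range_extend {f : ℕ → ℂ} {K T : ℕ} (hT : K ≤ T) (hf : ∀ i, K ≤ i → f i = 0) :
    ∑ i ∈ Finset.range T, f i = ∑ i ∈ Finset.range K, f i := by
  refine (Finset.sum_subset (Finset.range_mono hT) fun i _ hi => hf i ?_).symm
  simpa using hi

theorem exists_uniform_bound {P : ℕ → ℕ → Prop} (hP : ∀ j, ∃ L, ∀ i, L ≤ i → P j i) (K : ℕ) :
    ∃ L, ∀ j, j < K → ∀ i, L ≤ i → P j i := by
  choose f hf using hP
  exact ⟨(Finset.range K).sup f, fun j hj i hi =>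
    hf j i ((Finset.le_sup (f := f) (Finset.mem_range.mpr hj)).trans hi)⟩

section AssociatorNegOne

variable {V W₁ W₂ W₃ : Type*}
  [AddCommGroup W₁] [Module ℂ W₁] [AddCommGroup W₂] [Module ℂ W₂]
  [AddCommGroup W₃] [Module ℂ W₃]
  {Y₁ : V → ℤ → Module.End ℂ W₁} {Y₂ : V → ℤ → Module.End ℂ W₂}
  {Y₃ : V → ℤ → Module.End ℂ W₃} {I : W₁ → ℂ → W₂ →ₗ[ℂ] W₃}

theorem JacobiIdentity.associator_neg_one (hI : JacobiIdentity Y₁ Y₂ Y₃ I) (u : V) (a : W₁)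
    (b : W₂) (n : ℂ) {K : ℕ} (h₁ : ∀ i : ℕ, K ≤ i → I a (n + i) b = 0)
    (h₂ : ∀ i : ℕ, K ≤ i → Y₂ u i b = 0) :
    I (Y₁ u (-1) a) n b = ∑ i ∈ Finset.range K,
      (Y₃ u (-1 - i) (I a (n + i) b) + I a (n + (-1 - i)) (Y₂ u i b)) := by
  rw [hI.associator u a b (-1) n h₁ h₂]
  refine Finset.sum_congr rfl fun i _ => ?_
  have e : ((-1 : ℤ) : ℂ) + n - i = n + (-1 - i) := by push_cast; ring
  rw [ringChoose_neg_one, e]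
  push_cast
  rw [neg_one_pow_mul_self]
  simp

theorem JacobiIdentity.associator_neg (hI : JacobiIdentity Y₁ Y₂ Y₃ I) (u : V) (a : W₁)
    (b : W₂) (j : ℕ) (n : ℂ) {K : ℕ} (h₁ : ∀ i : ℕ, K ≤ i → I a (n + i) b = 0)
    (h₂ : ∀ i : ℕ, K ≤ i → Y₂ u i b = 0) :
    I (Y₁ u (-1 - j) a) n b = ∑ i ∈ Finset.range K, ((i + j).choose j : ℂ) •
      (Y₃ u (-1 - j - i) (I a (n + i) b) +
        (-1 : ℂ) ^ j • I a (n + (-1 - j) - i) (Y₂ u i b)) := by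
  rw [hI.associator u a b (-1 - j) n h₁ h₂]
  refine Finset.sum_congr rfl fun i _ => ?_
  have e : ((-1 - j : ℤ) : ℂ) + n - i = n + (-1 - j) - i := by push_cast; ring
  have e2 : (-1 : ℂ) ^ (-1 - j : ℤ) = -(-1) ^ j := by
    rw [sub_eq_add_neg, zpow_add₀ (by norm_num), zpow_neg, zpow_neg, zpow_natCast, zpow_one,
      ← inv_pow]
    norm_num
  rw [ringChoose_neg_one_sub, e, e2]
  push_cast
  rw [← mul_assoc, neg_one_pow_mul_self, one_mul, neg_smul, sub_neg_eq_add]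

end AssociatorNegOne

section Correlators

variable {V : Type*} [AddCommGroup V] [Module ℂ V] {𝒱 : VertexOperatorAlgebra V}

namespace DiscreteModule

variable {W : Type*} [AddCommGroup W] [Module ℂ W] (M : DiscreteModule 𝒱 W)

theorem exists_truncation (v : V) (w : W) : ∃ K : ℕ, ∀ i : ℕ, K ≤ i → M.Y v i w = 0 := by
  obtain ⟨N, hN⟩ := M.truncation v w
  exact ⟨N.toNat, fun i hi => hN i (by omega)⟩

/-- The pairing with `w`. -/
def evalDual (w : W) : M.gradedDual →ₗ[ℂ] ℂ := (LinearMap.applyₗ w) ∘ₗ M.gradedDual.subtype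

theorem evalDual_contragredient (w : W) (v : V) (n : ℤ) (f : M.gradedDual) :
    M.evalDual w (M.contragredient v n f) = M.evalDual (M.oppositeMode v n w) f := rfl

theorem evalDual_zero (f : M.gradedDual) : M.evalDual 0 f = 0 := map_zero f.1

end DiscreteModule

variable {W₀ : Type*} [AddCommGroup W₀] [Module ℂ W₀] {M₀ : DiscreteModule 𝒱 W₀}
  {W₁ : Type*} [AddCommGroup W₁] [Module ℂ W₁] {M₁ : DiscreteModule 𝒱 W₁}
  {W₂ : Type*} [AddCommGroup W₂] [Module ℂ W₂] {M₂ : DiscreteModule 𝒱 W₂}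
  {W₃ : Type*} [AddCommGroup W₃] [Module ℂ W₃] {M₃ : DiscreteModule 𝒱 W₃}
  {U : Type*} [AddCommGroup U] [Module ℂ U] {MU : DiscreteModule 𝒱 U}
  (p q : ExpansionRing) (h : IsUnit (p * q * (p - q)))

section Product

variable (I : IntertwiningOperator 𝒱 ⇑M₁.Y ⇑MU.Y M₀.contragredient)
  (J : IntertwiningOperator 𝒱 ⇑M₂.Y ⇑M₃.Y ⇑MU.Y)

theorem prodSeries_mem (w₀ : W₀) (w₁ : W₁) (w₂ : W₂) (w₃ : W₃) :
    prodSeries I J w₀ w₁ w₂ w₃ ∈ lowerTruncated := by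
  intro β
  obtain ⟨K, hK⟩ := J.truncation w₂ w₃ (-β - 1)
  refine ⟨K, fun k hk α => ?_⟩
  have e : -(β - k) - 1 = -β - 1 + k := by ring
  unfold prodSeries
  rw [e, hK k hk, map_zero]
  rfl

/-- The series `⟨w₀, I(w₁, x) J(w₂, y) w₃⟩`, as a multilinear map. -/
def prodCorrelator : W₀ →ₗ[ℂ] W₁ →ₗ[ℂ] W₂ →ₗ[ℂ] W₃ →ₗ[ℂ] SeriesModule p q h :=
  mkMultilinear (fun w₀ w₁ w₂ w₃ =>
      SeriesModule.mk h (prodSeries I J w₀ w₁ w₂ w₃) (prodSeries_mem I J w₀ w₁ w₂ w₃))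
    (fun _ _ _ _ _ => SeriesModule.ext fun _ _ => by
      simp [prodSeries, SeriesModule.toSeries_add, SeriesModule.toSeries_mk])
    (fun _ _ _ _ _ => SeriesModule.ext fun _ _ => by
      simp [prodSeries, SeriesModule.toSeries_smul, SeriesModule.toSeries_mk])
    (fun _ _ _ _ _ => SeriesModule.ext fun _ _ => by
      simp [prodSeries, SeriesModule.toSeries_add, SeriesModule.toSeries_mk])
    (fun _ _ _ _ _ => SeriesModule.ext fun _ _ => by
      simp [prodSeries, SeriesModule.toSeries_smul, SeriesModule.toSeries_mk])
    (fun _ _ _ _ _ => SeriesModule.ext fun _ _ => by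
      simp [prodSeries, SeriesModule.toSeries_add, SeriesModule.toSeries_mk])
    (fun _ _ _ _ _ => SeriesModule.ext fun _ _ => by
      simp [prodSeries, SeriesModule.toSeries_smul, SeriesModule.toSeries_mk])
    (fun _ _ _ _ _ => SeriesModule.ext fun _ _ => by
      simp [prodSeries, SeriesModule.toSeries_add, SeriesModule.toSeries_mk])
    (fun _ _ _ _ _ => SeriesModule.ext fun _ _ => by
      simp [prodSeries, SeriesModule.toSeries_smul, SeriesModule.toSeries_mk])

theorem prodCorrelator_mode (w₀ : W₀) (w₁ : W₁) (w₂ : W₂) (w₃ : W₃) (N M : ℂ) :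
    (prodCorrelator p q h I J w₀ w₁ w₂ w₃).mode N M =
      M₀.evalDual w₀ (I.mode w₁ N (J.mode w₂ M w₃)) := by
  have e : ∀ z : ℂ, -(-z - 1) - 1 = z := fun z => by ring
  show M₀.evalDual w₀ (I.mode w₁ (-(-N - 1) - 1) (J.mode w₂ (-(-M - 1) - 1) w₃)) = _
  rw [e, e]

end Product

section Iterate

variable (J : IntertwiningOperator 𝒱 ⇑M₁.Y ⇑M₂.Y ⇑MU.Y)
  (I : IntertwiningOperator 𝒱 ⇑MU.Y ⇑M₃.Y M₀.contragredient)

theorem iterSeries_mem (w₀ : W₀) (w₁ : W₁) (w₂ : W₂) (w₃ : W₃) :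
    iterSeries J I w₀ w₁ w₂ w₃ ∈ lowerTruncated := by
  intro β
  obtain ⟨K, hK⟩ := J.truncation w₁ w₂ (-β - 1)
  refine ⟨K, fun k hk α => ?_⟩
  have e : -(β - k) - 1 = -β - 1 + k := by ring
  unfold iterSeries
  rw [e, hK k hk]
  simp

/-- The series `⟨w₀, I(J(w₁, y) w₂, x) w₃⟩`, as a multilinear map. -/
def iterCorrelator : W₀ →ₗ[ℂ] W₁ →ₗ[ℂ] W₂ →ₗ[ℂ] W₃ →ₗ[ℂ] SeriesModule p q h :=
  mkMultilinear (fun w₀ w₁ w₂ w₃ =>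
      SeriesModule.mk h (iterSeries J I w₀ w₁ w₂ w₃) (iterSeries_mem J I w₀ w₁ w₂ w₃))
    (fun _ _ _ _ _ => SeriesModule.ext fun _ _ => by
      simp [iterSeries, SeriesModule.toSeries_add, SeriesModule.toSeries_mk])
    (fun _ _ _ _ _ => SeriesModule.ext fun _ _ => by
      simp [iterSeries, SeriesModule.toSeries_smul, SeriesModule.toSeries_mk])
    (fun _ _ _ _ _ => SeriesModule.ext fun _ _ => by
      simp [iterSeries, SeriesModule.toSeries_add, SeriesModule.toSeries_mk])
    (fun _ _ _ _ _ => SeriesModule.ext fun _ _ => by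
      simp [iterSeries, SeriesModule.toSeries_smul, SeriesModule.toSeries_mk])
    (fun _ _ _ _ _ => SeriesModule.ext fun _ _ => by
      simp [iterSeries, SeriesModule.toSeries_add, SeriesModule.toSeries_mk])
    (fun _ _ _ _ _ => SeriesModule.ext fun _ _ => by
      simp [iterSeries, SeriesModule.toSeries_smul, SeriesModule.toSeries_mk])
    (fun _ _ _ _ _ => SeriesModule.ext fun _ _ => by
      simp [iterSeries, SeriesModule.toSeries_add, SeriesModule.toSeries_mk])
    (fun _ _ _ _ _ => SeriesModule.ext fun _ _ => by
      simp [iterSeries, SeriesModule.toSeries_smul, SeriesModule.toSeries_mk])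

theorem iterCorrelator_mode (w₀ : W₀) (w₁ : W₁) (w₂ : W₂) (w₃ : W₃) (N M : ℂ) :
    (iterCorrelator p q h J I w₀ w₁ w₂ w₃).mode N M =
      M₀.evalDual w₀ (I.mode (J.mode w₁ M w₂) N w₃) := by
  have e : ∀ z : ℂ, -(-z - 1) - 1 = z := fun z => by ring
  show M₀.evalDual w₀ (I.mode (J.mode w₁ (-(-M - 1) - 1) w₂) (-(-N - 1) - 1) w₃) = _
  rw [e, e]

end Iterate

end Correlators

end VOA
end

noncomputable section

namespace VOA

open scoped LaurentPolynomial

/-! ### The relations for products of intertwining operators -/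

section ProductRelations

variable {V : Type*} [AddCommGroup V] [Module ℂ V] {𝒱 : VertexOperatorAlgebra V}
  {W₀ : Type*} [AddCommGroup W₀] [Module ℂ W₀] {M₀ : DiscreteModule 𝒱 W₀}
  {W₁ : Type*} [AddCommGroup W₁] [Module ℂ W₁] {M₁ : DiscreteModule 𝒱 W₁}
  {W₂ : Type*} [AddCommGroup W₂] [Module ℂ W₂] {M₂ : DiscreteModule 𝒱 W₂}
  {W₃ : Type*} [AddCommGroup W₃] [Module ℂ W₃] {M₃ : DiscreteModule 𝒱 W₃}
  {U : Type*} [AddCommGroup U] [Module ℂ U] {MU : DiscreteModule 𝒱 U}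
  {p q : ExpansionRing} (h : IsUnit (p * q * (p - q)))
  (I : IntertwiningOperator 𝒱 ⇑M₁.Y ⇑MU.Y M₀.contragredient)
  (J : IntertwiningOperator 𝒱 ⇑M₂.Y ⇑M₃.Y ⇑MU.Y)
  {ζ₁ ζ₂ ζ₁₂ : CoeffRingˣ}

theorem varX_sub_varY_eq :
    varX - varY = varX + HahnSeries.single 1 (LaurentPolynomial.C (-1 : ℂ)) := by
  rw [map_neg, map_one, HahnSeries.single_neg, ← sub_eq_add_neg]
  rfl

theorem varX_add_varY_eq :
    varX + varY = varX + HahnSeries.single 1 (LaurentPolynomial.C (1 : ℂ)) := by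
  rw [map_one]
  rfl

theorem neg_zpow_smul {h : IsUnit (p * q * (p - q))} (ζ : CoeffRingˣ) (j : ℕ)
    (φ : SeriesModule p q h) :
    (-ζ) ^ (-1 - j : ℤ) • φ = (-(-1 : ℂ) ^ j) • ζ ^ (-1 - j : ℤ) • φ := by
  have e : ∀ φ : SeriesModule p q h, ((-1 : CoeffRingˣ) ^ (-1 - j : ℤ)) • φ =
      (-(-1 : ℂ) ^ j) • φ := by
    intro φ
    rw [zpow_sub, zpow_natCast, zpow_neg, zpow_one]
    rcases Nat.even_or_odd j with hj | hj
    · simp [hj.neg_one_pow]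
    · simp [hj.neg_one_pow]
  rw [← neg_one_mul, mul_zpow, mul_smul, e]

/-- The mode `v_n` next to `w₀` is moved to the right through `I` and then through `J`, each passage
contributing a commutator. The units `ζ` are specified only by their expansions, so that the result
also applies with `z₁` and `z₂` exchanged. -/
theorem prodCorrelator_outer (h₁ : expand p q h ζ₁ = varX) (h₂ : expand p q h ζ₂ = varY)
    (v : V) (n : ℤ) (w₀ : W₀) (w₁ : W₁) (w₂ : W₂) (w₃ : W₃) (K : ℕ)
    (t₁ : ∀ k : ℕ, K ≤ k → M₁.Y v k w₁ = 0) (t₂ : ∀ k : ℕ, K ≤ k → M₂.Y v k w₂ = 0) :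
    prodCorrelator p q h I J (M₀.oppositeMode v n w₀) w₁ w₂ w₃ =
      prodCorrelator p q h I J w₀ w₁ w₂ (M₃.Y v n w₃) +
      ∑ j ∈ Finset.range K, ((Ring.choose n j : ℤ) : ℂ) •
        (ζ₁ ^ (n - j : ℤ) • prodCorrelator p q h I J w₀ (M₁.Y v j w₁) w₂ w₃ +
          ζ₂ ^ (n - j : ℤ) • prodCorrelator p q h I J w₀ w₁ (M₂.Y v j w₂) w₃) := by
  refine SeriesModule.ext_mode fun N M => ?_
  simp only [SeriesModule.mode_add, SeriesModule.mode_sum, SeriesModule.mode_smul,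
    SeriesModule.mode_zpow_smul_of_varX h₁, SeriesModule.mode_zpow_smul_of_varY h₂,
    prodCorrelator_mode]
  rw [← M₀.evalDual_contragredient,
    I.jacobi.commutator v w₁ _ n N t₁ (fun n => by rw [map_zero]; rfl),
    J.jacobi.commutator v w₂ w₃ n M t₂ (fun n => by rw [map_zero]; rfl)]
  simp only [map_add, map_sum, map_smul, smul_eq_mul, mul_add, Finset.sum_add_distrib]
  have e : ∀ (z : ℂ) (j : ℕ), (n : ℂ) + z - j = z + ((n - j : ℤ) : ℂ) := by
    intro z j
    push_cast
    ring
  simp only [e]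
  ring

/-- The associator formula for `I` yields modes `v_{-1-i}` on the left, absorbed by `w₀`, and modes
`v_i` on the right, which move past `J`. The commutator terms with `v_j w₂` add up to `∑ C(i,j)
x^(-1-i) y^(i-j)`, the expansion of `(x - y)^(-1-j)`. -/
theorem prodCorrelator_first (h₁ : expand p q h ζ₁ = varX)
    (h₁₂ : expand p q h ζ₁₂ = varX - varY)
    (v : V) (w₀ : W₀) (w₁ : W₁) (w₂ : W₂) (w₃ : W₃) (K : ℕ)
    (t₀ : ∀ k : ℕ, K ≤ k → M₀.oppositeMode v (-1 - k) w₀ = 0)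
    (t₂ : ∀ k : ℕ, K ≤ k → M₂.Y v k w₂ = 0) (t₃ : ∀ k : ℕ, K ≤ k → M₃.Y v k w₃ = 0) :
    prodCorrelator p q h I J w₀ (M₁.Y v (-1) w₁) w₂ w₃ = ∑ k ∈ Finset.range K,
      (ζ₁ ^ (k : ℤ) • prodCorrelator p q h I J (M₀.oppositeMode v (-1 - k) w₀) w₁ w₂ w₃ +
        ζ₁₂ ^ (-1 - k : ℤ) • prodCorrelator p q h I J w₀ w₁ (M₂.Y v k w₂) w₃ +
        ζ₁ ^ (-1 - k : ℤ) • prodCorrelator p q h I J w₀ w₁ w₂ (M₃.Y v k w₃)) := by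
  refine SeriesModule.ext_mode fun N M => ?_
  obtain ⟨T₁, hT₁⟩ := I.truncation w₁ (J.mode w₂ M w₃) N
  obtain ⟨T₂, hT₂⟩ := MU.exists_truncation v (J.mode w₂ M w₃)
  obtain ⟨L, hL⟩ := exists_uniform_bound
    (fun j => J.truncation (M₂.Y v j w₂) w₃ M) K
  -- A common cutoff for all sums; it exceeds `K + L` so that `T - j ≥ L` still holds after the
  -- index shift by `j < K`.
  set T := K + (L + T₁ + T₂) with hT
  have hlhs := I.jacobi.associator_neg_one v w₁ (J.mode w₂ M w₃) N (K := T)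
    (fun i hi => hT₁ i (by omega)) (fun i hi => hT₂ i (by omega))
  have hcomm := fun i : ℕ => J.jacobi.commutator v w₂ w₃ i M t₂ (fun n => by rw [map_zero]; rfl)
  have hbin : ∀ j ∈ Finset.range K,
      (ζ₁₂ ^ (-1 - j : ℤ) • prodCorrelator p q h I J w₀ w₁ (M₂.Y v j w₂) w₃).mode N M =
      ∑ i ∈ Finset.range T, (i.choose j : ℂ) * M₀.evalDual w₀ (I.mode w₁ (N + (-1 - i))
        (J.mode (M₂.Y v j w₂) (i + M - j) w₃)) := by
    intro j hj
    rw [Finset.mem_range] at hj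
    rw [sum_choose_shift _ (show j ≤ T by omega),
      SeriesModule.mode_zpow_smul_of_binomial (h₁₂.trans varX_sub_varY_eq) (K := T - j)]
    · refine Finset.sum_congr rfl fun i _ => ?_
      rw [ringChoose_neg_one_sub, prodCorrelator_mode]
      have e1 : N + ((-1 - (j : ℤ) : ℤ) : ℂ) - i = N + (-1 - ((i + j : ℕ) : ℂ)) := by
        push_cast
        ring
      have e2 : ((i + j : ℕ) : ℂ) + M - j = M + i := by push_cast; ring
      rw [e1, e2]
      push_cast
      rw [mul_right_comm ((-1 : ℂ) ^ i), neg_one_pow_mul_self, one_mul]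
    · intro N' i hi
      rw [prodCorrelator_mode, hL j hj i (by omega), map_zero, map_zero]
  simp only [SeriesModule.mode_add, SeriesModule.mode_sum, Finset.sum_add_distrib,
    SeriesModule.mode_zpow_smul_of_varX h₁]
  rw [Finset.sum_congr rfl hbin, Finset.sum_comm]
  simp only [prodCorrelator_mode]
  rw [hlhs]
  simp only [Int.cast_natCast] at hcomm
  simp only [map_add, map_sum, map_smul, smul_eq_mul, Finset.sum_add_distrib, hcomm,
    M₀.evalDual_contragredient, ringChoose_natCast, Int.cast_natCast]
  rw [sum_range_extend (f := fun i => M₀.evalDual (M₀.oppositeMode v (-1 - i) w₀) _)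
      (show K ≤ T by omega) (fun i hi => by rw [t₀ i hi, M₀.evalDual_zero]),
    sum_range_extend (f := fun i : ℕ => M₀.evalDual w₀ (I.mode w₁ (N + (-1 - i))
      (J.mode w₂ M (M₃.Y v i w₃))))
      (show K ≤ T by omega) (fun i hi => by rw [t₃ i hi]; simp only [map_zero])]
  push_cast
  ring

/-- Here the associator formula is used for `J`, and the modes `v_{-1-i}` pass through `I` to reach
`w₀`. The commutator terms with `v_j w₁` add up to `(y - x)^(-1-j)`, still expanded in powers of
`y`. -/
theorem prodCorrelator_second (h₂ : expand p q h ζ₂ = varY)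
    (h₁₂ : expand p q h ζ₁₂ = varX - varY)
    (v : V) (w₀ : W₀) (w₁ : W₁) (w₂ : W₂) (w₃ : W₃) (K : ℕ)
    (t₀ : ∀ k : ℕ, K ≤ k → M₀.oppositeMode v (-1 - k) w₀ = 0)
    (t₁ : ∀ k : ℕ, K ≤ k → M₁.Y v k w₁ = 0) (t₃ : ∀ k : ℕ, K ≤ k → M₃.Y v k w₃ = 0) :
    prodCorrelator p q h I J w₀ w₁ (M₂.Y v (-1) w₂) w₃ = ∑ k ∈ Finset.range K,
      (ζ₂ ^ (k : ℤ) • prodCorrelator p q h I J (M₀.oppositeMode v (-1 - k) w₀) w₁ w₂ w₃ +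
        (-ζ₁₂) ^ (-1 - k : ℤ) • prodCorrelator p q h I J w₀ (M₁.Y v k w₁) w₂ w₃ +
        ζ₂ ^ (-1 - k : ℤ) • prodCorrelator p q h I J w₀ w₁ w₂ (M₃.Y v k w₃)) := by
  refine SeriesModule.ext_mode fun N M => ?_
  obtain ⟨T₁, hT₁⟩ := J.truncation w₂ w₃ M
  set T := K + T₁ with hT
  have hlhs := J.jacobi.associator_neg_one v w₂ w₃ M (K := T)
    (fun i hi => hT₁ i (by omega)) (fun i hi => t₃ i (by omega))
  have hcomm := fun i : ℕ => I.jacobi.commutator v w₁ (J.mode w₂ (M + i) w₃) (-1 - i) N t₁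
    (fun n => by rw [map_zero]; rfl)
  have hbin : ∀ j ∈ Finset.range K,
      ((-ζ₁₂) ^ (-1 - j : ℤ) • prodCorrelator p q h I J w₀ (M₁.Y v j w₁) w₂ w₃).mode N M =
      -∑ i ∈ Finset.range T, ((Ring.choose (-1 - i : ℤ) j : ℤ) : ℂ) * M₀.evalDual w₀
        (I.mode (M₁.Y v j w₁) (((-1 - i : ℤ) : ℂ) + N - j) (J.mode w₂ (M + i) w₃)) := by
    intro j hj
    rw [neg_zpow_smul, SeriesModule.mode_smul,
      SeriesModule.mode_zpow_smul_of_binomial (h₁₂.trans varX_sub_varY_eq) (K := T), neg_mul,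
      Finset.mul_sum]
    · congr 1
      refine Finset.sum_congr rfl fun i _ => ?_
      rw [ringChoose_neg_one_sub, ringChoose_neg_one_sub, prodCorrelator_mode]
      have e1 : N + ((-1 - (j : ℤ) : ℤ) : ℂ) - i = ((-1 - i : ℤ) : ℂ) + N - j := by
        push_cast
        ring
      rw [e1, add_comm j i, Nat.choose_symm_add]
      push_cast
      rw [mul_right_comm ((-1 : ℂ) ^ i), neg_one_pow_mul_self, one_mul, mul_assoc]
    · intro N' i hi
      rw [prodCorrelator_mode, hT₁ i (by omega), map_zero, map_zero]
  simp only [SeriesModule.mode_add, SeriesModule.mode_sum, Finset.sum_add_distrib,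
    SeriesModule.mode_zpow_smul_of_varY h₂]
  rw [Finset.sum_congr rfl hbin, Finset.sum_neg_distrib, Finset.sum_comm]
  simp only [prodCorrelator_mode]
  rw [hlhs]
  have hcomm' := fun i : ℕ => eq_sub_of_add_eq (hcomm i).symm
  simp only [map_add, map_sum, map_smul, map_sub, smul_eq_mul, Finset.sum_add_distrib, hcomm',
    M₀.evalDual_contragredient, Finset.sum_sub_distrib]
  rw [sum_range_extend (f := fun i : ℕ => M₀.evalDual (M₀.oppositeMode v (-1 - i) w₀)
      (I.mode w₁ N (J.mode w₂ (M + i) w₃)))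
      (show K ≤ T by omega) (fun i hi => by rw [t₀ i hi, M₀.evalDual_zero]),
    sum_range_extend (f := fun i : ℕ => M₀.evalDual w₀ (I.mode w₁ N
      (J.mode w₂ (M + (-1 - i)) (M₃.Y v i w₃))))
      (show K ≤ T by omega) (fun i hi => by rw [t₃ i hi]; simp only [map_zero])]
  push_cast
  ring

theorem prodCorrelator_relations (h₁ : expand p q h ζ₁ = varX) (h₂ : expand p q h ζ₂ = varY)
    (h₁₂ : expand p q h ζ₁₂ = varX - varY) :
    CorrelatorRelations M₀ M₁ M₂ M₃ ζ₁ ζ₂ ζ₁₂ (prodCorrelator p q h I J) where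
  first := prodCorrelator_first h I J h₁ h₁₂
  second := prodCorrelator_second h I J h₂ h₁₂
  outer := prodCorrelator_outer h I J h₁ h₂

end ProductRelations

/-! ### The relations for iterates of intertwining operators -/

section IterateRelations

variable {V : Type*} [AddCommGroup V] [Module ℂ V] {𝒱 : VertexOperatorAlgebra V}
  {W₀ : Type*} [AddCommGroup W₀] [Module ℂ W₀] {M₀ : DiscreteModule 𝒱 W₀}
  {W₁ : Type*} [AddCommGroup W₁] [Module ℂ W₁] {M₁ : DiscreteModule 𝒱 W₁}
  {W₂ : Type*} [AddCommGroup W₂] [Module ℂ W₂] {M₂ : DiscreteModule 𝒱 W₂}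
  {W₃ : Type*} [AddCommGroup W₃] [Module ℂ W₃] {M₃ : DiscreteModule 𝒱 W₃}
  {U : Type*} [AddCommGroup U] [Module ℂ U] {MU : DiscreteModule 𝒱 U}
  {p q : ExpansionRing} (h : IsUnit (p * q * (p - q)))
  (J : IntertwiningOperator 𝒱 ⇑M₁.Y ⇑M₂.Y ⇑MU.Y)
  (I : IntertwiningOperator 𝒱 ⇑MU.Y ⇑M₃.Y M₀.contragredient)
  {ζ₁ ζ₂ ζ₁₂ : CoeffRingˣ}

/-- Moving `v_n` past `I` produces modes `v_j` on `J(w₁, y) w₂`, which then move past `J`. The terms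
with `v_i w₁` add up to `(x + y)^(n-i)` because `C(n,j) C(j,i) = C(n,i) C(n-i,j-i)`. -/
theorem iterCorrelator_outer (h₁ : expand p q h ζ₁ = varX + varY) (h₂ : expand p q h ζ₂ = varX)
    (v : V) (n : ℤ) (w₀ : W₀) (w₁ : W₁) (w₂ : W₂) (w₃ : W₃) (K : ℕ)
    (t₁ : ∀ k : ℕ, K ≤ k → M₁.Y v k w₁ = 0) (t₂ : ∀ k : ℕ, K ≤ k → M₂.Y v k w₂ = 0) :
    iterCorrelator p q h J I (M₀.oppositeMode v n w₀) w₁ w₂ w₃ =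
      iterCorrelator p q h J I w₀ w₁ w₂ (M₃.Y v n w₃) +
      ∑ j ∈ Finset.range K, ((Ring.choose n j : ℤ) : ℂ) •
        (ζ₁ ^ (n - j : ℤ) • iterCorrelator p q h J I w₀ (M₁.Y v j w₁) w₂ w₃ +
          ζ₂ ^ (n - j : ℤ) • iterCorrelator p q h J I w₀ w₁ (M₂.Y v j w₂) w₃) := by
  refine SeriesModule.ext_mode fun N M => ?_
  obtain ⟨T₁, hT₁⟩ := MU.exists_truncation v (J.mode w₁ M w₂)
  obtain ⟨L, hL⟩ := exists_uniform_bound (fun j => J.truncation (M₁.Y v j w₁) w₂ M) K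
  set T := K + (L + T₁) with hT
  have hcomm := fun i : ℕ => J.jacobi.commutator v w₁ w₂ i M t₁ (fun n => by rw [map_zero]; rfl)
  have hbin : ∀ i ∈ Finset.range K, ((Ring.choose n i : ℤ) : ℂ) *
      (ζ₁ ^ (n - i : ℤ) • iterCorrelator p q h J I w₀ (M₁.Y v i w₁) w₂ w₃).mode N M =
      ∑ j ∈ Finset.range T, (j.choose i : ℂ) * (((Ring.choose n j : ℤ) : ℂ) * M₀.evalDual w₀
        (I.mode (J.mode (M₁.Y v i w₁) (j + M - i) w₂) (n + N - j) w₃)) := by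
    intro i hi
    rw [Finset.mem_range] at hi
    rw [sum_choose_shift _ (show i ≤ T by omega),
      SeriesModule.mode_zpow_smul_of_binomial (h₁.trans varX_add_varY_eq) (K := T - i),
      Finset.mul_sum]
    · refine Finset.sum_congr rfl fun k _ => ?_
      rw [iterCorrelator_mode]
      have e1 : N + ((n - (i : ℤ) : ℤ) : ℂ) - k = n + N - ((k + i : ℕ) : ℂ) := by
        push_cast
        ring
      have e2 : ((k + i : ℕ) : ℂ) + M - i = M + k := by push_cast; ring
      have e3 := Ring.choose_smul_choose n (show i ≤ k + i by omega)
      rw [nsmul_eq_mul, Nat.add_sub_cancel] at e3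
      have e4 : ((k + i).choose i : ℂ) * ((Ring.choose n (k + i) : ℤ) : ℂ) =
          ((Ring.choose n i : ℤ) : ℂ) * ((Ring.choose (n - i) k : ℤ) : ℂ) := by
        exact_mod_cast e3
      rw [e1, e2, ← mul_assoc, one_pow, mul_one, ← e4, mul_assoc]
    · intro N' k hk
      rw [iterCorrelator_mode, hL i hi k (by omega), map_zero]
      simp
  simp only [SeriesModule.mode_add, SeriesModule.mode_sum, Finset.sum_add_distrib,
    SeriesModule.mode_smul, SeriesModule.mode_zpow_smul_of_varX h₂, mul_add]
  rw [Finset.sum_congr rfl hbin, Finset.sum_comm]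
  simp only [iterCorrelator_mode]
  rw [← M₀.evalDual_contragredient,
    I.jacobi.commutator v _ w₃ n N (K := T) (fun i hi => hT₁ i (by omega))
      (fun n => by rw [map_zero]; rfl)]
  simp only [Int.cast_natCast] at hcomm
  simp only [hcomm, map_add, map_sum, map_smul, smul_eq_mul, Finset.sum_add_distrib, mul_add,
    LinearMap.add_apply, LinearMap.sum_apply, LinearMap.smul_apply, Pi.add_apply, Finset.sum_apply,
    Pi.smul_apply, ringChoose_natCast, Int.cast_natCast]
  rw [sum_range_extend (f := fun i : ℕ => ((Ring.choose n i : ℤ) : ℂ) * M₀.evalDual w₀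
      (I.mode (J.mode w₁ M (M₂.Y v i w₂)) (n + N - i) w₃))
      (show K ≤ T by omega) (fun i hi => by rw [t₂ i hi]; simp)]
  have e : ∀ j : ℕ, N + ((n - j : ℤ) : ℂ) = n + N - j := by
    intro j
    push_cast
    ring
  simp only [e, Finset.mul_sum, mul_left_comm]
  ring

/-- Two associator formulas are composed, first for `J` and then for `I` with the modes `v_{-1-i}`.
The terms that reach `w₀` add up to `(x + y)^k` with `k = i + j`, those that reach `w₃` to the
expansion of `(x + y)^(-1-k)` in powers of `y`. -/
theorem iterCorrelator_first (h₁ : expand p q h ζ₁ = varX + varY)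
    (h₁₂ : expand p q h ζ₁₂ = varY)
    (v : V) (w₀ : W₀) (w₁ : W₁) (w₂ : W₂) (w₃ : W₃) (K : ℕ)
    (t₀ : ∀ k : ℕ, K ≤ k → M₀.oppositeMode v (-1 - k) w₀ = 0)
    (t₂ : ∀ k : ℕ, K ≤ k → M₂.Y v k w₂ = 0) (t₃ : ∀ k : ℕ, K ≤ k → M₃.Y v k w₃ = 0) :
    iterCorrelator p q h J I w₀ (M₁.Y v (-1) w₁) w₂ w₃ = ∑ k ∈ Finset.range K,
      (ζ₁ ^ (k : ℤ) • iterCorrelator p q h J I (M₀.oppositeMode v (-1 - k) w₀) w₁ w₂ w₃ +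
        ζ₁₂ ^ (-1 - k : ℤ) • iterCorrelator p q h J I w₀ w₁ (M₂.Y v k w₂) w₃ +
        ζ₁ ^ (-1 - k : ℤ) • iterCorrelator p q h J I w₀ w₁ w₂ (M₃.Y v k w₃)) := by
  refine SeriesModule.ext_mode fun N M => ?_
  obtain ⟨T₁, hT₁⟩ := J.truncation w₁ w₂ M
  set T := K + T₁ with hT
  obtain ⟨L, hL⟩ := exists_uniform_bound (fun i => I.truncation (J.mode w₁ (M + i) w₂) w₃ N) T
  set S := K + L with hS
  have hlhs := J.jacobi.associator_neg_one v w₁ w₂ M (K := T)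
    (fun i hi => hT₁ i (by omega)) (fun i hi => t₂ i (by omega))
  have hassoc : ∀ i ∈ Finset.range T, _ := fun i hi =>
    I.jacobi.associator_neg v (J.mode w₁ (M + i) w₂) w₃ i N (K := S)
      (fun j hj => hL i (Finset.mem_range.mp hi) j (by omega)) (fun j hj => t₃ j (by omega))
  have hpos : ∀ k : ℕ,
      (ζ₁ ^ (k : ℤ) • iterCorrelator p q h J I (M₀.oppositeMode v (-1 - k) w₀) w₁ w₂ w₃).mode N M =
      ∑ i ∈ Finset.range T, (k.choose i : ℂ) * M₀.evalDual (M₀.oppositeMode v (-1 - k) w₀)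
        (I.mode (J.mode w₁ (M + i) w₂) (N + k - i) w₃) := by
    intro k
    rw [SeriesModule.mode_zpow_smul_of_binomial (h₁.trans varX_add_varY_eq) (K := T)]
    · refine Finset.sum_congr rfl fun i _ => ?_
      rw [iterCorrelator_mode, ringChoose_natCast]
      simp
    · intro N' i hi
      rw [iterCorrelator_mode, hT₁ i (by omega), map_zero]
      simp
  have hneg : ∀ k : ℕ,
      (ζ₁ ^ (-1 - k : ℤ) • iterCorrelator p q h J I w₀ w₁ w₂ (M₃.Y v k w₃)).mode N M =
      ∑ i ∈ Finset.range T, ((k + i).choose i : ℂ) * ((-1) ^ i * M₀.evalDual w₀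
        (I.mode (J.mode w₁ (M + i) w₂) (N + (-1 - i) - k) (M₃.Y v k w₃))) := by
    intro k
    rw [SeriesModule.mode_zpow_smul_of_binomial (h₁.trans varX_add_varY_eq) (K := T)]
    · refine Finset.sum_congr rfl fun i _ => ?_
      rw [iterCorrelator_mode, ringChoose_neg_one_sub, add_comm i k, Nat.choose_symm_add]
      have e1 : N + ((-1 - (k : ℤ) : ℤ) : ℂ) - i = N + (-1 - i) - k := by
        push_cast
        ring
      rw [e1]
      push_cast
      ring
    · intro N' i hi
      rw [iterCorrelator_mode, hT₁ i (by omega), map_zero]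
      simp
  simp only [SeriesModule.mode_add, SeriesModule.mode_sum, Finset.sum_add_distrib,
    SeriesModule.mode_zpow_smul_of_varY h₁₂, hpos, hneg]
  simp only [iterCorrelator_mode]
  rw [hlhs]
  simp only [map_add, map_sum, Finset.sum_add_distrib, LinearMap.add_apply, LinearMap.sum_apply,
    Pi.add_apply, Finset.sum_apply]
  rw [Finset.sum_congr rfl fun i hi => congrArg (M₀.evalDual w₀) (hassoc i hi)]
  simp only [map_add, map_sum, map_smul, smul_eq_mul, mul_add, Finset.sum_add_distrib,
    M₀.evalDual_contragredient]
  rw [sum_range_extend (f := fun i : ℕ => M₀.evalDual w₀ (I.mode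
      (J.mode w₁ (M + (-1 - i)) (M₂.Y v i w₂)) N w₃))
      (show K ≤ T by omega) (fun i hi => by rw [t₂ i hi]; simp)]
  have hA : ∑ i ∈ Finset.range T, ∑ j ∈ Finset.range S, ((j + i).choose i : ℂ) *
        M₀.evalDual (M₀.oppositeMode v (-1 - i - j) w₀)
          (I.mode (J.mode w₁ (M + i) w₂) (N + j) w₃) =
      ∑ k ∈ Finset.range K, ∑ i ∈ Finset.range T, (k.choose i : ℂ) *
        M₀.evalDual (M₀.oppositeMode v (-1 - k) w₀)
        (I.mode (J.mode w₁ (M + i) w₂) (N + k - i) w₃) := by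
    rw [Finset.sum_comm (s := Finset.range K)]
    refine Finset.sum_congr rfl fun i _ => ?_
    -- With the upper limit `S + i`, the shift of the index by `i` ends exactly at `S`.
    rw [← sum_range_extend (T := S + i) (show K ≤ S + i by omega)
      (fun k hk => by rw [t₀ k hk, M₀.evalDual_zero, mul_zero]),
      sum_choose_shift _ (show i ≤ S + i by omega), Nat.add_sub_cancel]
    refine Finset.sum_congr rfl fun j _ => ?_
    have e1 : N + ((j + i : ℕ) : ℂ) - i = N + j := by push_cast; ring
    have e2 : (-1 - ((j + i : ℕ) : ℤ)) = -1 - i - j := by push_cast; ring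
    rw [e1, e2]
  have hB : ∑ i ∈ Finset.range T, ∑ j ∈ Finset.range S, ((j + i).choose i : ℂ) *
        ((-1) ^ i * M₀.evalDual w₀
        (I.mode (J.mode w₁ (M + i) w₂) (N + (-1 - i) - j) (M₃.Y v j w₃))) =
      ∑ k ∈ Finset.range K, ∑ i ∈ Finset.range T, ((k + i).choose i : ℂ) *
        ((-1) ^ i * M₀.evalDual w₀
        (I.mode (J.mode w₁ (M + i) w₂) (N + (-1 - i) - k) (M₃.Y v k w₃))) := by
    rw [Finset.sum_comm (s := Finset.range K)]
    refine Finset.sum_congr rfl fun i _ => ?_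
    exact sum_range_extend (show K ≤ S by omega)
      (fun k hk => by rw [t₃ k hk]; simp)
  rw [hA, hB]
  push_cast
  ring

/-- The commutator formula for `J` is solved for the term with `v₋₁ w₂`, and the associator formula
for `I` treats `v₋₁` on `J(w₁, y) w₂`. No binomial expansion occurs, since `ζ₂` and `ζ₁₂` are the
variables themselves. -/
theorem iterCorrelator_second (h₂ : expand p q h ζ₂ = varX) (h₁₂ : expand p q h ζ₁₂ = varY)
    (v : V) (w₀ : W₀) (w₁ : W₁) (w₂ : W₂) (w₃ : W₃) (K : ℕ)
    (t₀ : ∀ k : ℕ, K ≤ k → M₀.oppositeMode v (-1 - k) w₀ = 0)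
    (t₁ : ∀ k : ℕ, K ≤ k → M₁.Y v k w₁ = 0) (t₃ : ∀ k : ℕ, K ≤ k → M₃.Y v k w₃ = 0) :
    iterCorrelator p q h J I w₀ w₁ (M₂.Y v (-1) w₂) w₃ = ∑ k ∈ Finset.range K,
      (ζ₂ ^ (k : ℤ) • iterCorrelator p q h J I (M₀.oppositeMode v (-1 - k) w₀) w₁ w₂ w₃ +
        (-ζ₁₂) ^ (-1 - k : ℤ) • iterCorrelator p q h J I w₀ (M₁.Y v k w₁) w₂ w₃ +
        ζ₂ ^ (-1 - k : ℤ) • iterCorrelator p q h J I w₀ w₁ w₂ (M₃.Y v k w₃)) := by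
  refine SeriesModule.ext_mode fun N M => ?_
  obtain ⟨T₁, hT₁⟩ := I.truncation (J.mode w₁ M w₂) w₃ N
  set T := K + T₁ with hT
  have hassoc := I.jacobi.associator_neg_one v (J.mode w₁ M w₂) w₃ N (K := T)
    (fun i hi => hT₁ i (by omega)) (fun i hi => t₃ i (by omega))
  have hcomm := J.jacobi.commutator v w₁ w₂ (-1) M t₁ (fun n => by rw [map_zero]; rfl)
  have hlhs := eq_sub_of_add_eq hcomm.symm
  simp only [SeriesModule.mode_add, SeriesModule.mode_sum, Finset.sum_add_distrib, neg_zpow_smul,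
    SeriesModule.mode_smul,
    SeriesModule.mode_zpow_smul_of_varX h₂, SeriesModule.mode_zpow_smul_of_varY h₁₂]
  simp only [iterCorrelator_mode]
  rw [hlhs, map_sub, Pi.sub_apply, LinearMap.sub_apply, map_sub, hassoc]
  simp only [map_add, map_sum, map_smul, smul_eq_mul, Finset.sum_add_distrib,
    M₀.evalDual_contragredient, LinearMap.sum_apply, LinearMap.smul_apply, Finset.sum_apply,
    Pi.smul_apply, ringChoose_neg_one]
  rw [sum_range_extend (f := fun i : ℕ => M₀.evalDual (M₀.oppositeMode v (-1 - i) w₀)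
      (I.mode (J.mode w₁ M w₂) (N + i) w₃))
      (show K ≤ T by omega) (fun i hi => by rw [t₀ i hi, M₀.evalDual_zero]),
    sum_range_extend (f := fun i : ℕ => M₀.evalDual w₀ (I.mode (J.mode w₁ M w₂)
      (N + (-1 - i)) (M₃.Y v i w₃)))
      (show K ≤ T by omega) (fun i hi => by rw [t₃ i hi]; simp only [map_zero])]
  have e : ∀ j : ℕ, ((-1 : ℤ) : ℂ) + M - j = M + ((-1 - j : ℤ) : ℂ) := by
    intro j
    push_cast
    ring
  simp only [e, neg_mul, Finset.sum_neg_distrib]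
  push_cast
  ring

theorem iterCorrelator_relations (h₁ : expand p q h ζ₁ = varX + varY)
    (h₂ : expand p q h ζ₂ = varX) (h₁₂ : expand p q h ζ₁₂ = varY) :
    CorrelatorRelations M₀ M₁ M₂ M₃ ζ₁ ζ₂ ζ₁₂ (iterCorrelator p q h J I) where
  first := iterCorrelator_first h J I h₁ h₁₂
  second := iterCorrelator_second h J I h₂ h₁₂
  outer := iterCorrelator_outer h J I h₁ h₂

end IterateRelations

end VOA
end

noncomputable section

namespace VOA

/-! ### Weights and `C₁`-cofiniteness -/

namespace VertexOperatorAlgebra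

variable {V : Type*} [AddCommGroup V] [Module ℂ V] (𝒱 : VertexOperatorAlgebra V)

theorem decompose_of_mem {v : V} {h : ℤ} (hv : v ∈ 𝒱.weightSpace h) (n : ℤ) :
    (𝒱.decompose v n : V) = if n = h then v else 0 := by
  classical
  have h1 : 𝒱.decompose v = DirectSum.of (fun n : ℤ => 𝒱.weightSpace n) h ⟨v, hv⟩ := by
    rw [decompose, LinearEquiv.symm_apply_eq]
    exact (DirectSum.coeLinearMap_of (fun n : ℤ => 𝒱.weightSpace n) h ⟨v, hv⟩).symm
  rw [h1]
  split_ifs with hn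
  · subst hn
    rw [DirectSum.of_eq_same]
  · rw [DirectSum.of_eq_of_ne _ _ _ hn]
    rfl

theorem weightSpace_eq_bot {N : ℤ} (hN : ∀ n : ℤ, n < N → (𝒱.Y 𝒱.ω 1).eigenspace (n : ℂ) = ⊥)
    {n : ℤ} (hn : n < N) : 𝒱.weightSpace n = ⊥ := hN n hn

theorem exists_L_one_pow_eq_zero {v : V} {h : ℤ} (hv : v ∈ 𝒱.weightSpace h) :
    ∃ B : ℕ, ∀ i : ℕ, B ≤ i → ((𝒱.Y 𝒱.ω 2) ^ i) v = 0 := by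
  obtain ⟨N, hN⟩ := 𝒱.lower_bounded
  refine ⟨(h - N + 1).toNat, fun i hi => ?_⟩
  have h1 := DiscreteModule.L_one_pow_mem (𝒱 := 𝒱) hv i
  rw [𝒱.weightSpace_eq_bot hN (by omega)] at h1
  exact h1

end VertexOperatorAlgebra

namespace DiscreteModule

variable {V : Type*} [AddCommGroup V] [Module ℂ V] {𝒱 : VertexOperatorAlgebra V}
  {W : Type*} [AddCommGroup W] [Module ℂ W] (M : DiscreteModule 𝒱 W)

theorem mode_mem {v : V} {h : ℤ} (hv : v ∈ 𝒱.weightSpace h) {w : W} {r : ℝ}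
    (hw : w ∈ M.weightSpace r) (n : ℤ) :
    M.Y v n w ∈ M.weightSpace (r + ((h - n - 1 : ℤ) : ℝ)) := by
  have := mode_mem_eigenspace 𝒱 M.Y M.jacobi M.derivative hv hw n
  unfold weightSpace
  convert this using 2
  push_cast
  ring

theorem L_neg_one_pow_mem {w : W} {r : ℝ} (hw : w ∈ M.weightSpace r) (k : ℕ) :
    ((M.Y 𝒱.ω 0) ^ k) w ∈ M.weightSpace (r + ((k : ℤ) : ℝ)) := by
  induction k with
  | zero => simpa using hw
  | succ k ih =>
    rw [pow_succ', Module.End.mul_apply]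
    have := M.mode_mem (h := 2) 𝒱.ω_mem ih 0
    convert this using 2
    push_cast
    ring

/-! #### Lower bounds and finiteness of the weights -/

/-- Eigenvectors of different weights are independent, and those of weight at most `C` span a
finite-dimensional space. -/
theorem finite_weights (C : ℝ) : {r : ℝ | r ≤ C ∧ M.weightSpace r ≠ ⊥}.Finite := by
  set S := {r : ℝ | r ≤ C ∧ M.weightSpace r ≠ ⊥}
  set P : Submodule ℂ W := ⨆ s : {s : ℝ // s ≤ C}, (M.Y 𝒱.ω 1).eigenspace ((s : ℝ) : ℂ)
  have hP : FiniteDimensional ℂ P := M.discrete C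
  have hne : ∀ r : S, ∃ w ∈ M.weightSpace r, w ≠ 0 := fun r => Submodule.exists_mem_ne_zero_of_ne_bot r.2.2
  choose f hf hf0 using hne
  have hind : iSupIndep fun r : ℝ => M.weightSpace r := M.isInternal.submodule_iSupIndep
  have hlin : LinearIndependent ℂ f :=
    (hind.comp Subtype.val_injective).linearIndependent _ hf hf0
  have hfP : ∀ r : S, f r ∈ P := fun r =>
    Submodule.mem_iSup_of_mem (⟨r.1, r.2.1⟩ : {s : ℝ // s ≤ C}) (hf r)
  have hlin' : LinearIndependent ℂ fun r : S => (⟨f r, hfP r⟩ : P) :=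
    LinearIndependent.of_comp P.subtype hlin
  have : Finite S := hlin'.finite
  exact Set.toFinite S

theorem exists_lower_bound : ∃ b : ℝ, ∀ r : ℝ, ∀ w ∈ M.weightSpace r, w ≠ 0 → b ≤ r := by
  obtain ⟨b, hb⟩ := (M.finite_weights 0).bddBelow
  refine ⟨min b 0, fun r w hw h0 => ?_⟩
  rcases le_or_gt r 0 with hr | hr
  · refine (min_le_left _ _).trans (hb ⟨hr, fun hbot => h0 ?_⟩)
    rw [hbot] at hw
    exact hw
  · exact (min_le_right _ _).trans hr.le

theorem exists_finite_generators (C : ℝ) : ∃ G : Set (ℝ × W), G.Finite ∧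
    (∀ g ∈ G, g.2 ∈ M.weightSpace g.1) ∧
    ∀ r ≤ C, ∀ w ∈ M.weightSpace r, w ∈ Submodule.span ℂ {x | (r, x) ∈ G} := by
  have hfd : ∀ r : ℝ, ∃ s : Set W, s.Finite ∧ Submodule.span ℂ s = M.weightSpace r := by
    intro r
    have h1 : FiniteDimensional ℂ (M.weightSpace r) := by
      have := M.discrete r
      refine Submodule.finiteDimensional_of_le (S₂ := ⨆ s : {s : ℝ // s ≤ r},
        (M.Y 𝒱.ω 1).eigenspace ((s : ℝ) : ℂ)) ?_
      exact le_iSup (fun s : {s : ℝ // s ≤ r} => (M.Y 𝒱.ω 1).eigenspace ((s : ℝ) : ℂ)) ⟨r, le_rfl⟩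
    exact Submodule.fg_def.mp (Module.Finite.iff_fg.mp h1)
  choose s hs hspan using hfd
  refine ⟨⋃ r ∈ {r : ℝ | r ≤ C ∧ M.weightSpace r ≠ ⊥}, (fun x => (r, x)) '' s r,
    (M.finite_weights C).biUnion fun r _ => (hs r).image _, ?_, ?_⟩
  · intro g hg
    simp only [Set.mem_iUnion] at hg
    obtain ⟨r, _, x, hx, rfl⟩ := hg
    show x ∈ M.weightSpace r
    rw [← hspan r]
    exact Submodule.subset_span hx
  · intro r hr w hw
    by_cases hbot : M.weightSpace r = ⊥
    · rw [hbot] at hw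
      rw [(Submodule.mem_bot ℂ).mp hw]
      exact zero_mem _
    · rw [← hspan r] at hw
      refine Submodule.span_mono (fun x hx => ?_) hw
      exact Set.mem_biUnion (show r ∈ {r : ℝ | r ≤ C ∧ M.weightSpace r ≠ ⊥} from ⟨hr, hbot⟩)
        ⟨x, hx, rfl⟩

/-- A vector is a finite sum of homogeneous vectors. -/
theorem exists_homogeneous_sum (w : W) : ∃ (S : Finset ℝ) (f : ℝ → W),
    (∀ r, f r ∈ M.weightSpace r) ∧ w = ∑ r ∈ S, f r := by
  have h : w ∈ ⨆ r : ℝ, M.weightSpace r := by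
    have := M.isInternal.submodule_iSup_eq_top
    exact this ▸ Submodule.mem_top
  obtain ⟨f, hf, hsum⟩ := (Submodule.mem_iSup_iff_exists_finsupp _ _).mp h
  exact ⟨f.support, f, hf, hsum.symm⟩

/-- The projection to the homogeneous subspace of weight `r`. -/
def weightProj (r : ℝ) : W →ₗ[ℂ] W := by
  classical
  exact (M.weightSpace r).subtype ∘ₗ
    DirectSum.component ℂ ℝ (fun r : ℝ => M.weightSpace r) r ∘ₗ
    (LinearEquiv.ofBijective (DirectSum.coeLinearMap fun r : ℝ => M.weightSpace r)
      M.isInternal).symm.toLinearMap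

theorem weightProj_of_mem {w : W} {s : ℝ} (hw : w ∈ M.weightSpace s) (r : ℝ) :
    M.weightProj r w = if r = s then w else 0 := by
  classical
  have h1 : (LinearEquiv.ofBijective (DirectSum.coeLinearMap fun r : ℝ => M.weightSpace r)
      M.isInternal).symm w = DirectSum.of (fun r : ℝ => M.weightSpace r) s ⟨w, hw⟩ := by
    rw [LinearEquiv.symm_apply_eq]
    exact (DirectSum.coeLinearMap_of (fun r : ℝ => M.weightSpace r) s ⟨w, hw⟩).symm
  have h2 : M.weightProj r w =
      (DirectSum.of (fun r : ℝ => M.weightSpace r) s ⟨w, hw⟩ r : W) := by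
    rw [← h1]
    rfl
  rw [h2]
  split_ifs with hn
  · subst hn
    rw [DirectSum.of_eq_same]
  · rw [DirectSum.of_eq_of_ne _ _ _ hn]
    rfl

/-- The span of the homogeneous vectors `v_{-1} w` of weight `r` with `v` of positive weight. -/
def homogeneousC₁ (r : ℝ) : Submodule ℂ W :=
  Submodule.span ℂ {x | ∃ h : ℤ, 0 < h ∧ ∃ v ∈ 𝒱.weightSpace h,
    ∃ w ∈ M.weightSpace (r - (h : ℝ)), x = M.Y v (-1) w}

/-- Both `V₊` and `W` are spanned by homogeneous vectors, and for such `u` and `w` the vector `u₋₁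
w` is homogeneous, so its projection is either itself or zero. -/
theorem weightProj_mem_homogeneousC₁ {c : W} (hc : c ∈ M.C₁) (r : ℝ) :
    M.weightProj r c ∈ M.homogeneousC₁ r := by
  suffices M.C₁ ≤ (M.homogeneousC₁ r).comap (M.weightProj r) from this hc
  refine Submodule.span_le.mpr ?_
  rintro _ ⟨u, hu, w, rfl⟩
  rw [SetLike.mem_coe, Submodule.mem_comap]
  obtain ⟨S, f, hf, rfl⟩ := M.exists_homogeneous_sum w
  rw [map_sum, map_sum]
  refine sum_mem fun s _ => ?_
  refine Submodule.iSup_induction (fun n : {n : ℤ // 0 < n} => 𝒱.weightSpace n)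
    (motive := fun u => M.weightProj r (M.Y u (-1) (f s)) ∈ M.homogeneousC₁ r) hu ?_ ?_ ?_
  · rintro ⟨h, hpos⟩ v hv
    have h1 := M.mode_mem hv (hf s) (-1)
    rw [M.weightProj_of_mem h1]
    split_ifs with hr
    · refine Submodule.subset_span ⟨h, hpos, v, hv, f s, ?_, rfl⟩
      have : r - (h : ℝ) = s := by
        rw [hr]
        push_cast
        ring
      rw [this]
      exact hf s
    · exact zero_mem _
  · simp
  · intro u v hu hv
    simpa using add_mem hu hv

theorem exists_mem_weights_le (w : W) :
    ∃ K : ℝ, ∀ K' ≥ K, w ∈ ⨆ s : {s : ℝ // s ≤ K'}, M.weightSpace s := by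
  obtain ⟨S, f, hf, rfl⟩ := M.exists_homogeneous_sum w
  obtain ⟨K, hK⟩ := S.bddAbove
  refine ⟨K, fun K' hK' => sum_mem fun r hr => ?_⟩
  exact Submodule.mem_iSup_of_mem (⟨r, (hK hr).trans hK'⟩ : {s : ℝ // s ≤ K'}) (hf r)

/-- A finite-dimensional complement of `C₁` involves only weights up to some `K`. Projection to a
weight above `K` kills it and maps `C₁` to its homogeneous part. -/
theorem C₁Cofinite.exists_bound {M : DiscreteModule 𝒱 W} (hM : M.C₁Cofinite) :
    ∃ K : ℝ, ∀ r > K, M.weightSpace r ≤ M.homogeneousC₁ r := by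
  classical
  obtain ⟨F, hF⟩ := Submodule.exists_isCompl M.C₁
  have hfin : FiniteDimensional ℂ F :=
    have : FiniteDimensional ℂ (W ⧸ M.C₁) := hM
    (Submodule.quotientEquivOfIsCompl M.C₁ F hF).finiteDimensional
  obtain ⟨t, ht⟩ := Module.Finite.iff_fg.mp hfin
  choose k hk using M.exists_mem_weights_le
  obtain ⟨K, hK⟩ := (t.image k).bddAbove
  have hFK : F ≤ ⨆ s : {s : ℝ // s ≤ K}, M.weightSpace s := by
    rw [← ht]
    exact Submodule.span_le.mpr fun x hx =>
      hk x K (hK (Finset.mem_coe.mpr (Finset.mem_image_of_mem k hx)))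
  refine ⟨K, fun r hr w hw => ?_⟩
  have hw' : w ∈ M.C₁ ⊔ F := hF.sup_eq_top ▸ Submodule.mem_top
  obtain ⟨c, hc, f, hf, hcf⟩ := Submodule.mem_sup.mp hw'
  have h1 : M.weightProj r f = 0 := by
    have h2 : (⨆ s : {s : ℝ // s ≤ K}, M.weightSpace s) ≤ LinearMap.ker (M.weightProj r) := by
      refine iSup_le fun s x hx => ?_
      rw [LinearMap.mem_ker, M.weightProj_of_mem hx, if_neg (s.2.trans_lt hr).ne']
    exact h2 (hFK hf)
  have h3 : w = M.weightProj r c := by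
    have := congrArg (M.weightProj r) hcf
    rw [map_add, h1, add_zero, M.weightProj_of_mem hw, if_pos rfl] at this
    exact this.symm
  rw [h3]
  exact M.weightProj_mem_homogeneousC₁ hc r

/-! #### Modes of opposite vertex operators -/

theorem oppositeMode_eq_sum {v : V} {h : ℤ} (hv : v ∈ 𝒱.weightSpace h) {B : ℕ}
    (hB : ∀ i : ℕ, B ≤ i → ((𝒱.Y 𝒱.ω 2) ^ i) v = 0) (n : ℤ) :
    M.oppositeMode v n = ∑ i ∈ Finset.range B, ((-1 : ℂ) ^ h / (i.factorial : ℂ)) •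
      M.Y (((𝒱.Y 𝒱.ω 2) ^ i) v) (2 * h - n - i - 2) := by
  unfold oppositeMode
  rw [finsum_eq_sum_of_support_subset (s := (Finset.range B).image fun i => (h, i))]
  · rw [Finset.sum_image (by simp)]
    refine Finset.sum_congr rfl fun i _ => ?_
    rw [𝒱.decompose_of_mem hv, if_pos rfl]
  · rintro ⟨a, i⟩ hai
    rw [Finset.mem_coe, Finset.mem_image]
    rw [Function.mem_support] at hai
    simp only [𝒱.decompose_of_mem hv] at hai
    by_cases ha : a = h
    · subst ha
      refine ⟨i, ?_, rfl⟩
      rw [Finset.mem_range]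
      by_contra hi
      rw [if_pos rfl, hB i (not_lt.mp hi)] at hai
      simp at hai
    · rw [if_neg ha] at hai
      simp at hai

theorem oppositeMode_mem {v : V} {h : ℤ} (hv : v ∈ 𝒱.weightSpace h) {w : W} {r : ℝ}
    (hw : w ∈ M.weightSpace r) (n : ℤ) :
    M.oppositeMode v n w ∈ M.weightSpace (r + ((n + 1 - h : ℤ) : ℝ)) := by
  obtain ⟨B, hB⟩ := 𝒱.exists_L_one_pow_eq_zero hv
  rw [M.oppositeMode_eq_sum hv hB, LinearMap.sum_apply]
  refine sum_mem fun i _ => ?_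
  rw [LinearMap.smul_apply]
  refine Submodule.smul_mem _ _ ?_
  convert M.mode_mem (L_one_pow_mem hv i) hw (2 * h - n - i - 2) using 3
  push_cast
  ring

theorem exists_oppositeMode_truncation {v : V} {h : ℤ} (hv : v ∈ 𝒱.weightSpace h) (w : W) :
    ∃ K : ℕ, ∀ k : ℕ, K ≤ k → M.oppositeMode v (-1 - k) w = 0 := by
  obtain ⟨B, hB⟩ := 𝒱.exists_L_one_pow_eq_zero hv
  obtain ⟨L, hL⟩ := exists_uniform_bound
    (fun i => M.exists_truncation (((𝒱.Y 𝒱.ω 2) ^ i) v) w) B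
  -- This makes the mode index `2h - (-1 - k) - i - 2` at least `L` for all `i < B`.
  refine ⟨L + B + (1 - 2 * h).toNat, fun k hk => ?_⟩
  rw [M.oppositeMode_eq_sum hv hB, LinearMap.sum_apply]
  refine Finset.sum_eq_zero fun i hi => ?_
  rw [Finset.mem_range] at hi
  have h1 := hL i hi (2 * h - (-1 - k) - i - 2).toNat (by omega)
  rw [Int.toNat_of_nonneg (by omega)] at h1
  rw [LinearMap.smul_apply, h1, smul_zero]

/-- Up to sign, an opposite mode of `v` is a mode of `v` plus modes of multiples of `L(1)^i v`, `i ≥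
1`, which have lower weight. This triangular system is inverted by induction on the weight, bounded
below in `V`. The result links the cofiniteness of `W₀`, which concerns `v₋₁`, to the relations, in
which opposite modes act on `w₀`. -/
theorem mode_mem_span_oppositeMode {v : V} {p : ℤ} (hv : v ∈ 𝒱.weightSpace p) (q : ℤ) (w : W) :
    M.Y v q w ∈ Submodule.span ℂ {x | ∃ p' ≤ p, ∃ u ∈ 𝒱.weightSpace p',
      x = M.oppositeMode u (p' + p - q - 2) w} := by
  obtain ⟨N, hN⟩ := 𝒱.lower_bounded
  obtain ⟨m, hm⟩ : ∃ m : ℕ, p < N + m := ⟨(p - N + 1).toNat, by omega⟩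
  induction m generalizing p q v with
  | zero =>
    rw [𝒱.weightSpace_eq_bot hN (by simpa using hm), Submodule.mem_bot] at hv
    simp [hv]
  | succ m ih =>
    obtain ⟨B, hB⟩ := 𝒱.exists_L_one_pow_eq_zero hv
    -- The index `p + p - q - 2` is chosen so that the term `i = 0` is the mode `q`; the range `B +
    -- 1` guarantees that this term is present.
    have h1 := congrArg (fun A : Module.End ℂ W => A w)
      (M.oppositeMode_eq_sum hv (B := B + 1) (fun i hi => hB i (by omega)) (p + p - q - 2))
    simp only [Finset.sum_range_succ', LinearMap.add_apply, LinearMap.sum_apply,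
      LinearMap.smul_apply] at h1
    have e : 2 * p - (p + p - q - 2) - ((0 : ℕ) : ℤ) - 2 = q := by push_cast; ring
    have hsgn : (-1 : ℂ) ^ p / ((Nat.factorial 0 : ℕ) : ℂ) ≠ 0 := by
      simp [zpow_ne_zero]
    rw [e, pow_zero, Module.End.one_apply, ← sub_eq_iff_eq_add'] at h1
    have h2 : M.Y v q w = ((-1 : ℂ) ^ p / ((Nat.factorial 0 : ℕ) : ℂ))⁻¹ •
        (((-1 : ℂ) ^ p / ((Nat.factorial 0 : ℕ) : ℂ)) • M.Y v q w) := by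
      rw [smul_smul, inv_mul_cancel₀ hsgn, one_smul]
    rw [h2, ← h1]
    refine Submodule.smul_mem _ _ (sub_mem ?_ (sum_mem fun i _ => Submodule.smul_mem _ _ ?_))
    · exact Submodule.subset_span ⟨p, le_rfl, v, hv, rfl⟩
    · have h3 := ih (L_one_pow_mem hv (i + 1)) (2 * p - (p + p - q - 2) - ((i + 1 : ℕ) : ℤ) - 2)
        (by push_cast at hm ⊢; omega)
      refine Submodule.span_mono ?_ h3
      rintro _ ⟨p', hp', u, hu, rfl⟩
      refine ⟨p', by omega, u, hu, ?_⟩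
      congr 2
      ring

end DiscreteModule

end VOA
end

noncomputable section

namespace VOA

/-! ### Reduction to vectors of bounded weight -/

theorem zpow_mem_of_nonneg {G : Type*} [Group G] (S : Submonoid G) {a : G} (ha : a ∈ S) {n : ℤ}
    (hn : 0 ≤ n) : a ^ n ∈ S := by
  lift n to ℕ using hn
  rw [zpow_natCast]
  exact pow_mem ha n

/-- The units of `R` that lie in the subalgebra `O`. -/
def unitsIn {R : Type*} [CommRing R] [Algebra ℂ R] (O : Subalgebra ℂ R) : Submonoid Rˣ :=
  O.toSubmonoid.comap (Units.coeHom R)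

section Reduction

variable {V : Type*} [AddCommGroup V] [Module ℂ V] {𝒱 : VertexOperatorAlgebra V}
  {W₀ : Type*} [AddCommGroup W₀] [Module ℂ W₀] (M₀ : DiscreteModule 𝒱 W₀)
  {W₁ : Type*} [AddCommGroup W₁] [Module ℂ W₁] (M₁ : DiscreteModule 𝒱 W₁)
  {W₂ : Type*} [AddCommGroup W₂] [Module ℂ W₂] (M₂ : DiscreteModule 𝒱 W₂)
  {W₃ : Type*} [AddCommGroup W₃] [Module ℂ W₃] (M₃ : DiscreteModule 𝒱 W₃)
  {R : Type*} [CommRing R] [Algebra ℂ R] (O : Subalgebra ℂ R)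
  {Q : Type*} [AddCommGroup Q] [Module ℂ Q] [Module R Q] [IsScalarTower ℂ R Q]

/-- The factor by which a correlator of homogeneous vectors is scaled. -/
def scaling (s : Fin 4 → Rˣ) (r : Fin 4 → ℝ) : Rˣ :=
  s 0 ^ ⌊r 0⌋ * s 1 ^ ⌊r 1⌋ * s 2 ^ ⌊r 2⌋ * s 3 ^ ⌊r 3⌋

omit [Algebra ℂ R] in
-- Weights are real, but modes shift them by integers, which pass through the floor. Hence the shift
-- changes the scaling by an honest monomial in the `s i`.
theorem scaling_add (s : Fin 4 → Rˣ) (r : Fin 4 → ℝ) (δ : Fin 4 → ℤ) :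
    scaling s (fun i => r i + (δ i : ℝ)) =
      (s 0 ^ δ 0 * s 1 ^ δ 1 * s 2 ^ δ 2 * s 3 ^ δ 3) * scaling s r := by
  simp only [scaling, Int.floor_add_intCast]
  apply Additive.ofMul.injective
  simp only [ofMul_mul, ofMul_zpow]
  module

/-- The span over `O` of the scaled correlators of homogeneous vectors of total weight at
most `N`. -/
def boundedSpan (s : Fin 4 → Rˣ) (Φ : W₀ →ₗ[ℂ] W₁ →ₗ[ℂ] W₂ →ₗ[ℂ] W₃ →ₗ[ℂ] Q) (N : ℝ) :
    Submodule O Q :=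
  Submodule.span O {x | ∃ r : Fin 4 → ℝ, r 0 + r 1 + r 2 + r 3 ≤ N ∧
    ∃ w₀ ∈ M₀.weightSpace (r 0), ∃ w₁ ∈ M₁.weightSpace (r 1), ∃ w₂ ∈ M₂.weightSpace (r 2),
      ∃ w₃ ∈ M₃.weightSpace (r 3), x = scaling s r • Φ w₀ w₁ w₂ w₃}

variable {M₀ M₁ M₂ M₃ O} {s : Fin 4 → Rˣ} {Φ : W₀ →ₗ[ℂ] W₁ →ₗ[ℂ] W₂ →ₗ[ℂ] W₃ →ₗ[ℂ] Q}

omit [IsScalarTower ℂ R Q] in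
theorem boundedSpan_mono {N N' : ℝ} (h : N ≤ N') :
    boundedSpan M₀ M₁ M₂ M₃ O s Φ N ≤ boundedSpan M₀ M₁ M₂ M₃ O s Φ N' :=
  Submodule.span_mono fun _ ⟨r, hr, hx⟩ => ⟨r, hr.trans h, hx⟩

theorem complex_smul_mem {P : Submodule O Q} (c : ℂ) {x : Q} (hx : x ∈ P) : c • x ∈ P := by
  have := P.smul_mem (algebraMap ℂ O c) hx
  rw [algebraMap_smul] at this
  exact this

/-- The vectors that a unit scales into a submodule over `O`. -/
def scaledPreimage (P : Submodule O Q) (τ : Rˣ) : Submodule ℂ Q where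
  carrier := {x | τ • x ∈ P}
  zero_mem' := by simp
  add_mem' := by
    intro x y hx hy
    rw [Set.mem_ofPred_eq, smul_add]
    exact add_mem hx hy
  smul_mem' := by
    intro c x hx
    rw [Set.mem_ofPred_eq, Units.smul_def, smul_comm]
    exact complex_smul_mem c hx

theorem mem_scaledPreimage {P : Submodule O Q} {τ : Rˣ} {x : Q} :
    x ∈ scaledPreimage P τ ↔ τ • x ∈ P := Iff.rfl

omit [IsScalarTower ℂ R Q] in
-- The criterion for a single term of a relation: `δ` lists the weight shifts, and the coefficient
-- `t`, divided by the change of scaling that `δ` causes, must be regular.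
theorem scaled_mem_boundedSpan {r : Fin 4 → ℝ} {d : ℤ} {t : Rˣ} {w₀ : W₀} {w₁ : W₁} {w₂ : W₂}
    {w₃ : W₃} (δ : Fin 4 → ℤ) (hw₀ : w₀ ∈ M₀.weightSpace (r 0 + (δ 0 : ℝ)))
    (hw₁ : w₁ ∈ M₁.weightSpace (r 1 + (δ 1 : ℝ))) (hw₂ : w₂ ∈ M₂.weightSpace (r 2 + (δ 2 : ℝ)))
    (hw₃ : w₃ ∈ M₃.weightSpace (r 3 + (δ 3 : ℝ))) (hδ : δ 0 + δ 1 + δ 2 + δ 3 ≤ d)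
    (ht : t * (s 0 ^ δ 0 * s 1 ^ δ 1 * s 2 ^ δ 2 * s 3 ^ δ 3)⁻¹ ∈ unitsIn O) :
    (t * scaling s r) • Φ w₀ w₁ w₂ w₃ ∈
      boundedSpan M₀ M₁ M₂ M₃ O s Φ (r 0 + r 1 + r 2 + r 3 + (d : ℝ)) := by
  have h1 : scaling s (fun i => r i + (δ i : ℝ)) • Φ w₀ w₁ w₂ w₃ ∈
      boundedSpan M₀ M₁ M₂ M₃ O s Φ (r 0 + r 1 + r 2 + r 3 + (d : ℝ)) := by
    refine Submodule.subset_span ⟨fun i => r i + (δ i : ℝ), ?_, w₀, hw₀, w₁, hw₁, w₂, hw₂, w₃, hw₃,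
      rfl⟩
    have : ((δ 0 + δ 1 + δ 2 + δ 3 : ℤ) : ℝ) ≤ d := by exact_mod_cast hδ
    push_cast at this
    linarith
  have h2 : t * scaling s r = (t * (s 0 ^ δ 0 * s 1 ^ δ 1 * s 2 ^ δ 2 * s 3 ^ δ 3)⁻¹) *
      scaling s (fun i => r i + (δ i : ℝ)) := by
    rw [scaling_add, mul_assoc, inv_mul_cancel_left]
  rw [h2, mul_smul]
  exact Submodule.smul_mem _ (⟨_, ht⟩ : O) h1

theorem linear_mem_of_span {W : Type*} [AddCommGroup W] [Module ℂ W] {P : Submodule ℂ Q}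
    (f : W →ₗ[ℂ] Q) {X : Set W} (hX : ∀ x ∈ X, f x ∈ P) {w : W} (hw : w ∈ Submodule.span ℂ X) :
    f w ∈ P :=
  (Submodule.span_le (p := P.comap f)).mpr hX hw

theorem mem_of_span_zero {P : Submodule ℂ Q} {X : Set W₀} {w₀ : W₀} {w₁ : W₁} {w₂ : W₂} {w₃ : W₃}
    (hX : ∀ x ∈ X, Φ x w₁ w₂ w₃ ∈ P) (hw : w₀ ∈ Submodule.span ℂ X) : Φ w₀ w₁ w₂ w₃ ∈ P :=
  linear_mem_of_span (LinearMap.applyₗ w₃ ∘ₗ LinearMap.applyₗ w₂ ∘ₗ LinearMap.applyₗ w₁ ∘ₗ Φ) hX hw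

theorem mem_of_span_one {P : Submodule ℂ Q} {X : Set W₁} {w₀ : W₀} {w₁ : W₁} {w₂ : W₂} {w₃ : W₃}
    (hX : ∀ x ∈ X, Φ w₀ x w₂ w₃ ∈ P) (hw : w₁ ∈ Submodule.span ℂ X) : Φ w₀ w₁ w₂ w₃ ∈ P :=
  linear_mem_of_span (LinearMap.applyₗ w₃ ∘ₗ LinearMap.applyₗ w₂ ∘ₗ Φ w₀) hX hw

theorem mem_of_span_two {P : Submodule ℂ Q} {X : Set W₂} {w₀ : W₀} {w₁ : W₁} {w₂ : W₂} {w₃ : W₃}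
    (hX : ∀ x ∈ X, Φ w₀ w₁ x w₃ ∈ P) (hw : w₂ ∈ Submodule.span ℂ X) : Φ w₀ w₁ w₂ w₃ ∈ P :=
  linear_mem_of_span (LinearMap.applyₗ w₃ ∘ₗ Φ w₀ w₁) hX hw

theorem mem_of_span_three {P : Submodule ℂ Q} {X : Set W₃} {w₀ : W₀} {w₁ : W₁} {w₂ : W₂} {w₃ : W₃}
    (hX : ∀ x ∈ X, Φ w₀ w₁ w₂ x ∈ P) (hw : w₃ ∈ Submodule.span ℂ X) : Φ w₀ w₁ w₂ w₃ ∈ P :=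
  linear_mem_of_span (Φ w₀ w₁ w₂) hX hw

/-- The weights of nonzero vectors are bounded below, so a bound on the total weight bounds each
weight from above, and finitely many homogeneous generators suffice in each module. -/
theorem boundedSpan_fg (N : ℝ) : (boundedSpan M₀ M₁ M₂ M₃ O s Φ N).FG := by
  obtain ⟨b₀, hb₀⟩ := M₀.exists_lower_bound
  obtain ⟨b₁, hb₁⟩ := M₁.exists_lower_bound
  obtain ⟨b₂, hb₂⟩ := M₂.exists_lower_bound
  obtain ⟨b₃, hb₃⟩ := M₃.exists_lower_bound
  obtain ⟨G₀, hG₀, hm₀, hs₀⟩ := M₀.exists_finite_generators (N - b₁ - b₂ - b₃)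
  obtain ⟨G₁, hG₁, hm₁, hs₁⟩ := M₁.exists_finite_generators (N - b₀ - b₂ - b₃)
  obtain ⟨G₂, hG₂, hm₂, hs₂⟩ := M₂.exists_finite_generators (N - b₀ - b₁ - b₃)
  obtain ⟨G₃, hG₃, hm₃, hs₃⟩ := M₃.exists_finite_generators (N - b₀ - b₁ - b₂)
  set X : Set Q := (fun g : (ℝ × W₀) × (ℝ × W₁) × (ℝ × W₂) × (ℝ × W₃) =>
    scaling s ![g.1.1, g.2.1.1, g.2.2.1.1, g.2.2.2.1] • Φ g.1.2 g.2.1.2 g.2.2.1.2 g.2.2.2.2) ''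
      {g | (g ∈ G₀ ×ˢ G₁ ×ˢ G₂ ×ˢ G₃) ∧ g.1.1 + g.2.1.1 + g.2.2.1.1 + g.2.2.2.1 ≤ N} with hX
  refine Submodule.fg_def.mpr ⟨X, ((hG₀.prod (hG₁.prod (hG₂.prod hG₃))).subset
    (fun g hg => hg.1)).image _, le_antisymm (Submodule.span_le.mpr ?_)
    (Submodule.span_le.mpr ?_)⟩
  · rintro _ ⟨⟨⟨r₀, x₀⟩, ⟨r₁, x₁⟩, ⟨r₂, x₂⟩, ⟨r₃, x₃⟩⟩, ⟨⟨h0, h1, h2, h3⟩, hN⟩, rfl⟩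
    refine Submodule.subset_span ⟨![r₀, r₁, r₂, r₃], hN, x₀, ?_, x₁, ?_, x₂, ?_, x₃, ?_, rfl⟩
    · exact hm₀ (r₀, x₀) h0
    · exact hm₁ (r₁, x₁) h1
    · exact hm₂ (r₂, x₂) h2
    · exact hm₃ (r₃, x₃) h3
  · rintro _ ⟨r, hr, w₀, hw₀, w₁, hw₁, w₂, hw₂, w₃, hw₃, rfl⟩
    rw [SetLike.mem_coe, ← mem_scaledPreimage]
    -- The zero vector lies in every weight space and escapes the lower bounds.
    by_cases h0 : w₀ = 0
    · simp [h0]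
    by_cases h1 : w₁ = 0
    · simp [h1]
    by_cases h2 : w₂ = 0
    · simp [h2]
    by_cases h3 : w₃ = 0
    · simp [h3]
    have l0 := hb₀ _ _ hw₀ h0
    have l1 := hb₁ _ _ hw₁ h1
    have l2 := hb₂ _ _ hw₂ h2
    have l3 := hb₃ _ _ hw₃ h3
    refine mem_of_span_zero (fun x₀ hx₀ => ?_) (hs₀ _ (by linarith) _ hw₀)
    refine mem_of_span_one (fun x₁ hx₁ => ?_) (hs₁ _ (by linarith) _ hw₁)
    refine mem_of_span_two (fun x₂ hx₂ => ?_) (hs₂ _ (by linarith) _ hw₂)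
    refine mem_of_span_three (fun x₃ hx₃ => ?_) (hs₃ _ (by linarith) _ hw₃)
    rw [mem_scaledPreimage]
    refine Submodule.subset_span ⟨((r 0, x₀), (r 1, x₁), (r 2, x₂), (r 3, x₃)),
      ⟨⟨hx₀, hx₁, hx₂, hx₃⟩, hr⟩, rfl⟩

/-- Correlators with an insertion `v_{-1} w`, or its analogue at infinity, reduce to correlators of
lower total weight. -/
structure Reducible (M₀ : DiscreteModule 𝒱 W₀) (M₁ : DiscreteModule 𝒱 W₁)
    (M₂ : DiscreteModule 𝒱 W₂) (M₃ : DiscreteModule 𝒱 W₃) (O : Subalgebra ℂ R) (s : Fin 4 → Rˣ)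
    (Φ : W₀ →ₗ[ℂ] W₁ →ₗ[ℂ] W₂ →ₗ[ℂ] W₃ →ₗ[ℂ] Q) : Prop where
  zero : ∀ (r : Fin 4 → ℝ) (h p : ℤ), 0 < h → p ≤ h → ∀ v ∈ 𝒱.weightSpace p,
    ∀ w₀ ∈ M₀.weightSpace (r 0), ∀ w₁ ∈ M₁.weightSpace (r 1), ∀ w₂ ∈ M₂.weightSpace (r 2),
    ∀ w₃ ∈ M₃.weightSpace (r 3),
    (s 0 ^ h * scaling s r) • Φ (M₀.oppositeMode v (p + h - 1) w₀) w₁ w₂ w₃ ∈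
      boundedSpan M₀ M₁ M₂ M₃ O s Φ (r 0 + r 1 + r 2 + r 3 + ((h - 1 : ℤ) : ℝ))
  one : ∀ (r : Fin 4 → ℝ) (h : ℤ), 0 < h → ∀ v ∈ 𝒱.weightSpace h,
    ∀ w₀ ∈ M₀.weightSpace (r 0), ∀ w₁ ∈ M₁.weightSpace (r 1), ∀ w₂ ∈ M₂.weightSpace (r 2),
    ∀ w₃ ∈ M₃.weightSpace (r 3),
    (s 1 ^ h * scaling s r) • Φ w₀ (M₁.Y v (-1) w₁) w₂ w₃ ∈
      boundedSpan M₀ M₁ M₂ M₃ O s Φ (r 0 + r 1 + r 2 + r 3 + ((h - 1 : ℤ) : ℝ))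
  two : ∀ (r : Fin 4 → ℝ) (h : ℤ), 0 < h → ∀ v ∈ 𝒱.weightSpace h,
    ∀ w₀ ∈ M₀.weightSpace (r 0), ∀ w₁ ∈ M₁.weightSpace (r 1), ∀ w₂ ∈ M₂.weightSpace (r 2),
    ∀ w₃ ∈ M₃.weightSpace (r 3),
    (s 2 ^ h * scaling s r) • Φ w₀ w₁ (M₂.Y v (-1) w₂) w₃ ∈
      boundedSpan M₀ M₁ M₂ M₃ O s Φ (r 0 + r 1 + r 2 + r 3 + ((h - 1 : ℤ) : ℝ))
  three : ∀ (r : Fin 4 → ℝ) (h : ℤ), 0 < h → ∀ v ∈ 𝒱.weightSpace h,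
    ∀ w₀ ∈ M₀.weightSpace (r 0), ∀ w₁ ∈ M₁.weightSpace (r 1), ∀ w₂ ∈ M₂.weightSpace (r 2),
    ∀ w₃ ∈ M₃.weightSpace (r 3),
    (s 3 ^ h * scaling s r) • Φ w₀ w₁ w₂ (M₃.Y v (-1) w₃) ∈
      boundedSpan M₀ M₁ M₂ M₃ O s Φ (r 0 + r 1 + r 2 + r 3 + ((h - 1 : ℤ) : ℝ))

omit [Algebra ℂ R] in
theorem scaling_update_sub (r : Fin 4 → ℝ) (i : Fin 4) (h : ℤ) :
    s i ^ h * scaling s (Function.update r i (r i - (h : ℝ))) = scaling s r := by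
  fin_cases i <;>
  · simp only [scaling, Function.update_apply, Fin.reduceEq, Fin.reduceFinMk, if_true, if_false,
      Int.floor_sub_intCast, Fin.zero_eta, Fin.mk_one, Fin.isValue, zero_ne_one, one_ne_zero]
    apply Additive.ofMul.injective
    simp only [ofMul_mul, ofMul_zpow]
    module

/-- When the total weight exceeds the sum of the thresholds `Kᵢ`, some vector exceeds its own
threshold and is a sum of vectors `v₋₁ x`. Reducibility then lowers the bound on the total weight by
one. -/
theorem Reducible.exists_bound (hΦ : Reducible M₀ M₁ M₂ M₃ O s Φ) (h₀ : M₀.C₁Cofinite)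
    (h₁ : M₁.C₁Cofinite) (h₂ : M₂.C₁Cofinite) (h₃ : M₃.C₁Cofinite) :
    ∃ N₀ : ℝ, ∀ N, boundedSpan M₀ M₁ M₂ M₃ O s Φ N ≤ boundedSpan M₀ M₁ M₂ M₃ O s Φ N₀ := by
  obtain ⟨K₀, hK₀⟩ := h₀.exists_bound
  obtain ⟨K₁, hK₁⟩ := h₁.exists_bound
  obtain ⟨K₂, hK₂⟩ := h₂.exists_bound
  obtain ⟨K₃, hK₃⟩ := h₃.exists_bound
  set N₀ := K₀ + K₁ + K₂ + K₃ with hN₀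
  refine ⟨N₀, ?_⟩
  suffices hn : ∀ n : ℕ, boundedSpan M₀ M₁ M₂ M₃ O s Φ (N₀ + n) ≤
      boundedSpan M₀ M₁ M₂ M₃ O s Φ N₀ by
    intro N
    obtain ⟨n, hn'⟩ := exists_nat_ge (N - N₀)
    exact (boundedSpan_mono (by linarith)).trans (hn n)
  intro n
  induction n with
  | zero => simp
  | succ n ih =>
    refine Submodule.span_le.mpr ?_
    rintro _ ⟨r, hr, w₀, hw₀, w₁, hw₁, w₂, hw₂, w₃, hw₃, rfl⟩
    push_cast at hr
    rw [SetLike.mem_coe, ← mem_scaledPreimage]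
    have hle : boundedSpan M₀ M₁ M₂ M₃ O s Φ (r 0 + r 1 + r 2 + r 3 - 1) ≤
        boundedSpan M₀ M₁ M₂ M₃ O s Φ N₀ := (boundedSpan_mono (by linarith)).trans ih
    by_cases c : r 0 + r 1 + r 2 + r 3 ≤ N₀
    · exact Submodule.subset_span ⟨r, c, w₀, hw₀, w₁, hw₁, w₂, hw₂, w₃, hw₃, rfl⟩
    by_cases c0 : K₀ < r 0
    · refine mem_of_span_zero ?_ (hK₀ _ c0 hw₀)
      rintro _ ⟨h, hpos, v, hv, x, hx, rfl⟩
      refine mem_of_span_zero ?_ (M₀.mode_mem_span_oppositeMode hv (-1) x)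
      rintro _ ⟨p, hp, u, hu, rfl⟩
      have e : p + h - (-1) - 2 = p + h - 1 := by ring
      rw [mem_scaledPreimage, ← scaling_update_sub r 0 h, e]
      have := hΦ.zero (Function.update r 0 (r 0 - h)) h p hpos hp u hu x (by simpa using hx)
        w₁ (by simpa using hw₁) w₂ (by simpa using hw₂) w₃ (by simpa using hw₃)
      refine hle (boundedSpan_mono ?_ this)
      simp
      linarith
    by_cases c1 : K₁ < r 1
    · refine mem_of_span_one ?_ (hK₁ _ c1 hw₁)
      rintro _ ⟨h, hpos, v, hv, x, hx, rfl⟩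
      rw [mem_scaledPreimage, ← scaling_update_sub r 1 h]
      have := hΦ.one (Function.update r 1 (r 1 - h)) h hpos v hv w₀ (by simpa using hw₀)
        x (by simpa using hx) w₂ (by simpa using hw₂) w₃ (by simpa using hw₃)
      refine hle (boundedSpan_mono ?_ this)
      simp
      linarith
    by_cases c2 : K₂ < r 2
    · refine mem_of_span_two ?_ (hK₂ _ c2 hw₂)
      rintro _ ⟨h, hpos, v, hv, x, hx, rfl⟩
      rw [mem_scaledPreimage, ← scaling_update_sub r 2 h]
      have := hΦ.two (Function.update r 2 (r 2 - h)) h hpos v hv w₀ (by simpa using hw₀)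
        w₁ (by simpa using hw₁) x (by simpa using hx) w₃ (by simpa using hw₃)
      refine hle (boundedSpan_mono ?_ this)
      simp
      linarith
    by_cases c3 : K₃ < r 3
    · refine mem_of_span_three ?_ (hK₃ _ c3 hw₃)
      rintro _ ⟨h, hpos, v, hv, x, hx, rfl⟩
      rw [mem_scaledPreimage, ← scaling_update_sub r 3 h]
      have := hΦ.three (Function.update r 3 (r 3 - h)) h hpos v hv w₀ (by simpa using hw₀)
        w₁ (by simpa using hw₁) w₂ (by simpa using hw₂) x (by simpa using hx)
      refine hle (boundedSpan_mono ?_ this)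
      simp
      linarith
    exact absurd (by linarith) c

end Reduction

end VOA
end

noncomputable section

namespace VOA

/-! ### Reducibility of correlators -/

section Reducibility

variable {V : Type*} [AddCommGroup V] [Module ℂ V] {𝒱 : VertexOperatorAlgebra V}
  {W₀ : Type*} [AddCommGroup W₀] [Module ℂ W₀] {M₀ : DiscreteModule 𝒱 W₀}
  {W₁ : Type*} [AddCommGroup W₁] [Module ℂ W₁] {M₁ : DiscreteModule 𝒱 W₁}
  {W₂ : Type*} [AddCommGroup W₂] [Module ℂ W₂] {M₂ : DiscreteModule 𝒱 W₂}
  {W₃ : Type*} [AddCommGroup W₃] [Module ℂ W₃] {M₃ : DiscreteModule 𝒱 W₃}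
  {R : Type*} [CommRing R] [Algebra ℂ R] {O : Subalgebra ℂ R}
  {Q : Type*} [AddCommGroup Q] [Module ℂ Q] [Module R Q] [IsScalarTower ℂ R Q]
  {s : Fin 4 → Rˣ} {Φ : W₀ →ₗ[ℂ] W₁ →ₗ[ℂ] W₂ →ₗ[ℂ] W₃ →ₗ[ℂ] Q} {ζ₁ ζ₂ ζ₁₂ : Rˣ}

theorem DiscreteModule.mem_add_zero {W : Type*} [AddCommGroup W] [Module ℂ W]
    {M : DiscreteModule 𝒱 W} {w : W} {r : ℝ} (hw : w ∈ M.weightSpace r) :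
    w ∈ M.weightSpace (r + ((0 : ℤ) : ℝ)) := by
  simpa using hw

omit [Algebra ℂ R] [Module ℂ Q] [IsScalarTower ℂ R Q] in
theorem smul_zpow_smul (τ σ a : Rˣ) (x : Q) : (τ * σ) • a • x = (τ * a * σ) • x := by
  rw [smul_smul, mul_right_comm]

open DiscreteModule in
-- For every term of `first`, the coefficient divided by the change of scaling is a product of
-- nonnegative powers of the units assumed regular, with exponents `h` and `k` or `k + 1`.
theorem CorrelatorRelations.reducible_one (hΦ : CorrelatorRelations M₀ M₁ M₂ M₃ ζ₁ ζ₂ ζ₁₂ Φ)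
    (c₀₁ : s 0 * s 1 ∈ unitsIn O) (c₀ : ζ₁ * s 0 ∈ unitsIn O) (c₁₂ : s 1 * (s 2)⁻¹ ∈ unitsIn O)
    (c₂ : s 2 * ζ₁₂⁻¹ ∈ unitsIn O) (c₁₃ : s 1 * (s 3)⁻¹ ∈ unitsIn O)
    (c₃ : s 3 * ζ₁⁻¹ ∈ unitsIn O)
    (r : Fin 4 → ℝ) (h : ℤ) (hpos : 0 < h) (v : V) (hv : v ∈ 𝒱.weightSpace h)
    (w₀ : W₀) (hw₀ : w₀ ∈ M₀.weightSpace (r 0)) (w₁ : W₁) (hw₁ : w₁ ∈ M₁.weightSpace (r 1))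
    (w₂ : W₂) (hw₂ : w₂ ∈ M₂.weightSpace (r 2)) (w₃ : W₃) (hw₃ : w₃ ∈ M₃.weightSpace (r 3)) :
    (s 1 ^ h * scaling s r) • Φ w₀ (M₁.Y v (-1) w₁) w₂ w₃ ∈
      boundedSpan M₀ M₁ M₂ M₃ O s Φ (r 0 + r 1 + r 2 + r 3 + ((h - 1 : ℤ) : ℝ)) := by
  obtain ⟨K₀, hK₀⟩ := M₀.exists_oppositeMode_truncation hv w₀
  obtain ⟨K₂, hK₂⟩ := M₂.exists_truncation v w₂
  obtain ⟨K₃, hK₃⟩ := M₃.exists_truncation v w₃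
  rw [hΦ.first v w₀ w₁ w₂ w₃ (K₀ + K₂ + K₃) (fun k hk => hK₀ k (by omega))
    (fun k hk => hK₂ k (by omega)) (fun k hk => hK₃ k (by omega)), Finset.smul_sum]
  refine sum_mem fun k _ => ?_
  rw [smul_add, smul_add, smul_zpow_smul, smul_zpow_smul, smul_zpow_smul]
  refine add_mem (add_mem ?_ ?_) ?_
  · refine scaled_mem_boundedSpan ![-1 - k + 1 - h, 0, 0, 0] (M₀.oppositeMode_mem hv hw₀ _)
      (mem_add_zero hw₁) (mem_add_zero hw₂) (mem_add_zero hw₃) ?_ ?_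
    · simp
      omega
    · have e : s 1 ^ h * ζ₁ ^ (k : ℤ) *
          (s 0 ^ (-1 - k + 1 - h : ℤ) * s 1 ^ (0 : ℤ) * s 2 ^ (0 : ℤ) * s 3 ^ (0 : ℤ))⁻¹ =
          (s 0 * s 1) ^ h * (ζ₁ * s 0) ^ (k : ℤ) := by
        apply Additive.ofMul.injective
        simp only [ofMul_mul, ofMul_zpow, ofMul_inv]
        module
      exact e ▸ mul_mem (zpow_mem_of_nonneg _ c₀₁ hpos.le) (zpow_mem_of_nonneg _ c₀ (by omega))
  · refine scaled_mem_boundedSpan ![0, 0, h - k - 1, 0] (mem_add_zero hw₀)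
      (mem_add_zero hw₁) (M₂.mode_mem hv hw₂ k) (mem_add_zero hw₃) ?_ ?_
    · simp
    · have e : s 1 ^ h * ζ₁₂ ^ (-1 - k : ℤ) *
          (s 0 ^ (0 : ℤ) * s 1 ^ (0 : ℤ) * s 2 ^ (h - k - 1 : ℤ) * s 3 ^ (0 : ℤ))⁻¹ =
          (s 1 * (s 2)⁻¹) ^ h * (s 2 * ζ₁₂⁻¹) ^ (1 + k : ℤ) := by
        apply Additive.ofMul.injective
        simp only [ofMul_mul, ofMul_zpow, ofMul_inv]
        module
      exact e ▸ mul_mem (zpow_mem_of_nonneg _ c₁₂ hpos.le) (zpow_mem_of_nonneg _ c₂ (by omega))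
  · refine scaled_mem_boundedSpan ![0, 0, 0, h - k - 1] (mem_add_zero hw₀)
      (mem_add_zero hw₁) (mem_add_zero hw₂) (M₃.mode_mem hv hw₃ k) ?_ ?_
    · simp
    · have e : s 1 ^ h * ζ₁ ^ (-1 - k : ℤ) *
          (s 0 ^ (0 : ℤ) * s 1 ^ (0 : ℤ) * s 2 ^ (0 : ℤ) * s 3 ^ (h - k - 1 : ℤ))⁻¹ =
          (s 1 * (s 3)⁻¹) ^ h * (s 3 * ζ₁⁻¹) ^ (1 + k : ℤ) := by
        apply Additive.ofMul.injective
        simp only [ofMul_mul, ofMul_zpow, ofMul_inv]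
        module
      exact e ▸ mul_mem (zpow_mem_of_nonneg _ c₁₃ hpos.le) (zpow_mem_of_nonneg _ c₃ (by omega))

open DiscreteModule in
-- The relation `outer` for `n = -1`, solved for the term at `w₃`.
theorem CorrelatorRelations.reducible_three (hΦ : CorrelatorRelations M₀ M₁ M₂ M₃ ζ₁ ζ₂ ζ₁₂ Φ)
    (c₀₃ : s 0 * s 3 ∈ unitsIn O) (c₁₃ : s 3 * (s 1)⁻¹ ∈ unitsIn O) (c₁ : s 1 * ζ₁⁻¹ ∈ unitsIn O)
    (c₂₃ : s 3 * (s 2)⁻¹ ∈ unitsIn O) (c₂ : s 2 * ζ₂⁻¹ ∈ unitsIn O)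
    (r : Fin 4 → ℝ) (h : ℤ) (hpos : 0 < h) (v : V) (hv : v ∈ 𝒱.weightSpace h)
    (w₀ : W₀) (hw₀ : w₀ ∈ M₀.weightSpace (r 0)) (w₁ : W₁) (hw₁ : w₁ ∈ M₁.weightSpace (r 1))
    (w₂ : W₂) (hw₂ : w₂ ∈ M₂.weightSpace (r 2)) (w₃ : W₃) (hw₃ : w₃ ∈ M₃.weightSpace (r 3)) :
    (s 3 ^ h * scaling s r) • Φ w₀ w₁ w₂ (M₃.Y v (-1) w₃) ∈
      boundedSpan M₀ M₁ M₂ M₃ O s Φ (r 0 + r 1 + r 2 + r 3 + ((h - 1 : ℤ) : ℝ)) := by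
  obtain ⟨K₁, hK₁⟩ := M₁.exists_truncation v w₁
  obtain ⟨K₂, hK₂⟩ := M₂.exists_truncation v w₂
  have hrel := hΦ.outer v (-1) w₀ w₁ w₂ w₃ (K₁ + K₂) (fun k hk => hK₁ k (by omega))
    (fun k hk => hK₂ k (by omega))
  rw [← sub_eq_iff_eq_add] at hrel
  rw [← hrel, smul_sub, Finset.smul_sum]
  refine sub_mem ?_ (sum_mem fun k _ => ?_)
  · refine scaled_mem_boundedSpan ![-1 + 1 - h, 0, 0, 0] (M₀.oppositeMode_mem hv hw₀ _)
      (mem_add_zero hw₁) (mem_add_zero hw₂) (mem_add_zero hw₃) ?_ ?_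
    · simp
      omega
    · have e : s 3 ^ h *
          (s 0 ^ (-1 + 1 - h : ℤ) * s 1 ^ (0 : ℤ) * s 2 ^ (0 : ℤ) * s 3 ^ (0 : ℤ))⁻¹ =
          (s 0 * s 3) ^ h := by
        apply Additive.ofMul.injective
        simp only [ofMul_mul, ofMul_zpow, ofMul_inv]
        module
      exact e ▸ zpow_mem_of_nonneg _ c₀₃ hpos.le
  · rw [Units.smul_def, smul_comm, ← Units.smul_def]
    refine complex_smul_mem _ ?_
    rw [smul_add, smul_zpow_smul, smul_zpow_smul]
    refine add_mem ?_ ?_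
    · refine scaled_mem_boundedSpan ![0, h - k - 1, 0, 0] (mem_add_zero hw₀)
        (M₁.mode_mem hv hw₁ k) (mem_add_zero hw₂) (mem_add_zero hw₃) ?_ ?_
      · simp
      · have e : s 3 ^ h * ζ₁ ^ (-1 - k : ℤ) *
            (s 0 ^ (0 : ℤ) * s 1 ^ (h - k - 1 : ℤ) * s 2 ^ (0 : ℤ) * s 3 ^ (0 : ℤ))⁻¹ =
            (s 3 * (s 1)⁻¹) ^ h * (s 1 * ζ₁⁻¹) ^ (1 + k : ℤ) := by
          apply Additive.ofMul.injective
          simp only [ofMul_mul, ofMul_zpow, ofMul_inv]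
          module
        exact e ▸ mul_mem (zpow_mem_of_nonneg _ c₁₃ hpos.le) (zpow_mem_of_nonneg _ c₁ (by omega))
    · refine scaled_mem_boundedSpan ![0, 0, h - k - 1, 0] (mem_add_zero hw₀)
        (mem_add_zero hw₁) (M₂.mode_mem hv hw₂ k) (mem_add_zero hw₃) ?_ ?_
      · simp
      · have e : s 3 ^ h * ζ₂ ^ (-1 - k : ℤ) *
            (s 0 ^ (0 : ℤ) * s 1 ^ (0 : ℤ) * s 2 ^ (h - k - 1 : ℤ) * s 3 ^ (0 : ℤ))⁻¹ =
            (s 3 * (s 2)⁻¹) ^ h * (s 2 * ζ₂⁻¹) ^ (1 + k : ℤ) := by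
          apply Additive.ofMul.injective
          simp only [ofMul_mul, ofMul_zpow, ofMul_inv]
          module
        exact e ▸ mul_mem (zpow_mem_of_nonneg _ c₂₃ hpos.le) (zpow_mem_of_nonneg _ c₂ (by omega))

omit [Algebra ℂ R] in
-- Serves `reducible_zero`, where the weight shift `e` of `w₁` or `w₂` can have either sign. For `e
-- > 0` the inequality `e ≤ h` provides enough factors `s₀` to pair with `s₁⁻¹`.
theorem zpow_mul_zpow_mem_unitsIn {S : Submonoid Rˣ} {ζ s₀ s₁ : Rˣ} (c : ζ * s₀ ∈ S)
    (c' : s₁ * ζ⁻¹ ∈ S) (c'' : ζ ^ 2 * s₀ * s₁⁻¹ ∈ S) {h e : ℤ} (hpos : 0 ≤ h) (he : e ≤ h) :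
    s₀ ^ h * ζ ^ (h + e) * s₁ ^ (-e) ∈ S := by
  rcases le_or_gt e 0 with h0 | h0
  · have e1 : s₀ ^ h * ζ ^ (h + e) * s₁ ^ (-e) = (ζ * s₀) ^ h * (s₁ * ζ⁻¹) ^ (-e) := by
      apply Additive.ofMul.injective
      simp only [ofMul_mul, ofMul_zpow, ofMul_inv]
      module
    exact e1 ▸ mul_mem (zpow_mem_of_nonneg _ c hpos) (zpow_mem_of_nonneg _ c' (by omega))
  · have e1 : s₀ ^ h * ζ ^ (h + e) * s₁ ^ (-e) =
        (ζ * s₀) ^ (h - e) * (ζ ^ 2 * s₀ * s₁⁻¹) ^ e := by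
      apply Additive.ofMul.injective
      simp only [ofMul_mul, ofMul_zpow, ofMul_inv, ofMul_pow]
      module
    exact e1 ▸ mul_mem (zpow_mem_of_nonneg _ c (by omega)) (zpow_mem_of_nonneg _ c'' h0.le)

open DiscreteModule in
-- The index `p + h - 1` makes the opposite mode raise the weight of `w₀` by exactly `h`, whatever
-- `p` is. After `outer` the mode lowers the weight of `w₃` by `h`, or shifts that of `w₁` or `w₂`
-- by `p - k - 1 ≤ h - 1`.
theorem CorrelatorRelations.reducible_zero (hΦ : CorrelatorRelations M₀ M₁ M₂ M₃ ζ₁ ζ₂ ζ₁₂ Φ)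
    (c₀₃ : s 0 * s 3 ∈ unitsIn O)
    (c₁ : ζ₁ * s 0 ∈ unitsIn O) (c₁' : s 1 * ζ₁⁻¹ ∈ unitsIn O)
    (c₁'' : ζ₁ ^ 2 * s 0 * (s 1)⁻¹ ∈ unitsIn O)
    (c₂ : ζ₂ * s 0 ∈ unitsIn O) (c₂' : s 2 * ζ₂⁻¹ ∈ unitsIn O)
    (c₂'' : ζ₂ ^ 2 * s 0 * (s 2)⁻¹ ∈ unitsIn O)
    (r : Fin 4 → ℝ) (h p : ℤ) (hpos : 0 < h) (hp : p ≤ h) (v : V) (hv : v ∈ 𝒱.weightSpace p)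
    (w₀ : W₀) (hw₀ : w₀ ∈ M₀.weightSpace (r 0)) (w₁ : W₁) (hw₁ : w₁ ∈ M₁.weightSpace (r 1))
    (w₂ : W₂) (hw₂ : w₂ ∈ M₂.weightSpace (r 2)) (w₃ : W₃) (hw₃ : w₃ ∈ M₃.weightSpace (r 3)) :
    (s 0 ^ h * scaling s r) • Φ (M₀.oppositeMode v (p + h - 1) w₀) w₁ w₂ w₃ ∈
      boundedSpan M₀ M₁ M₂ M₃ O s Φ (r 0 + r 1 + r 2 + r 3 + ((h - 1 : ℤ) : ℝ)) := by
  obtain ⟨K₁, hK₁⟩ := M₁.exists_truncation v w₁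
  obtain ⟨K₂, hK₂⟩ := M₂.exists_truncation v w₂
  rw [hΦ.outer v (p + h - 1) w₀ w₁ w₂ w₃ (K₁ + K₂) (fun k hk => hK₁ k (by omega))
    (fun k hk => hK₂ k (by omega)), smul_add, Finset.smul_sum]
  refine add_mem ?_ (sum_mem fun k _ => ?_)
  · refine scaled_mem_boundedSpan ![0, 0, 0, p - (p + h - 1) - 1] (mem_add_zero hw₀)
      (mem_add_zero hw₁) (mem_add_zero hw₂) (M₃.mode_mem hv hw₃ _) ?_ ?_
    · simp
      omega
    · have e : s 0 ^ h *
          (s 0 ^ (0 : ℤ) * s 1 ^ (0 : ℤ) * s 2 ^ (0 : ℤ) * s 3 ^ (p - (p + h - 1) - 1 : ℤ))⁻¹ =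
          (s 0 * s 3) ^ h := by
        apply Additive.ofMul.injective
        simp only [ofMul_mul, ofMul_zpow, ofMul_inv]
        module
      exact e ▸ zpow_mem_of_nonneg _ c₀₃ hpos.le
  · rw [Units.smul_def, smul_comm, ← Units.smul_def]
    refine complex_smul_mem _ ?_
    rw [smul_add, smul_zpow_smul, smul_zpow_smul]
    refine add_mem ?_ ?_
    · refine scaled_mem_boundedSpan ![0, p - k - 1, 0, 0] (mem_add_zero hw₀)
        (M₁.mode_mem hv hw₁ k) (mem_add_zero hw₂) (mem_add_zero hw₃) ?_ ?_
      · simp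
        omega
      · have e : s 0 ^ h * ζ₁ ^ (p + h - 1 - k : ℤ) *
            (s 0 ^ (0 : ℤ) * s 1 ^ (p - k - 1 : ℤ) * s 2 ^ (0 : ℤ) * s 3 ^ (0 : ℤ))⁻¹ =
            s 0 ^ h * ζ₁ ^ (h + (p - k - 1) : ℤ) * s 1 ^ (-(p - k - 1) : ℤ) := by
          apply Additive.ofMul.injective
          simp only [ofMul_mul, ofMul_zpow, ofMul_inv]
          module
        exact e ▸ zpow_mul_zpow_mem_unitsIn c₁ c₁' c₁'' hpos.le (by omega)
    · refine scaled_mem_boundedSpan ![0, 0, p - k - 1, 0] (mem_add_zero hw₀)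
        (mem_add_zero hw₁) (M₂.mode_mem hv hw₂ k) (mem_add_zero hw₃) ?_ ?_
      · simp
        omega
      · have e : s 0 ^ h * ζ₂ ^ (p + h - 1 - k : ℤ) *
            (s 0 ^ (0 : ℤ) * s 1 ^ (0 : ℤ) * s 2 ^ (p - k - 1 : ℤ) * s 3 ^ (0 : ℤ))⁻¹ =
            s 0 ^ h * ζ₂ ^ (h + (p - k - 1) : ℤ) * s 2 ^ (-(p - k - 1) : ℤ) := by
          apply Additive.ofMul.injective
          simp only [ofMul_mul, ofMul_zpow, ofMul_inv]
          module
        exact e ▸ zpow_mul_zpow_mem_unitsIn c₂ c₂' c₂'' hpos.le (by omega)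

end Reducibility

end VOA
end

/-! ### Reducibility at `z₁ = ∞` -/

noncomputable section

namespace VOA

section Infinity

variable {V : Type*} [AddCommGroup V] [Module ℂ V] {𝒱 : VertexOperatorAlgebra V}
  {W₀ : Type*} [AddCommGroup W₀] [Module ℂ W₀] {M₀ : DiscreteModule 𝒱 W₀}
  {W₁ : Type*} [AddCommGroup W₁] [Module ℂ W₁] {M₁ : DiscreteModule 𝒱 W₁}
  {W₂ : Type*} [AddCommGroup W₂] [Module ℂ W₂] {M₂ : DiscreteModule 𝒱 W₂}
  {W₃ : Type*} [AddCommGroup W₃] [Module ℂ W₃] {M₃ : DiscreteModule 𝒱 W₃}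
  {R : Type*} [CommRing R] [Algebra ℂ R] {O : Subalgebra ℂ R}
  {Q : Type*} [AddCommGroup Q] [Module ℂ Q] [Module R Q] [IsScalarTower ℂ R Q]
  {s : Fin 4 → Rˣ} {Φ : W₀ →ₗ[ℂ] W₁ →ₗ[ℂ] W₂ →ₗ[ℂ] W₃ →ₗ[ℂ] Q} {ζ₁ ζ₂ ζ₁₂ : Rˣ}

/-- The remainder of the expansion of `(z₁ - z₂)^{-1-j}` in powers of `z₁⁻¹` after `n` terms. -/
def expansionRemainder (ζ₁ ζ₂ ζ₁₂ : Rˣ) (n j : ℕ) : R :=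
  ↑(ζ₁₂ ^ (-1 - j : ℤ)) -
    ∑ i ∈ Finset.range n, (i.choose j : R) * ↑(ζ₁ ^ (-1 - i : ℤ) * ζ₂ ^ (i - j : ℤ))

omit [Algebra ℂ R] in
theorem expansionRemainder_succ (n j : ℕ) :
    expansionRemainder ζ₁ ζ₂ ζ₁₂ (n + 1) j = expansionRemainder ζ₁ ζ₂ ζ₁₂ n j -
      (n.choose j : R) * ↑(ζ₁ ^ (-1 - n : ℤ) * ζ₂ ^ (n - j : ℤ)) := by
  simp only [expansionRemainder, Finset.sum_range_succ]
  ring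

omit [Algebra ℂ R] in
-- The remainder of a geometric series.
theorem expansionRemainder_right_zero (h : (ζ₁₂ : R) = ζ₁ - ζ₂) (n : ℕ) :
    expansionRemainder ζ₁ ζ₂ ζ₁₂ n 0 = ↑(ζ₁ ^ (-n : ℤ) * ζ₂ ^ (n : ℤ) * ζ₁₂⁻¹) := by
  induction n with
  | zero => simp [expansionRemainder]
  | succ n ih =>
    rw [expansionRemainder_succ, ih]
    have e1 : ζ₁ ^ (-n : ℤ) * ζ₂ ^ (n : ℤ) * ζ₁₂⁻¹ =
        ζ₁ * (ζ₁ ^ (-1 - n : ℤ) * ζ₂ ^ (n : ℤ) * ζ₁₂⁻¹) := by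
      apply Additive.ofMul.injective
      simp only [ofMul_mul, ofMul_zpow, ofMul_inv]
      module
    have e2 : ζ₁ ^ (-1 - n : ℤ) * ζ₂ ^ (n - (0 : ℕ) : ℤ) =
        ζ₁₂ * (ζ₁ ^ (-1 - n : ℤ) * ζ₂ ^ (n : ℤ) * ζ₁₂⁻¹) := by
      apply Additive.ofMul.injective
      simp only [ofMul_mul, ofMul_zpow, ofMul_inv]
      module
    have e3 : ζ₁ ^ (-(n + 1 : ℕ) : ℤ) * ζ₂ ^ ((n + 1 : ℕ) : ℤ) * ζ₁₂⁻¹ =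
        ζ₂ * (ζ₁ ^ (-1 - n : ℤ) * ζ₂ ^ (n : ℤ) * ζ₁₂⁻¹) := by
      apply Additive.ofMul.injective
      push_cast
      simp only [ofMul_mul, ofMul_zpow, ofMul_inv]
      module
    rw [e1, e2, e3, Units.val_mul, Units.val_mul ζ₁₂, Units.val_mul ζ₂, h]
    simp only [Nat.choose_zero_right, Nat.cast_one]
    ring

omit [Algebra ℂ R] in
-- Multiplication by `z₁ - z₂` lowers the exponent `j + 1` to `j`, with Pascal's rule on the
-- coefficients; the truncation leaves one boundary term. This reduces all `j` to the geometric
-- series.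
theorem mul_expansionRemainder_succ (h : (ζ₁₂ : R) = ζ₁ - ζ₂) (n j : ℕ) :
    (ζ₁₂ : R) * expansionRemainder ζ₁ ζ₂ ζ₁₂ (n + 1) (j + 1) = expansionRemainder ζ₁ ζ₂ ζ₁₂ n j +
      (n.choose (j + 1) : R) * ↑(ζ₁ ^ (-1 - n : ℤ) * ζ₂ ^ (n - j : ℤ)) := by
  induction n with
  | zero =>
    have e : (ζ₁₂ : R) * ↑(ζ₁₂ ^ (-1 - (j + 1 : ℕ) : ℤ)) = ↑(ζ₁₂ ^ (-1 - j : ℤ)) := by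
      rw [← Units.val_mul, ← zpow_one_add]
      congr 2
      push_cast
      ring
    simp [expansionRemainder, ← e]
  | succ n ih =>
    rw [expansionRemainder_succ, mul_sub, ih, expansionRemainder_succ n j]
    have e1 : ζ₁ ^ (-1 - n : ℤ) * ζ₂ ^ (n - j : ℤ) =
        ζ₁ * (ζ₁ ^ (-2 - n : ℤ) * ζ₂ ^ (n - j : ℤ)) := by
      apply Additive.ofMul.injective
      simp only [ofMul_mul, ofMul_zpow]
      module
    have e2 : ζ₁ ^ (-1 - (n + 1 : ℕ) : ℤ) * ζ₂ ^ ((n + 1 : ℕ) - (j + 1 : ℕ) : ℤ) =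
        ζ₁ ^ (-2 - n : ℤ) * ζ₂ ^ (n - j : ℤ) := by
      apply Additive.ofMul.injective
      push_cast
      simp only [ofMul_mul, ofMul_zpow]
      module
    have e3 : ζ₁ ^ (-1 - (n + 1 : ℕ) : ℤ) * ζ₂ ^ ((n + 1 : ℕ) - j : ℤ) =
        ζ₂ * (ζ₁ ^ (-2 - n : ℤ) * ζ₂ ^ (n - j : ℤ)) := by
      apply Additive.ofMul.injective
      push_cast
      simp only [ofMul_mul, ofMul_zpow]
      module
    rw [e1, e2, e3, Units.val_mul, Units.val_mul ζ₂, h, Nat.choose_succ_succ]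
    push_cast
    ring

/-- After `n` terms the remainder vanishes at `z₁ = ∞` to order at least `n + 1`. In the recursion
every factor `ζ₁₂⁻¹` is paired with a factor `ζ₁`. -/
theorem zpow_mul_expansionRemainder_mem (h : (ζ₁₂ : R) = ζ₁ - ζ₂) (c₁ : ζ₁⁻¹ ∈ unitsIn O)
    (c₂ : ζ₂ ∈ unitsIn O) (c₂' : ζ₂⁻¹ ∈ unitsIn O) (c₁₂ : ζ₁ * ζ₁₂⁻¹ ∈ unitsIn O) (n j : ℕ) :
    ↑(ζ₁ ^ (n + 1 : ℤ)) * expansionRemainder ζ₁ ζ₂ ζ₁₂ n j ∈ O := by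
  have hz (k : ℤ) : ζ₂ ^ k ∈ unitsIn O := by
    rcases le_total 0 k with hk | hk
    · exact zpow_mem_of_nonneg _ c₂ hk
    · have := zpow_mem_of_nonneg _ c₂' (n := -k) (by omega)
      simpa using this
  induction n generalizing j with
  | zero =>
    have e : ζ₁ ^ ((0 : ℕ) + 1 : ℤ) * ζ₁₂ ^ (-1 - j : ℤ) =
        (ζ₁ * ζ₁₂⁻¹) ^ (1 + j : ℤ) * ζ₁⁻¹ ^ (j : ℤ) := by
      apply Additive.ofMul.injective
      push_cast
      simp only [ofMul_mul, ofMul_zpow, ofMul_inv]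
      module
    have hm : ζ₁ ^ ((0 : ℕ) + 1 : ℤ) * ζ₁₂ ^ (-1 - j : ℤ) ∈ unitsIn O :=
      e ▸ mul_mem (zpow_mem_of_nonneg _ c₁₂ (by omega)) (zpow_mem_of_nonneg _ c₁ (by omega))
    simp only [expansionRemainder, Finset.range_zero, Finset.sum_empty, sub_zero]
    rw [← Units.val_mul]
    exact hm
  | succ n ih =>
    cases j with
    | zero =>
      have e : ζ₁ ^ ((n + 1 : ℕ) + 1 : ℤ) *
          (ζ₁ ^ (-(n + 1 : ℕ) : ℤ) * ζ₂ ^ ((n + 1 : ℕ) : ℤ) * ζ₁₂⁻¹) =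
          (ζ₁ * ζ₁₂⁻¹) * ζ₂ ^ ((n + 1 : ℕ) : ℤ) := by
        apply Additive.ofMul.injective
        push_cast
        simp only [ofMul_mul, ofMul_zpow, ofMul_inv]
        module
      rw [expansionRemainder_right_zero h, ← Units.val_mul, e]
      exact mul_mem (S := Submonoid Rˣ) (s := unitsIn O) c₁₂ (hz _)
    | succ j =>
      have e1 : ζ₁ ^ ((n + 1 : ℕ) + 1 : ℤ) = ζ₁ * ζ₁₂⁻¹ * ζ₁ ^ (n + 1 : ℤ) * ζ₁₂ := by
        apply Additive.ofMul.injective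
        push_cast
        simp only [ofMul_mul, ofMul_zpow, ofMul_inv]
        module
      have e2 : ζ₁ ^ (n + 1 : ℤ) * (ζ₁ ^ (-1 - n : ℤ) * ζ₂ ^ (n - j : ℤ)) = ζ₂ ^ (n - j : ℤ) := by
        apply Additive.ofMul.injective
        simp only [ofMul_mul, ofMul_zpow]
        module
      rw [e1, Units.val_mul, mul_assoc, mul_expansionRemainder_succ h, Units.val_mul, mul_assoc,
        mul_add, mul_left_comm, ← Units.val_mul (ζ₁ ^ (n + 1 : ℤ)), e2]
      exact mul_mem (show ((ζ₁ * ζ₁₂⁻¹ : Rˣ) : R) ∈ O from c₁₂)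
        (add_mem (ih j) (mul_mem (natCast_mem O _) (show ((ζ₂ ^ (n - j : ℤ) : Rˣ) : R) ∈ O from hz _)))

omit [Algebra ℂ R] [IsScalarTower ℂ R Q] in
-- The residue theorem for `(x/ζ₁)^H (x - ζ₁)⁻¹`. This kernel differs from `(x - ζ₁)⁻¹` by the sum
-- of `ζ₁^(-1-i) x^i` over `i < H`, that is, by `H` instances of `outer`. They cancel the modes
-- below `H` on `w₃` and the first `H` terms of the expansion of `ζ₁₂^(-1-j)`.
theorem CorrelatorRelations.first_infinity (hΦ : CorrelatorRelations M₀ M₁ M₂ M₃ ζ₁ ζ₂ ζ₁₂ Φ)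
    (v : V) (w₀ : W₀) (w₁ : W₁) (w₂ : W₂) (w₃ : W₃) (H K : ℕ)
    (hK₀ : ∀ k : ℕ, K ≤ k → M₀.oppositeMode v (-1 - k) w₀ = 0)
    (hK₁ : ∀ k : ℕ, K ≤ k → M₁.Y v k w₁ = 0)
    (hK₂ : ∀ k : ℕ, K ≤ k → M₂.Y v k w₂ = 0) (hK₃ : ∀ k : ℕ, K ≤ k → M₃.Y v k w₃ = 0) :
    Φ w₀ (M₁.Y v (-1) w₁) w₂ w₃ =
      ∑ k ∈ Finset.range (H + K), ζ₁ ^ (k : ℤ) • Φ (M₀.oppositeMode v (-1 - k) w₀) w₁ w₂ w₃ +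
      ∑ j ∈ Finset.range (H + K), expansionRemainder ζ₁ ζ₂ ζ₁₂ H j • Φ w₀ w₁ (M₂.Y v j w₂) w₃ +
      ∑ k ∈ Finset.range K, ζ₁ ^ (-1 - (H + k : ℕ) : ℤ) • Φ w₀ w₁ w₂ (M₃.Y v (H + k : ℕ) w₃) +
      ∑ i ∈ Finset.range H, (ζ₁ ^ (-1 - i : ℤ) • Φ (M₀.oppositeMode v i w₀) w₁ w₂ w₃ -
        ∑ j ∈ Finset.range (H + K),
          (i.choose j : R) • ζ₁ ^ (-1 - j : ℤ) • Φ w₀ (M₁.Y v j w₁) w₂ w₃) := by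
  have ho (i : ℕ) : ζ₁ ^ (-1 - i : ℤ) • Φ (M₀.oppositeMode v i w₀) w₁ w₂ w₃ -
      ∑ j ∈ Finset.range (H + K),
        (i.choose j : R) • ζ₁ ^ (-1 - j : ℤ) • Φ w₀ (M₁.Y v j w₁) w₂ w₃ =
      ζ₁ ^ (-1 - i : ℤ) • Φ w₀ w₁ w₂ (M₃.Y v i w₃) + ∑ j ∈ Finset.range (H + K),
        ((i.choose j : R) * ↑(ζ₁ ^ (-1 - i : ℤ) * ζ₂ ^ (i - j : ℤ))) •
          Φ w₀ w₁ (M₂.Y v j w₂) w₃ := by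
    rw [hΦ.outer v i w₀ w₁ w₂ w₃ (H + K) (fun k hk => hK₁ k (by omega))
      (fun k hk => hK₂ k (by omega)), smul_add, add_sub_assoc, Finset.smul_sum,
      ← Finset.sum_sub_distrib]
    refine congrArg _ (Finset.sum_congr rfl fun j _ => ?_)
    have e : ((Ring.choose (i : ℤ) j : ℤ) : ℂ) = (i.choose j : ℂ) := by
      rw [Ring.choose_natCast]
      norm_cast
    have e1 : ζ₁ ^ (-1 - j : ℤ) = ζ₁ ^ (-1 - i : ℤ) * ζ₁ ^ (i - j : ℤ) := by
      rw [← zpow_add]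
      congr 1
      ring
    rw [e, Nat.cast_smul_eq_nsmul, ← Nat.cast_smul_eq_nsmul R, smul_add, smul_add, e1, mul_smul,
      mul_smul, ← Units.smul_def, mul_smul, smul_comm (ζ₁ ^ (-1 - i : ℤ)) (i.choose j : R),
      smul_comm (ζ₁ ^ (-1 - i : ℤ)) (i.choose j : R)]
    abel
  rw [hΦ.first v w₀ w₁ w₂ w₃ (H + K) (fun k hk => hK₀ k (by omega))
    (fun k hk => hK₂ k (by omega)) (fun k hk => hK₃ k (by omega)), Finset.sum_congr rfl
    fun i _ => ho i, Finset.sum_add_distrib, Finset.sum_add_distrib, Finset.sum_add_distrib,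
    Finset.sum_range_add (fun k : ℕ => ζ₁ ^ (-1 - k : ℤ) • Φ w₀ w₁ w₂ (M₃.Y v k w₃)),
    Finset.sum_comm (s := Finset.range H)]
  have hE : ∑ j ∈ Finset.range (H + K), ζ₁₂ ^ (-1 - j : ℤ) • Φ w₀ w₁ (M₂.Y v j w₂) w₃ =
      ∑ j ∈ Finset.range (H + K), expansionRemainder ζ₁ ζ₂ ζ₁₂ H j • Φ w₀ w₁ (M₂.Y v j w₂) w₃ +
      ∑ j ∈ Finset.range (H + K), ∑ i ∈ Finset.range H,
        ((i.choose j : R) * ↑(ζ₁ ^ (-1 - i : ℤ) * ζ₂ ^ (i - j : ℤ))) •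
          Φ w₀ w₁ (M₂.Y v j w₂) w₃ := by
    rw [← Finset.sum_add_distrib]
    refine Finset.sum_congr rfl fun j _ => ?_
    rw [← Finset.sum_smul, ← add_smul, expansionRemainder, sub_add_cancel, Units.smul_def]
  rw [hE]
  abel

open DiscreteModule in
-- Since `w₂` and `w₃` are not scaled, `first` alone would give coefficients `ζ₁^h ζ₁₂^(-1-k)` and
-- `ζ₁^(h-1-k)`, with poles at infinity for `k < h - 1`. Taking `H = h - 1` in `first_infinity`
-- leaves only terms of order at least `h` there, which absorb the factor `ζ₁^h`.
theorem CorrelatorRelations.reducible_one_of_infinity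
    (hΦ : CorrelatorRelations M₀ M₁ M₂ M₃ ζ₁ ζ₂ ζ₁₂ Φ) (hζ : (ζ₁₂ : R) = ζ₁ - ζ₂)
    (c₁ : ζ₁⁻¹ ∈ unitsIn O) (c₂ : ζ₂ ∈ unitsIn O) (c₂' : ζ₂⁻¹ ∈ unitsIn O)
    (c₁₂ : ζ₁ * ζ₁₂⁻¹ ∈ unitsIn O) (hs₀ : s 0 = ζ₁⁻¹) (hs₁ : s 1 = ζ₁) (hs₂ : s 2 = 1)
    (hs₃ : s 3 = 1)
    (r : Fin 4 → ℝ) (h : ℤ) (hpos : 0 < h) (v : V) (hv : v ∈ 𝒱.weightSpace h)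
    (w₀ : W₀) (hw₀ : w₀ ∈ M₀.weightSpace (r 0)) (w₁ : W₁) (hw₁ : w₁ ∈ M₁.weightSpace (r 1))
    (w₂ : W₂) (hw₂ : w₂ ∈ M₂.weightSpace (r 2)) (w₃ : W₃) (hw₃ : w₃ ∈ M₃.weightSpace (r 3)) :
    (s 1 ^ h * scaling s r) • Φ w₀ (M₁.Y v (-1) w₁) w₂ w₃ ∈
      boundedSpan M₀ M₁ M₂ M₃ O s Φ (r 0 + r 1 + r 2 + r 3 + ((h - 1 : ℤ) : ℝ)) := by
  obtain ⟨K₀, hK₀⟩ := M₀.exists_oppositeMode_truncation hv w₀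
  obtain ⟨K₁, hK₁⟩ := M₁.exists_truncation v w₁
  obtain ⟨K₂, hK₂⟩ := M₂.exists_truncation v w₂
  obtain ⟨K₃, hK₃⟩ := M₃.exists_truncation v w₃
  obtain ⟨H, rfl⟩ : ∃ H : ℕ, h = H + 1 := ⟨(h - 1).toNat, by omega⟩
  rw [hΦ.first_infinity v w₀ w₁ w₂ w₃ H (K₀ + K₁ + K₂ + K₃) (fun k hk => hK₀ k (by omega))
    (fun k hk => hK₁ k (by omega)) (fun k hk => hK₂ k (by omega)) (fun k hk => hK₃ k (by omega)),
    smul_add, smul_add, smul_add]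
  simp only [Finset.smul_sum, smul_sub]
  refine add_mem (add_mem (add_mem (sum_mem fun k _ => ?_) (sum_mem fun k _ => ?_))
    (sum_mem fun k _ => ?_)) (sum_mem fun i hi => sub_mem ?_ (sum_mem fun j _ => ?_))
  · rw [smul_zpow_smul]
    refine scaled_mem_boundedSpan ![-1 - k + 1 - (H + 1), 0, 0, 0] (M₀.oppositeMode_mem hv hw₀ _)
      (mem_add_zero hw₁) (mem_add_zero hw₂) (mem_add_zero hw₃) ?_ ?_
    · simp
      omega
    · have e : s 1 ^ (H + 1 : ℤ) * ζ₁ ^ (k : ℤ) * (s 0 ^ (-1 - k + 1 - (H + 1) : ℤ) *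
          s 1 ^ (0 : ℤ) * s 2 ^ (0 : ℤ) * s 3 ^ (0 : ℤ))⁻¹ = 1 := by
        rw [hs₀, hs₁]
        apply Additive.ofMul.injective
        simp only [ofMul_mul, ofMul_zpow, ofMul_inv, ofMul_one]
        module
      exact e ▸ one_mem _
  · have hx : (1 * scaling s r) • Φ w₀ w₁ (M₂.Y v k w₂) w₃ ∈ boundedSpan M₀ M₁ M₂ M₃ O s Φ
        (r 0 + r 1 + r 2 + r 3 + (((H + 1 : ℤ) - 1 : ℤ) : ℝ)) := by
      refine scaled_mem_boundedSpan ![0, 0, (H + 1) - k - 1, 0] (mem_add_zero hw₀)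
        (mem_add_zero hw₁) (M₂.mode_mem hv hw₂ k) (mem_add_zero hw₃) ?_ ?_
      · simp
      · simp [hs₂]
    have e : (s 1 ^ (H + 1 : ℤ) * scaling s r) • expansionRemainder ζ₁ ζ₂ ζ₁₂ H k •
        Φ w₀ w₁ (M₂.Y v k w₂) w₃ = (↑(ζ₁ ^ (H + 1 : ℤ)) * expansionRemainder ζ₁ ζ₂ ζ₁₂ H k) •
          (1 * scaling s r) • Φ w₀ w₁ (M₂.Y v k w₂) w₃ := by
      rw [hs₁, one_mul, Units.smul_def, Units.smul_def, smul_smul, smul_smul, Units.val_mul]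
      congr 1
      ring
    rw [e]
    exact Submodule.smul_mem _
      (⟨_, zpow_mul_expansionRemainder_mem hζ c₁ c₂ c₂' c₁₂ H k⟩ : O) hx
  · rw [smul_zpow_smul]
    refine scaled_mem_boundedSpan ![0, 0, 0, (H + 1) - (H + k : ℕ) - 1] (mem_add_zero hw₀)
      (mem_add_zero hw₁) (mem_add_zero hw₂) (M₃.mode_mem hv hw₃ _) ?_ ?_
    · simp
    · have e : s 1 ^ (H + 1 : ℤ) * ζ₁ ^ (-1 - (H + k : ℕ) : ℤ) * (s 0 ^ (0 : ℤ) *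
          s 1 ^ (0 : ℤ) * s 2 ^ (0 : ℤ) * s 3 ^ ((H + 1) - (H + k : ℕ) - 1 : ℤ))⁻¹ =
          ζ₁⁻¹ ^ (k : ℤ) := by
        rw [hs₁, hs₃]
        apply Additive.ofMul.injective
        push_cast
        simp only [ofMul_mul, ofMul_zpow, ofMul_inv, ofMul_one]
        module
      exact e ▸ zpow_mem_of_nonneg _ c₁ (by omega)
  · rw [Finset.mem_range] at hi
    rw [smul_zpow_smul]
    refine scaled_mem_boundedSpan ![i + 1 - (H + 1), 0, 0, 0] (M₀.oppositeMode_mem hv hw₀ _)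
      (mem_add_zero hw₁) (mem_add_zero hw₂) (mem_add_zero hw₃) ?_ ?_
    · simp
      omega
    · have e : s 1 ^ (H + 1 : ℤ) * ζ₁ ^ (-1 - i : ℤ) * (s 0 ^ (i + 1 - (H + 1) : ℤ) *
          s 1 ^ (0 : ℤ) * s 2 ^ (0 : ℤ) * s 3 ^ (0 : ℤ))⁻¹ = 1 := by
        rw [hs₀, hs₁]
        apply Additive.ofMul.injective
        simp only [ofMul_mul, ofMul_zpow, ofMul_inv, ofMul_one]
        module
      exact e ▸ one_mem _
  · rw [Nat.cast_smul_eq_nsmul, smul_comm]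
    refine nsmul_mem ?_ _
    rw [smul_zpow_smul]
    refine scaled_mem_boundedSpan ![0, (H + 1) - j - 1, 0, 0] (mem_add_zero hw₀)
      (M₁.mode_mem hv hw₁ j) (mem_add_zero hw₂) (mem_add_zero hw₃) ?_ ?_
    · simp
    · have e : s 1 ^ (H + 1 : ℤ) * ζ₁ ^ (-1 - j : ℤ) * (s 0 ^ (0 : ℤ) *
          s 1 ^ ((H + 1) - j - 1 : ℤ) * s 2 ^ (0 : ℤ) * s 3 ^ (0 : ℤ))⁻¹ = 1 := by
        rw [hs₁]
        apply Additive.ofMul.injective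
        simp only [ofMul_mul, ofMul_zpow, ofMul_inv, ofMul_one]
        module
      exact e ▸ one_mem _

end Infinity

end VOA
end

/-! ### Exchange of `z₁` and `z₂`, and reducibility in all four positions -/

noncomputable section

namespace VOA

theorem mem_unitsIn {R : Type*} [CommRing R] [Algebra ℂ R] {O : Subalgebra ℂ R} {a : Rˣ} :
    a ∈ unitsIn O ↔ (a : R) ∈ O := Iff.rfl

theorem neg_mem_unitsIn {R : Type*} [CommRing R] [Algebra ℂ R] {O : Subalgebra ℂ R} {a : Rˣ}
    (ha : a ∈ unitsIn O) : -a ∈ unitsIn O := by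
  rw [mem_unitsIn, Units.val_neg]
  exact neg_mem (mem_unitsIn.mp ha)

section Swap

variable {V : Type*} [AddCommGroup V] [Module ℂ V] {𝒱 : VertexOperatorAlgebra V}
  {W₀ : Type*} [AddCommGroup W₀] [Module ℂ W₀] {M₀ : DiscreteModule 𝒱 W₀}
  {W₁ : Type*} [AddCommGroup W₁] [Module ℂ W₁] {M₁ : DiscreteModule 𝒱 W₁}
  {W₂ : Type*} [AddCommGroup W₂] [Module ℂ W₂] {M₂ : DiscreteModule 𝒱 W₂}
  {W₃ : Type*} [AddCommGroup W₃] [Module ℂ W₃] {M₃ : DiscreteModule 𝒱 W₃}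
  {R : Type*} [CommRing R] [Algebra ℂ R] {O : Subalgebra ℂ R}
  {Q : Type*} [AddCommGroup Q] [Module ℂ Q] [Module R Q] [IsScalarTower ℂ R Q]
  {s s' : Fin 4 → Rˣ} {Φ : W₀ →ₗ[ℂ] W₁ →ₗ[ℂ] W₂ →ₗ[ℂ] W₃ →ₗ[ℂ] Q} {ζ₁ ζ₂ ζ₁₂ : Rˣ}

omit [Algebra ℂ R] in
theorem scaling_swap (h₀ : s' 0 = s 0) (h₁ : s' 1 = s 2) (h₂ : s' 2 = s 1) (h₃ : s' 3 = s 3)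
    (r : Fin 4 → ℝ) : scaling s' ![r 0, r 2, r 1, r 3] = scaling s r := by
  simp only [scaling, h₀, h₁, h₂, h₃, Matrix.cons_val]
  rw [mul_right_comm (s 0 ^ ⌊r 0⌋)]

omit [IsScalarTower ℂ R Q] in
theorem boundedSpan_swap_le (h₀ : s' 0 = s 0) (h₁ : s' 1 = s 2) (h₂ : s' 2 = s 1)
    (h₃ : s' 3 = s 3) (N : ℝ) :
    boundedSpan M₀ M₂ M₁ M₃ O s' (LinearMap.lflip.toLinearMap ∘ₗ Φ) N ≤
      boundedSpan M₀ M₁ M₂ M₃ O s Φ N := by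
  refine Submodule.span_le.mpr ?_
  rintro _ ⟨r, hr, w₀, hw₀, w₂, hw₂, w₁, hw₁, w₃, hw₃, rfl⟩
  refine Submodule.subset_span ⟨![r 0, r 2, r 1, r 3], ?_, w₀, hw₀, w₁, hw₁, w₂, hw₂, w₃, hw₃, ?_⟩
  · simp only [Matrix.cons_val]
    linarith
  · rw [scaling_swap (s := s') (s' := s) h₀.symm h₂.symm h₁.symm h₃.symm]
    rfl

omit [IsScalarTower ℂ R Q] in
theorem mem_boundedSpan_of_swap (h₀ : s' 0 = s 0) (h₁ : s' 1 = s 2) (h₂ : s' 2 = s 1)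
    (h₃ : s' 3 = s 3) (r : Fin 4 → ℝ) (d : ℤ) {x : Q}
    (hx : x ∈ boundedSpan M₀ M₂ M₁ M₃ O s' (LinearMap.lflip.toLinearMap ∘ₗ Φ)
      (r 0 + r 2 + r 1 + r 3 + (d : ℝ))) :
    x ∈ boundedSpan M₀ M₁ M₂ M₃ O s Φ (r 0 + r 1 + r 2 + r 3 + (d : ℝ)) := by
  rw [add_right_comm (r 0)] at hx
  exact boundedSpan_swap_le h₀ h₁ h₂ h₃ _ hx

omit [IsScalarTower ℂ R Q] in
theorem Reducible.of_swap (h₀ : s' 0 = s 0) (h₁ : s' 1 = s 2) (h₂ : s' 2 = s 1) (h₃ : s' 3 = s 3)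
    (hΦ : Reducible M₀ M₂ M₁ M₃ O s' (LinearMap.lflip.toLinearMap ∘ₗ Φ)) :
    Reducible M₀ M₁ M₂ M₃ O s Φ := by
  have key := mem_boundedSpan_of_swap (M₀ := M₀) (M₁ := M₁) (M₂ := M₂) (M₃ := M₃) (O := O) (Φ := Φ)
    h₀ h₁ h₂ h₃
  refine ⟨fun r h p hpos hp v hv w₀ hw₀ w₁ hw₁ w₂ hw₂ w₃ hw₃ => ?_,
    fun r h hpos v hv w₀ hw₀ w₁ hw₁ w₂ hw₂ w₃ hw₃ => ?_,
    fun r h hpos v hv w₀ hw₀ w₁ hw₁ w₂ hw₂ w₃ hw₃ => ?_,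
    fun r h hpos v hv w₀ hw₀ w₁ hw₁ w₂ hw₂ w₃ hw₃ => ?_⟩
  · rw [← scaling_swap h₀ h₁ h₂ h₃, ← h₀]
    exact key r _ (hΦ.zero ![r 0, r 2, r 1, r 3] h p hpos hp v hv w₀ hw₀ w₂ hw₂ w₁ hw₁ w₃ hw₃)
  · rw [← scaling_swap h₀ h₁ h₂ h₃, ← h₂]
    exact key r _ (hΦ.two ![r 0, r 2, r 1, r 3] h hpos v hv w₀ hw₀ w₂ hw₂ w₁ hw₁ w₃ hw₃)
  · rw [← scaling_swap h₀ h₁ h₂ h₃, ← h₁]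
    exact key r _ (hΦ.one ![r 0, r 2, r 1, r 3] h hpos v hv w₀ hw₀ w₂ hw₂ w₁ hw₁ w₃ hw₃)
  · rw [← scaling_swap h₀ h₁ h₂ h₃, ← h₃]
    exact key r _ (hΦ.three ![r 0, r 2, r 1, r 3] h hpos v hv w₀ hw₀ w₂ hw₂ w₁ hw₁ w₃ hw₃)

theorem CorrelatorRelations.reducible_two (hΦ : CorrelatorRelations M₀ M₁ M₂ M₃ ζ₁ ζ₂ ζ₁₂ Φ)
    (c₀₂ : s 0 * s 2 ∈ unitsIn O) (c₀ : ζ₂ * s 0 ∈ unitsIn O) (c₂₁ : s 2 * (s 1)⁻¹ ∈ unitsIn O)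
    (c₁ : s 1 * ζ₁₂⁻¹ ∈ unitsIn O) (c₂₃ : s 2 * (s 3)⁻¹ ∈ unitsIn O)
    (c₃ : s 3 * ζ₂⁻¹ ∈ unitsIn O)
    (r : Fin 4 → ℝ) (h : ℤ) (hpos : 0 < h) (v : V) (hv : v ∈ 𝒱.weightSpace h)
    (w₀ : W₀) (hw₀ : w₀ ∈ M₀.weightSpace (r 0)) (w₁ : W₁) (hw₁ : w₁ ∈ M₁.weightSpace (r 1))
    (w₂ : W₂) (hw₂ : w₂ ∈ M₂.weightSpace (r 2)) (w₃ : W₃) (hw₃ : w₃ ∈ M₃.weightSpace (r 3)) :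
    (s 2 ^ h * scaling s r) • Φ w₀ w₁ (M₂.Y v (-1) w₂) w₃ ∈
      boundedSpan M₀ M₁ M₂ M₃ O s Φ (r 0 + r 1 + r 2 + r 3 + ((h - 1 : ℤ) : ℝ)) := by
  obtain ⟨s', h₀, h₁, h₂, h₃⟩ : ∃ s' : Fin 4 → Rˣ, s' 0 = s 0 ∧ s' 1 = s 2 ∧ s' 2 = s 1 ∧
      s' 3 = s 3 := ⟨![s 0, s 2, s 1, s 3], rfl, rfl, rfl, rfl⟩
  have hn : s 1 * (-ζ₁₂)⁻¹ ∈ unitsIn O := by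
    rw [inv_neg, mul_neg]
    exact neg_mem_unitsIn c₁
  rw [← scaling_swap h₀ h₁ h₂ h₃, ← h₁]
  rw [← h₀, ← h₁] at c₀₂
  rw [← h₀] at c₀
  rw [← h₁, ← h₂] at c₂₁
  rw [← h₂] at hn
  rw [← h₁, ← h₃] at c₂₃
  rw [← h₃] at c₃
  exact mem_boundedSpan_of_swap h₀ h₁ h₂ h₃ r _ (hΦ.swap.reducible_one c₀₂ c₀ c₂₁ hn c₂₃ c₃
    ![r 0, r 2, r 1, r 3] h hpos v hv w₀ hw₀ w₂ hw₂ w₁ hw₁ w₃ hw₃)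

/-- When the three finite points share the factor `t`, the remaining conditions follow: `ζ₁ u`, `ζ₂
u` and `u t` are products of the given regular units. -/
theorem CorrelatorRelations.reducible (hΦ : CorrelatorRelations M₀ M₁ M₂ M₃ ζ₁ ζ₂ ζ₁₂ Φ)
    {t u : Rˣ} (c₁₂ : t * ζ₁₂⁻¹ ∈ unitsIn O) (c₁ : t * ζ₁⁻¹ ∈ unitsIn O)
    (c₂ : t * ζ₂⁻¹ ∈ unitsIn O) (c₁' : ζ₁ ^ 2 * u * t⁻¹ ∈ unitsIn O)
    (c₂' : ζ₂ ^ 2 * u * t⁻¹ ∈ unitsIn O) :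
    Reducible M₀ M₁ M₂ M₃ O ![u, t, t, t] Φ := by
  have e₁ : ζ₁ * u = t * ζ₁⁻¹ * (ζ₁ ^ 2 * u * t⁻¹) := by
    apply Additive.ofMul.injective
    simp only [ofMul_mul, ofMul_inv, ofMul_pow]
    module
  have e₂ : ζ₂ * u = t * ζ₂⁻¹ * (ζ₂ ^ 2 * u * t⁻¹) := by
    apply Additive.ofMul.injective
    simp only [ofMul_mul, ofMul_inv, ofMul_pow]
    module
  have e : u * t = t * ζ₁⁻¹ * (t * ζ₁⁻¹ * (ζ₁ ^ 2 * u * t⁻¹)) := by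
    apply Additive.ofMul.injective
    simp only [ofMul_mul, ofMul_inv, ofMul_pow]
    module
  have d₁ : ζ₁ * u ∈ unitsIn O := e₁ ▸ mul_mem c₁ c₁'
  have d₂ : ζ₂ * u ∈ unitsIn O := e₂ ▸ mul_mem c₂ c₂'
  have d : u * t ∈ unitsIn O := e ▸ mul_mem c₁ (mul_mem c₁ c₁')
  have d' : t * t⁻¹ ∈ unitsIn O := by simp
  exact ⟨hΦ.reducible_zero d d₁ c₁ c₁' d₂ c₂ c₂', hΦ.reducible_one d d₁ d' c₁₂ d' c₁,
    hΦ.reducible_two d d₂ d' c₁₂ d' c₂, hΦ.reducible_three d d' c₁ d' c₂⟩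

/-- With these scales `reducible_one` would require `s 1 * (s 2)⁻¹ = ζ₁` to be regular, so this
position alone uses the modified relation. -/
theorem CorrelatorRelations.reducible_of_infinity
    (hΦ : CorrelatorRelations M₀ M₁ M₂ M₃ ζ₁ ζ₂ ζ₁₂ Φ) (hζ : (ζ₁₂ : R) = ζ₁ - ζ₂)
    (c₁ : ζ₁⁻¹ ∈ unitsIn O) (c₂ : ζ₂ ∈ unitsIn O) (c₂' : ζ₂⁻¹ ∈ unitsIn O)
    (c₁₂ : ζ₁ * ζ₁₂⁻¹ ∈ unitsIn O) :
    Reducible M₀ M₁ M₂ M₃ O ![ζ₁⁻¹, ζ₁, 1, 1] Φ := by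
  have m := Submonoid.one_mem (unitsIn O)
  refine ⟨hΦ.reducible_zero ?_ ?_ ?_ ?_ ?_ ?_ ?_,
    hΦ.reducible_one_of_infinity hζ c₁ c₂ c₂' c₁₂ rfl rfl rfl rfl,
    hΦ.reducible_two ?_ ?_ ?_ ?_ ?_ ?_, hΦ.reducible_three ?_ ?_ ?_ ?_ ?_⟩ <;>
    simp only [Matrix.cons_val, mul_one, one_mul, inv_one, mul_inv_cancel] <;> try assumption
  · simp [pow_two]
  · exact mul_mem c₂ c₁
  · exact mul_mem (pow_mem c₂ 2) c₁
  · exact mul_mem c₂ c₁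

end Swap

/-! ### The scalings at the singular points -/

namespace SingularPoint

/-- The units by which the correlators are scaled according to the weights of the vectors. -/
def scales : SingularPoint → Fin 4 → CoeffRingˣ
  | z₁_zero => ![z₁, z₁, z₁, z₁]
  | z₂_zero => ![z₂, z₂, z₂, z₂]
  | z₁_infty => ![z₁⁻¹, z₁, 1, 1]
  | z₂_infty => ![z₂⁻¹, 1, z₂, 1]
  | z₁_eq_z₂ => ![z₁₂, z₁₂, z₁₂, z₁₂]
  | z₁_ratio => ![z₁₂ * (z₂ ^ 2)⁻¹, z₁₂, z₁₂, z₁₂]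
  | z₂_ratio => ![z₁₂ * (z₂ ^ 2)⁻¹, z₁₂, z₁₂, z₁₂]

theorem fg_regularFunctions (S : SingularPoint) : S.regularFunctions.FG := by
  cases S <;> exact Subalgebra.fg_def.mpr ⟨_, Set.toFinite _, rfl⟩

instance isNoetherianRing_regularFunctions (S : SingularPoint) :
    IsNoetherianRing S.regularFunctions :=
  isNoetherianRing_of_fg S.fg_regularFunctions

/-- Transfers pole bounds from the unit used in the scaling to the one in the definition of
regularity. They differ only at `z₂ = ∞`, where the scaling by `1` gives the stronger bound. -/
theorem scale₁_mul_inv_mem (S : SingularPoint) :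
    S.scale₁ * (S.scales 1)⁻¹ ∈ unitsIn S.regularFunctions := by
  cases S
  case z₂_infty => exact Algebra.subset_adjoin (by simp [scale₁, scales])
  all_goals simp [scale₁, scales]

theorem scale₂_mul_inv_mem (S : SingularPoint) :
    S.scale₂ * (S.scales 2)⁻¹ ∈ unitsIn S.regularFunctions := by
  cases S
  case z₁_infty => exact Algebra.subset_adjoin (by simp [scale₂, scales])
  all_goals simp [scale₂, scales]

end SingularPoint

theorem mem_unitsIn_adjoin {X : Set CoeffRing} {a : CoeffRingˣ} (ha : (a : CoeffRing) ∈ X) :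
    a ∈ unitsIn (Algebra.adjoin ℂ X) :=
  Algebra.subset_adjoin ha

theorem z₁₂_mul_z₁_inv : ((z₁₂ * z₁⁻¹ : CoeffRingˣ) : CoeffRing) = 1 - ↑(z₂ * z₁⁻¹) := by
  rw [Units.val_mul, coe_z₁₂, sub_mul, Units.mul_inv, Units.val_mul]

theorem z₁₂_mul_z₂_inv : ((z₁₂ * z₂⁻¹ : CoeffRingˣ) : CoeffRing) = ↑(z₁ * z₂⁻¹) - 1 := by
  rw [Units.val_mul, coe_z₁₂, sub_mul, Units.mul_inv, Units.val_mul]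

section

variable {V : Type*} [AddCommGroup V] [Module ℂ V] {𝒱 : VertexOperatorAlgebra V}
  {W₀ : Type*} [AddCommGroup W₀] [Module ℂ W₀] {M₀ : DiscreteModule 𝒱 W₀}
  {W₁ : Type*} [AddCommGroup W₁] [Module ℂ W₁] {M₁ : DiscreteModule 𝒱 W₁}
  {W₂ : Type*} [AddCommGroup W₂] [Module ℂ W₂] {M₂ : DiscreteModule 𝒱 W₂}
  {W₃ : Type*} [AddCommGroup W₃] [Module ℂ W₃] {M₃ : DiscreteModule 𝒱 W₃}
  {Q : Type*} [AddCommGroup Q] [Module ℂ Q] [Module CoeffRing Q] [IsScalarTower ℂ CoeffRing Q]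
  {Φ : W₀ →ₗ[ℂ] W₁ →ₗ[ℂ] W₂ →ₗ[ℂ] W₃ →ₗ[ℂ] Q}

/-- All functions in this algebra have degree zero in `z₁`, `z₂`. The factor for `w₀`, which sits at
infinity, must therefore have degree `-1`, whereas `z₁₂` has degree `1`. -/
theorem CorrelatorRelations.reducible_ratio (hΦ : CorrelatorRelations M₀ M₁ M₂ M₃ z₁ z₂ z₁₂ Φ) :
    Reducible M₀ M₁ M₂ M₃ (Algebra.adjoin ℂ {↑(z₁ * z₂⁻¹), ↑(z₂ * z₁⁻¹)})
      ![z₁₂ * (z₂ ^ 2)⁻¹, z₁₂, z₁₂, z₁₂] Φ := by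
  have m₁ : z₁ * z₂⁻¹ ∈ unitsIn (Algebra.adjoin ℂ {↑(z₁ * z₂⁻¹), ↑(z₂ * z₁⁻¹)}) :=
    mem_unitsIn_adjoin (by simp)
  have m₂ : z₂ * z₁⁻¹ ∈ unitsIn (Algebra.adjoin ℂ {↑(z₁ * z₂⁻¹), ↑(z₂ * z₁⁻¹)}) :=
    mem_unitsIn_adjoin (by simp)
  refine hΦ.reducible ?_ ?_ ?_ ?_ ?_
  · simp
  · rw [mem_unitsIn, z₁₂_mul_z₁_inv]
    exact sub_mem (one_mem _) m₂
  · rw [mem_unitsIn, z₁₂_mul_z₂_inv]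
    exact sub_mem m₁ (one_mem _)
  · have e : z₁ ^ 2 * (z₁₂ * (z₂ ^ 2)⁻¹) * z₁₂⁻¹ = (z₁ * z₂⁻¹) ^ 2 := by
      apply Additive.ofMul.injective
      simp only [ofMul_mul, ofMul_inv, ofMul_pow]
      module
    exact e ▸ pow_mem m₁ 2
  · have e : z₂ ^ 2 * (z₁₂ * (z₂ ^ 2)⁻¹) * z₁₂⁻¹ = 1 := by
      apply Additive.ofMul.injective
      simp only [ofMul_mul, ofMul_inv, ofMul_pow, ofMul_one]
      module
    exact e ▸ one_mem _

theorem CorrelatorRelations.reducible_singularPoint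
    (hΦ : CorrelatorRelations M₀ M₁ M₂ M₃ z₁ z₂ z₁₂ Φ) (S : SingularPoint) :
    Reducible M₀ M₁ M₂ M₃ S.regularFunctions S.scales Φ := by
  cases S
  case z₁_zero =>
    have m : z₁ ∈ unitsIn SingularPoint.z₁_zero.regularFunctions := mem_unitsIn_adjoin (by simp)
    have m₂ : z₂ ∈ unitsIn SingularPoint.z₁_zero.regularFunctions := mem_unitsIn_adjoin (by simp)
    refine hΦ.reducible (mul_mem m (mem_unitsIn_adjoin (by simp))) ?_
      (mul_mem m (mem_unitsIn_adjoin (by simp))) ?_ ?_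
    · simp
    · simpa using pow_mem m 2
    · simpa using pow_mem m₂ 2
  case z₂_zero =>
    have m : z₂ ∈ unitsIn SingularPoint.z₂_zero.regularFunctions := mem_unitsIn_adjoin (by simp)
    have m₁ : z₁ ∈ unitsIn SingularPoint.z₂_zero.regularFunctions := mem_unitsIn_adjoin (by simp)
    refine hΦ.reducible (mul_mem m (mem_unitsIn_adjoin (by simp)))
      (mul_mem m (mem_unitsIn_adjoin (by simp))) ?_ ?_ ?_
    · simp
    · simpa using pow_mem m₁ 2
    · simpa using pow_mem m 2
  case z₁_infty =>
    exact hΦ.reducible_of_infinity coe_z₁₂ (mem_unitsIn_adjoin (by simp))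
      (mem_unitsIn_adjoin (by simp)) (mem_unitsIn_adjoin (by simp)) (mem_unitsIn_adjoin (by simp))
  case z₂_infty =>
    refine Reducible.of_swap (s' := ![z₂⁻¹, z₂, 1, 1]) rfl rfl rfl rfl
      (hΦ.swap.reducible_of_infinity ?_ (mem_unitsIn_adjoin (by simp))
        (mem_unitsIn_adjoin (by simp)) (mem_unitsIn_adjoin (by simp)) ?_)
    · rw [Units.val_neg, coe_z₁₂, neg_sub]
    · rw [inv_neg, mul_neg]
      exact neg_mem_unitsIn (mem_unitsIn_adjoin (by simp))
  case z₁_eq_z₂ =>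
    have m₁ : z₁ ∈ unitsIn SingularPoint.z₁_eq_z₂.regularFunctions := mem_unitsIn_adjoin (by simp)
    have m₂ : z₂ ∈ unitsIn SingularPoint.z₁_eq_z₂.regularFunctions := mem_unitsIn_adjoin (by simp)
    have m : z₁₂ ∈ unitsIn SingularPoint.z₁_eq_z₂.regularFunctions := by
      rw [mem_unitsIn, coe_z₁₂]
      exact sub_mem m₁ m₂
    refine hΦ.reducible ?_ (mul_mem m (mem_unitsIn_adjoin (by simp)))
      (mul_mem m (mem_unitsIn_adjoin (by simp))) ?_ ?_
    · simp
    · simpa using pow_mem m₁ 2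
    · simpa using pow_mem m₂ 2
  case z₁_ratio => exact hΦ.reducible_ratio
  case z₂_ratio => exact hΦ.reducible_ratio

end

end VOA
end

noncomputable section

namespace VOA

/-! ### Existence of the differential equations -/

/-- The spans of the first `k` vectors stabilise in the Noetherian module `T → P`, so some vector is
an `O`-combination of its predecessors. Working with functions on `T` yields coefficients common to
all `t`; the unit `c t` cancels, and `e ^ k` turns into the pole bound. -/
theorem exists_recurrence {R : Type*} [CommRing R] [Algebra ℂ R] (O : Subalgebra ℂ R)
    [IsNoetherianRing O] {Q : Type*} [AddCommGroup Q] [Module R Q] {T : Type*} [Finite T]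
    {P : Submodule O Q} (hP : P.FG) (e : Rˣ) (c : T → Rˣ) (y : T → ℕ → Q)
    (hy : ∀ t k, (e ^ k * c t) • y t k ∈ P) :
    ∃ m, 0 < m ∧ ∃ a : ℕ → R, (∀ k ∈ Finset.Icc 1 m, (e : R) ^ k * a k ∈ O) ∧
      ∀ t, y t m + ∑ k ∈ Finset.Icc 1 m, a k • y t (m - k) = 0 := by
  have : IsNoetherian O P := isNoetherian_of_fg_of_noetherian P hP
  set x : ℕ → T → P := fun k t => ⟨_, hy t k⟩ with hx
  obtain ⟨n, hn⟩ := monotone_stabilizes_iff_noetherian.mpr (inferInstance : IsNoetherian O (T → P))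
    ⟨fun k => Submodule.span O (x '' (Finset.range k : Set ℕ)), fun k l hkl =>
      Submodule.span_mono (Set.image_mono (by simpa using hkl))⟩
  -- Comparing the stages `n + 1` and `n + 2` ensures that the order `n + 1` is positive.
  have hmem : x (n + 1) ∈ Submodule.span O (x '' (Finset.range (n + 1) : Set ℕ)) := by
    have h1 := hn (n + 1) (by omega)
    have h2 := hn (n + 2) (by omega)
    have h3 := h1.symm.trans h2
    change Submodule.span O (x '' (Finset.range (n + 1) : Set ℕ)) =
      Submodule.span O (x '' (Finset.range (n + 2) : Set ℕ)) at h3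
    rw [h3]
    exact Submodule.subset_span ⟨n + 1, by simp, rfl⟩
  obtain ⟨d, hd⟩ : ∃ d : ℕ → O, ∑ i ∈ Finset.range (n + 1), d i • x i = x (n + 1) := by
    obtain ⟨d, hd⟩ := (Submodule.mem_span_image_finset_iff_exists_fun O).mp hmem
    refine ⟨fun i => if hi : i ∈ Finset.range (n + 1) then d ⟨i, hi⟩ else 0, ?_⟩
    rw [← hd, ← Finset.sum_coe_sort]
    exact Finset.sum_congr rfl fun i _ => by simp only [dif_pos i.2]
  refine ⟨n + 1, n.succ_pos, fun k => -(↑(e⁻¹ ^ k) * (d (n + 1 - k) : R)), fun k _ => ?_,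
    fun t => ?_⟩
  · rw [mul_neg, ← Units.val_pow_eq_pow_val, ← mul_assoc, ← Units.val_mul, ← mul_pow, mul_inv_cancel,
      one_pow, Units.val_one, one_mul]
    exact neg_mem (d _).2
  · have ht : ∑ i ∈ Finset.range (n + 1), (d i : R) • (e ^ i * c t) • y t i =
        (e ^ (n + 1) * c t) • y t (n + 1) := by
      have := congrArg (fun f : T → P => (f t : Q)) hd
      simp only [Finset.sum_apply, Pi.smul_apply, AddSubmonoidClass.coe_finsetSum] at this
      exact this
    have h3 : y t (n + 1) = ∑ i ∈ Finset.range (n + 1), (↑(e⁻¹ ^ (n + 1 - i)) * (d i : R)) • y t i := by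
      rw [eq_inv_smul_iff.mpr ht.symm, Finset.smul_sum]
      refine Finset.sum_congr rfl fun i hi => ?_
      rw [Finset.mem_range] at hi
      have e1 : (e ^ (n + 1) * c t)⁻¹ * (e ^ i * c t) = e⁻¹ ^ (n + 1 - i) := by
        rw [mul_inv, mul_mul_mul_comm, inv_mul_cancel, mul_one, inv_pow, pow_sub _ hi.le, mul_inv,
          inv_inv]
      rw [← e1, Units.smul_def, smul_smul, Units.smul_def (e ^ i * c t), smul_smul,
        Units.val_mul (e ^ (n + 1) * c t)⁻¹]
      congr 1
      ring
    rw [add_eq_zero_iff_eq_neg, ← Finset.sum_neg_distrib]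
    refine h3.trans (Finset.sum_bij' (fun i _ => n + 1 - i) (fun k _ => n + 1 - k) ?_ ?_ ?_ ?_ ?_)
    · intro i hi
      simp only [Finset.mem_range, Finset.mem_Icc] at hi ⊢
      omega
    · intro i hi
      simp only [Finset.mem_range, Finset.mem_Icc] at hi ⊢
      omega
    · intro i hi
      simp only [Finset.mem_range] at hi
      omega
    · intro i hi
      simp only [Finset.mem_Icc] at hi
      omega
    · intro i hi
      simp only [Finset.mem_range] at hi
      rw [neg_smul, neg_neg, Nat.sub_sub_self hi.le]

section Equation

variable {V : Type*} [AddCommGroup V] [Module ℂ V] {𝒱 : VertexOperatorAlgebra V}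
  {W₀ : Type*} [AddCommGroup W₀] [Module ℂ W₀] {M₀ : DiscreteModule 𝒱 W₀}
  {W₁ : Type*} [AddCommGroup W₁] [Module ℂ W₁] {M₁ : DiscreteModule 𝒱 W₁}
  {W₂ : Type*} [AddCommGroup W₂] [Module ℂ W₂] {M₂ : DiscreteModule 𝒱 W₂}
  {W₃ : Type*} [AddCommGroup W₃] [Module ℂ W₃] {M₃ : DiscreteModule 𝒱 W₃}
  {R : Type*} [CommRing R] [Algebra ℂ R] {O : Subalgebra ℂ R} [IsNoetherianRing O]
  {Q : Type*} [AddCommGroup Q] [Module ℂ Q] [Module R Q] [IsScalarTower ℂ R Q]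
  {s : Fin 4 → Rˣ} {Φ : W₀ →ₗ[ℂ] W₁ →ₗ[ℂ] W₂ →ₗ[ℂ] W₃ →ₗ[ℂ] Q}

/-- `L(-1)^k` raises the weight by `k`, so the `k`-th derivative carries the scaling `s 1 ^ k`. The
vectors need not be homogeneous: `T` runs over the quadruples of their components, and the common
recurrence is summed over `T`. -/
theorem Reducible.exists_equation_one (hΦ : Reducible M₀ M₁ M₂ M₃ O s Φ) (h₀ : M₀.C₁Cofinite)
    (h₁ : M₁.C₁Cofinite) (h₂ : M₂.C₁Cofinite) (h₃ : M₃.C₁Cofinite)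
    (w₀ : W₀) (w₁ : W₁) (w₂ : W₂) (w₃ : W₃) :
    ∃ m, 0 < m ∧ ∃ a : ℕ → R, (∀ k ∈ Finset.Icc 1 m, (s 1 : R) ^ k * a k ∈ O) ∧
      Φ w₀ ((M₁.Y 𝒱.ω 0 ^ m) w₁) w₂ w₃ +
        ∑ k ∈ Finset.Icc 1 m, a k • Φ w₀ ((M₁.Y 𝒱.ω 0 ^ (m - k)) w₁) w₂ w₃ = 0 := by
  obtain ⟨N₀, hN₀⟩ := hΦ.exists_bound h₀ h₁ h₂ h₃
  obtain ⟨S₀, f₀, hf₀, rfl⟩ := M₀.exists_homogeneous_sum w₀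
  obtain ⟨S₁, f₁, hf₁, rfl⟩ := M₁.exists_homogeneous_sum w₁
  obtain ⟨S₂, f₂, hf₂, rfl⟩ := M₂.exists_homogeneous_sum w₂
  obtain ⟨S₃, f₃, hf₃, rfl⟩ := M₃.exists_homogeneous_sum w₃
  have hsum (k : ℕ) : Φ (∑ r ∈ S₀, f₀ r) ((M₁.Y 𝒱.ω 0 ^ k) (∑ r ∈ S₁, f₁ r)) (∑ r ∈ S₂, f₂ r)
      (∑ r ∈ S₃, f₃ r) = ∑ t : ↥(S₃ ×ˢ S₂ ×ˢ S₁ ×ˢ S₀), Φ (f₀ t.1.2.2.2)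
        ((M₁.Y 𝒱.ω 0 ^ k) (f₁ t.1.2.2.1)) (f₂ t.1.2.1) (f₃ t.1.1) := by
    rw [Finset.sum_coe_sort (S₃ ×ˢ S₂ ×ˢ S₁ ×ˢ S₀) (fun t => Φ (f₀ t.2.2.2)
      ((M₁.Y 𝒱.ω 0 ^ k) (f₁ t.2.2.1)) (f₂ t.2.1) (f₃ t.1))]
    simp only [Finset.sum_product, map_sum, LinearMap.sum_apply]
  obtain ⟨m, hm, a, ha, h⟩ := exists_recurrence O (boundedSpan_fg (M₀ := M₀) (M₁ := M₁) (M₂ := M₂)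
    (M₃ := M₃) (O := O) (s := s) (Φ := Φ) N₀) (s 1)
    (fun t : ↥(S₃ ×ˢ S₂ ×ˢ S₁ ×ˢ S₀) => scaling s ![t.1.2.2.2, t.1.2.2.1, t.1.2.1, t.1.1])
    (fun t k => Φ (f₀ t.1.2.2.2) ((M₁.Y 𝒱.ω 0 ^ k) (f₁ t.1.2.2.1)) (f₂ t.1.2.1) (f₃ t.1.1))
    (fun t k => by
      refine hN₀ _ (scaled_mem_boundedSpan (d := k)
        (r := ![t.1.2.2.2, t.1.2.2.1, t.1.2.1, t.1.1]) ![0, k, 0, 0]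
        (DiscreteModule.mem_add_zero (hf₀ _)) (M₁.L_neg_one_pow_mem (hf₁ _) k)
        (DiscreteModule.mem_add_zero (hf₂ _)) (DiscreteModule.mem_add_zero (hf₃ _)) ?_ ?_)
      · simp
      · simp)
  refine ⟨m, hm, a, ha, ?_⟩
  simp only [hsum, Finset.smul_sum]
  rw [Finset.sum_comm, ← Finset.sum_add_distrib]
  exact Finset.sum_eq_zero fun t _ => h t

omit [IsNoetherianRing O] [IsScalarTower ℂ R Q] in
theorem Reducible.swap (hΦ : Reducible M₀ M₁ M₂ M₃ O s Φ) :
    Reducible M₀ M₂ M₁ M₃ O ![s 0, s 2, s 1, s 3] (LinearMap.lflip.toLinearMap ∘ₗ Φ) := by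
  refine Reducible.of_swap (s' := s) rfl rfl rfl rfl ?_
  have e : LinearMap.lflip.toLinearMap ∘ₗ LinearMap.lflip.toLinearMap ∘ₗ Φ = Φ := by
    ext
    rfl
  rw [e]
  exact hΦ

theorem Reducible.exists_equation_two (hΦ : Reducible M₀ M₁ M₂ M₃ O s Φ) (h₀ : M₀.C₁Cofinite)
    (h₁ : M₁.C₁Cofinite) (h₂ : M₂.C₁Cofinite) (h₃ : M₃.C₁Cofinite)
    (w₀ : W₀) (w₁ : W₁) (w₂ : W₂) (w₃ : W₃) :
    ∃ m, 0 < m ∧ ∃ a : ℕ → R, (∀ k ∈ Finset.Icc 1 m, (s 2 : R) ^ k * a k ∈ O) ∧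
      Φ w₀ w₁ ((M₂.Y 𝒱.ω 0 ^ m) w₂) w₃ +
        ∑ k ∈ Finset.Icc 1 m, a k • Φ w₀ w₁ ((M₂.Y 𝒱.ω 0 ^ (m - k)) w₂) w₃ = 0 :=
  hΦ.swap.exists_equation_one h₀ h₂ h₁ h₃ w₀ w₂ w₁ w₃

end Equation

end VOA
end

noncomputable section

namespace VOA

/-! ### The universal family of correlators -/

section Family

variable {V : Type*} [AddCommGroup V] [Module ℂ V] {𝒱 : VertexOperatorAlgebra V}
  {W₀ : Type*} [AddCommGroup W₀] [Module ℂ W₀] {M₀ : DiscreteModule 𝒱 W₀}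
  {W₁ : Type*} [AddCommGroup W₁] [Module ℂ W₁] {M₁ : DiscreteModule 𝒱 W₁}
  {W₂ : Type*} [AddCommGroup W₂] [Module ℂ W₂] {M₂ : DiscreteModule 𝒱 W₂}
  {W₃ : Type*} [AddCommGroup W₃] [Module ℂ W₃] {M₃ : DiscreteModule 𝒱 W₃}
  {R : Type*} [CommRing R] {ι : Type*} {Q : ι → Type*} [∀ i, AddCommGroup (Q i)]
  [∀ i, Module ℂ (Q i)] [∀ i, Module R (Q i)]

/-- A family of multilinear maps, as one multilinear map. -/
def piMultilinear (Φ : ∀ i, W₀ →ₗ[ℂ] W₁ →ₗ[ℂ] W₂ →ₗ[ℂ] W₃ →ₗ[ℂ] Q i) :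
    W₀ →ₗ[ℂ] W₁ →ₗ[ℂ] W₂ →ₗ[ℂ] W₃ →ₗ[ℂ] ∀ i, Q i :=
  mkMultilinear (fun w₀ w₁ w₂ w₃ i => Φ i w₀ w₁ w₂ w₃)
    (fun _ _ _ _ _ => funext fun _ => by simp) (fun _ _ _ _ _ => funext fun _ => by simp)
    (fun _ _ _ _ _ => funext fun _ => by simp) (fun _ _ _ _ _ => funext fun _ => by simp)
    (fun _ _ _ _ _ => funext fun _ => by simp) (fun _ _ _ _ _ => funext fun _ => by simp)
    (fun _ _ _ _ _ => funext fun _ => by simp) (fun _ _ _ _ _ => funext fun _ => by simp)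

theorem piMultilinear_apply (Φ : ∀ i, W₀ →ₗ[ℂ] W₁ →ₗ[ℂ] W₂ →ₗ[ℂ] W₃ →ₗ[ℂ] Q i) (w₀ : W₀)
    (w₁ : W₁) (w₂ : W₂) (w₃ : W₃) (i : ι) :
    piMultilinear Φ w₀ w₁ w₂ w₃ i = Φ i w₀ w₁ w₂ w₃ := rfl

theorem CorrelatorRelations.pi {ζ₁ ζ₂ ζ₁₂ : Rˣ}
    {Φ : ∀ i, W₀ →ₗ[ℂ] W₁ →ₗ[ℂ] W₂ →ₗ[ℂ] W₃ →ₗ[ℂ] Q i}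
    (hΦ : ∀ i, CorrelatorRelations M₀ M₁ M₂ M₃ ζ₁ ζ₂ ζ₁₂ (Φ i)) :
    CorrelatorRelations M₀ M₁ M₂ M₃ ζ₁ ζ₂ ζ₁₂ (piMultilinear Φ) where
  first v w₀ w₁ w₂ w₃ K h₀ h₂ h₃ := by
    funext i
    simp only [Finset.sum_apply, Pi.add_apply, Pi.smul_apply, piMultilinear_apply]
    exact (hΦ i).first v w₀ w₁ w₂ w₃ K h₀ h₂ h₃
  second v w₀ w₁ w₂ w₃ K h₀ h₁ h₃ := by
    funext i
    simp only [Finset.sum_apply, Pi.add_apply, Pi.smul_apply, piMultilinear_apply]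
    exact (hΦ i).second v w₀ w₁ w₂ w₃ K h₀ h₁ h₃
  outer v n w₀ w₁ w₂ w₃ K h₁ h₂ := by
    funext i
    simp only [Finset.sum_apply, Pi.add_apply, Pi.smul_apply, piMultilinear_apply]
    exact (hΦ i).outer v n w₀ w₁ w₂ w₃ K h₁ h₂

end Family

/-! ### Derivatives of correlators -/

theorem satisfiesEquation_of_iterate {p q : ExpansionRing} {h : IsUnit (p * q * (p - q))}
    {D : FormalSeries → FormalSeries} {m : ℕ} {a : ℕ → CoeffRing} {φ : FormalSeries}
    (ψ : ℕ → SeriesModule p q h) (hD : ∀ k, D^[k] φ = (ψ k).toSeries)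
    (e : ψ m + ∑ k ∈ Finset.Icc 1 m, a k • ψ (m - k) = 0) :
    SatisfiesEquation (expand p q h) D m a φ := by
  funext α β
  have := congrArg (fun x : SeriesModule p q h => x.toSeries α β) e
  simp only [SeriesModule.toSeries_add, SeriesModule.toSeries_sum,
    SeriesModule.toSeries_coeff_smul] at this
  rw [Pi.add_apply, Pi.add_apply, Finset.sum_apply, Finset.sum_apply]
  simp only [hD]
  exact this

theorem iterate_eq_of_intertwines {W X : Type*} [AddCommGroup W] [Module ℂ W] {D : X → X}
    {f : W → X} {L : Module.End ℂ W} (hf : ∀ w, D (f w) = f (L w)) (k : ℕ) (w : W) :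
    D^[k] (f w) = f ((L ^ k) w) := by
  induction k with
  | zero => rfl
  | succ k ih => rw [Function.iterate_succ_apply', ih, hf, pow_succ', Module.End.mul_apply]

section Derivatives

variable {V : Type*} [AddCommGroup V] [Module ℂ V] {𝒱 : VertexOperatorAlgebra V}
  {W₀ : Type*} [AddCommGroup W₀] [Module ℂ W₀] {M₀ : DiscreteModule 𝒱 W₀}
  {W₁ : Type*} [AddCommGroup W₁] [Module ℂ W₁] {M₁ : DiscreteModule 𝒱 W₁}
  {W₂ : Type*} [AddCommGroup W₂] [Module ℂ W₂] {M₂ : DiscreteModule 𝒱 W₂}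
  {W₃ : Type*} [AddCommGroup W₃] [Module ℂ W₃] {M₃ : DiscreteModule 𝒱 W₃}
  {U : Type*} [AddCommGroup U] [Module ℂ U] {MU : DiscreteModule 𝒱 U}

theorem IntertwiningOperator.mode_derivative
    {Y₁ : V → ℤ → Module.End ℂ W₁} {Y₂ : V → ℤ → Module.End ℂ W₂} {Y₃ : V → ℤ → Module.End ℂ W₃}
    (I : IntertwiningOperator 𝒱 Y₁ Y₂ Y₃) (w : W₁) (α : ℂ) :
    I.mode (Y₁ 𝒱.ω 0 w) (-α - 1) = (α + 1) • I.mode w (-(α + 1) - 1) := by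
  rw [I.derivative, neg_sub, sub_neg_eq_add, add_comm 1, neg_add, sub_eq_add_neg (-α)]

theorem dX_prodSeries (I : IntertwiningOperator 𝒱 ⇑M₁.Y ⇑MU.Y M₀.contragredient)
    (J : IntertwiningOperator 𝒱 ⇑M₂.Y ⇑M₃.Y ⇑MU.Y) (w₀ : W₀) (w₁ : W₁) (w₂ : W₂) (w₃ : W₃) :
    dX (prodSeries I J w₀ w₁ w₂ w₃) = prodSeries I J w₀ (M₁.Y 𝒱.ω 0 w₁) w₂ w₃ := by
  funext α β
  simp only [dX, prodSeries, I.mode_derivative]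
  rfl

theorem dY_prodSeries (I : IntertwiningOperator 𝒱 ⇑M₁.Y ⇑MU.Y M₀.contragredient)
    (J : IntertwiningOperator 𝒱 ⇑M₂.Y ⇑M₃.Y ⇑MU.Y) (w₀ : W₀) (w₁ : W₁) (w₂ : W₂) (w₃ : W₃) :
    dY (prodSeries I J w₀ w₁ w₂ w₃) = prodSeries I J w₀ w₁ (M₂.Y 𝒱.ω 0 w₂) w₃ := by
  funext α β
  simp only [dY, prodSeries, J.mode_derivative, LinearMap.smul_apply, map_smul]
  rfl

theorem dX_iterSeries (J : IntertwiningOperator 𝒱 ⇑M₁.Y ⇑M₂.Y ⇑MU.Y)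
    (I : IntertwiningOperator 𝒱 ⇑MU.Y ⇑M₃.Y M₀.contragredient)
    (w₀ : W₀) (w₁ : W₁) (w₂ : W₂) (w₃ : W₃) (α β : ℂ) :
    dX (iterSeries J I w₀ w₁ w₂ w₃) α β =
      (I.mode (MU.Y 𝒱.ω 0 (J.mode w₁ (-β - 1) w₂)) (-α - 1) w₃ : Module.Dual ℂ W₀) w₀ := by
  simp only [dX, iterSeries, I.mode_derivative]
  rfl

theorem dY_iterSeries (J : IntertwiningOperator 𝒱 ⇑M₁.Y ⇑M₂.Y ⇑MU.Y)
    (I : IntertwiningOperator 𝒱 ⇑MU.Y ⇑M₃.Y M₀.contragredient)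
    (w₀ : W₀) (w₁ : W₁) (w₂ : W₂) (w₃ : W₃) :
    dY (iterSeries J I w₀ w₁ w₂ w₃) = iterSeries J I w₀ (M₁.Y 𝒱.ω 0 w₁) w₂ w₃ := by
  funext α β
  simp only [dY, iterSeries, J.mode_derivative, LinearMap.smul_apply, map_smul]
  rfl

/-- `dX` puts `L(-1)` on `J(w₁, y) w₂` and `dY` puts it on `w₁`. The commutator formula for `ω_0`,
with its single term `L(-1) w₁`, leaves `L(-1)` on `w₂`. -/
theorem dX_sub_dY_iterSeries (J : IntertwiningOperator 𝒱 ⇑M₁.Y ⇑M₂.Y ⇑MU.Y)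
    (I : IntertwiningOperator 𝒱 ⇑MU.Y ⇑M₃.Y M₀.contragredient)
    (w₀ : W₀) (w₁ : W₁) (w₂ : W₂) (w₃ : W₃) :
    dX (iterSeries J I w₀ w₁ w₂ w₃) - dY (iterSeries J I w₀ w₁ w₂ w₃) =
      iterSeries J I w₀ w₁ (M₂.Y 𝒱.ω 0 w₂) w₃ := by
  obtain ⟨K, hK⟩ := M₁.exists_truncation 𝒱.ω w₁
  funext α β
  rw [dY_iterSeries, Pi.sub_apply, Pi.sub_apply, dX_iterSeries,
    J.jacobi.commutator 𝒱.ω w₁ w₂ 0 _ (K := K + 1) (fun k hk => hK k (by omega))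
      (fun n => by rw [map_zero]; rfl), Finset.sum_eq_single_of_mem 0 (by simp)]
  · simp [iterSeries]
  · intro k _ hk
    rw [Ring.choose_zero_pos ℤ (Nat.pos_of_ne_zero hk)]
    simp

end Derivatives

end VOA
end


noncomputable section

namespace VOA

/-! ### One system for all correlators -/

section Universal

variable {V : Type*} [AddCommGroup V] [Module ℂ V] {𝒱 : VertexOperatorAlgebra V}
  {W₀ : Type*} [AddCommGroup W₀] [Module ℂ W₀] (M₀ : DiscreteModule 𝒱 W₀)
  {W₁ : Type*} [AddCommGroup W₁] [Module ℂ W₁] (M₁ : DiscreteModule 𝒱 W₁)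
  {W₂ : Type*} [AddCommGroup W₂] [Module ℂ W₂] (M₂ : DiscreteModule 𝒱 W₂)
  {W₃ : Type*} [AddCommGroup W₃] [Module ℂ W₃] (M₃ : DiscreteModule 𝒱 W₃)

/-- Pairs of series that can be substituted for `z₁` and `z₂`. -/
abbrev ExpansionPair : Type :=
  {e : ExpansionRing × ExpansionRing // IsUnit (e.1 * e.2 * (e.1 - e.2))}

/-- Correlators with values in an expansion of the functions of `z₁` and `z₂`. -/
abbrev CorrelatorSeries : Type _ :=
  {f : Σ e : ExpansionPair, W₀ →ₗ[ℂ] W₁ →ₗ[ℂ] W₂ →ₗ[ℂ] W₃ →ₗ[ℂ] SeriesModule e.1.1 e.1.2 e.2 //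
    CorrelatorRelations M₀ M₁ M₂ M₃ z₁ z₂ z₁₂ f.2}

/-- All correlators at once. -/
def universalCorrelator : W₀ →ₗ[ℂ] W₁ →ₗ[ℂ] W₂ →ₗ[ℂ] W₃ →ₗ[ℂ]
    ∀ i : CorrelatorSeries M₀ M₁ M₂ M₃, SeriesModule i.1.1.1.1 i.1.1.1.2 i.1.1.2 :=
  piMultilinear fun i => i.1.2

theorem universalCorrelator_relations :
    CorrelatorRelations M₀ M₁ M₂ M₃ z₁ z₂ z₁₂ (universalCorrelator M₀ M₁ M₂ M₃) :=
  CorrelatorRelations.pi fun i => i.2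

variable {M₀ M₁ M₂ M₃}

theorem pow_mul_mem_of_mul_inv_mem {R : Type*} [CommRing R] [Algebra ℂ R] {O : Subalgebra ℂ R}
    {e s : Rˣ} (h : e * s⁻¹ ∈ unitsIn O) {k : ℕ} {a : R} (ha : (s : R) ^ k * a ∈ O) :
    (e : R) ^ k * a ∈ O := by
  have h1 : (e : R) ^ k * a = ((e * s⁻¹ : Rˣ) : R) ^ k * ((s : R) ^ k * a) := by
    rw [← mul_assoc, ← mul_pow, ← Units.val_mul, inv_mul_cancel_right]
  rw [h1]
  exact mul_mem (pow_mem (mem_unitsIn.mp h) k) ha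

/-- The equations hold in the product over all series that satisfy the relations and are read off in
each component. The index type involves only the four outer modules, so the system depends neither
on the intermediate module nor on its universe. -/
theorem exists_system (h₀ : M₀.C₁Cofinite) (h₁ : M₁.C₁Cofinite) (h₂ : M₂.C₁Cofinite)
    (h₃ : M₃.C₁Cofinite) (w₀ : W₀) (w₁ : W₁) (w₂ : W₂) (w₃ : W₃) (S : SingularPoint) :
    ∃ E : DiffSystem, E.IsRegularAt S ∧
      ∀ (p q : ExpansionRing) (h : IsUnit (p * q * (p - q)))
        (Φ : W₀ →ₗ[ℂ] W₁ →ₗ[ℂ] W₂ →ₗ[ℂ] W₃ →ₗ[ℂ] SeriesModule p q h),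
        CorrelatorRelations M₀ M₁ M₂ M₃ z₁ z₂ z₁₂ Φ →
        (Φ w₀ ((M₁.Y 𝒱.ω 0 ^ E.m) w₁) w₂ w₃ +
          ∑ k ∈ Finset.Icc 1 E.m, E.a k • Φ w₀ ((M₁.Y 𝒱.ω 0 ^ (E.m - k)) w₁) w₂ w₃ = 0) ∧
        (Φ w₀ w₁ ((M₂.Y 𝒱.ω 0 ^ E.n) w₂) w₃ +
          ∑ k ∈ Finset.Icc 1 E.n, E.b k • Φ w₀ w₁ ((M₂.Y 𝒱.ω 0 ^ (E.n - k)) w₂) w₃ = 0) := by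
  have hred := (universalCorrelator_relations M₀ M₁ M₂ M₃).reducible_singularPoint S
  obtain ⟨m, hm, a, ha, ea⟩ := hred.exists_equation_one h₀ h₁ h₂ h₃ w₀ w₁ w₂ w₃
  obtain ⟨n, hn, b, hb, eb⟩ := hred.exists_equation_two h₀ h₁ h₂ h₃ w₀ w₁ w₂ w₃
  refine ⟨⟨m, n, hm, hn, a, b⟩,
    ⟨fun k hk => pow_mul_mem_of_mul_inv_mem S.scale₁_mul_inv_mem (ha k hk),
      fun k hk => pow_mul_mem_of_mul_inv_mem S.scale₂_mul_inv_mem (hb k hk)⟩,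
    fun p q h Φ hΦ => ⟨?_, ?_⟩⟩
  · have := congrFun ea ⟨⟨⟨(p, q), h⟩, Φ⟩, hΦ⟩
    simp only [Finset.sum_apply, Pi.add_apply, Pi.smul_apply, universalCorrelator,
      piMultilinear_apply] at this
    exact this
  · have := congrFun eb ⟨⟨⟨(p, q), h⟩, Φ⟩, hΦ⟩
    simp only [Finset.sum_apply, Pi.add_apply, Pi.smul_apply, universalCorrelator,
      piMultilinear_apply] at this
    exact this

end Universal

end VOA
end

/-! ### The three correlators as solutions of one system -/

theorem theorem2p3 {V : Type*} [AddCommGroup V] [Module ℂ V] (𝒱 : VOA.VertexOperatorAlgebra V)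
    {W₀ : Type*} [AddCommGroup W₀] [Module ℂ W₀] (M₀ : VOA.DiscreteModule 𝒱 W₀)
    {W₁ : Type*} [AddCommGroup W₁] [Module ℂ W₁] (M₁ : VOA.DiscreteModule 𝒱 W₁)
    {W₂ : Type*} [AddCommGroup W₂] [Module ℂ W₂] (M₂ : VOA.DiscreteModule 𝒱 W₂)
    {W₃ : Type*} [AddCommGroup W₃] [Module ℂ W₃] (M₃ : VOA.DiscreteModule 𝒱 W₃)
    (h₀ : M₀.C₁Cofinite) (h₁ : M₁.C₁Cofinite) (h₂ : M₂.C₁Cofinite) (h₃ : M₃.C₁Cofinite)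
    (w₀ : W₀) (w₁ : W₁) (w₂ : W₂) (w₃ : W₃) (S : VOA.SingularPoint) :
    ∃ E : VOA.DiffSystem,
      (∀ (W₄ : Type*) [AddCommGroup W₄] [Module ℂ W₄] (M₄ : VOA.DiscreteModule 𝒱 W₄)
        (I₁ : VOA.IntertwiningOperator 𝒱 ⇑M₁.Y ⇑M₄.Y M₀.contragredient)
        (I₂ : VOA.IntertwiningOperator 𝒱 ⇑M₂.Y ⇑M₃.Y ⇑M₄.Y),
        E.SatisfiedByProd (VOA.prodSeries I₁ I₂ w₀ w₁ w₂ w₃)) ∧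
      (∀ (W₅ : Type*) [AddCommGroup W₅] [Module ℂ W₅] (M₅ : VOA.DiscreteModule 𝒱 W₅)
        (I₃ : VOA.IntertwiningOperator 𝒱 ⇑M₁.Y ⇑M₂.Y ⇑M₅.Y)
        (I₄ : VOA.IntertwiningOperator 𝒱 ⇑M₅.Y ⇑M₃.Y M₀.contragredient),
        E.SatisfiedByIter (VOA.iterSeries I₃ I₄ w₀ w₁ w₂ w₃)) ∧
      (∀ (W₆ : Type*) [AddCommGroup W₆] [Module ℂ W₆] (M₆ : VOA.DiscreteModule 𝒱 W₆)
        (I₅ : VOA.IntertwiningOperator 𝒱 ⇑M₂.Y ⇑M₆.Y M₀.contragredient)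
        (I₆ : VOA.IntertwiningOperator 𝒱 ⇑M₁.Y ⇑M₃.Y ⇑M₆.Y),
        E.SatisfiedByProd' (VOA.prodSeries I₅ I₆ w₀ w₂ w₁ w₃)) ∧
      E.IsRegularAt S := by
  obtain ⟨E, hE, hsol⟩ := VOA.exists_system h₀ h₁ h₂ h₃ w₀ w₁ w₂ w₃ S
  refine ⟨E, fun W₄ _ _ M₄ I₁ I₂ => ?_, fun W₅ _ _ M₅ I₃ I₄ => ?_, fun W₆ _ _ M₆ I₅ I₆ => ?_, hE⟩
  · obtain ⟨e₁, e₂⟩ := hsol _ _ _ _ (VOA.prodCorrelator_relations _ I₁ I₂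
      (VOA.expand_z₁ VOA.varX VOA.varY
        ((VOA.isUnit_varX.mul VOA.isUnit_varY).mul VOA.isUnit_varX_sub_varY))
      (VOA.expand_z₂ _ _ _) (VOA.expand_z₁₂ _ _ _))
    exact ⟨VOA.satisfiesEquation_of_iterate
        (fun k => VOA.prodCorrelator _ _ _ I₁ I₂ w₀ ((M₁.Y 𝒱.ω 0 ^ k) w₁) w₂ w₃)
        (fun k => VOA.iterate_eq_of_intertwines
        (f := fun w => VOA.prodSeries I₁ I₂ w₀ w w₂ w₃)
        (fun w => VOA.dX_prodSeries I₁ I₂ w₀ w w₂ w₃) k w₁) e₁,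
      VOA.satisfiesEquation_of_iterate
        (fun k => VOA.prodCorrelator _ _ _ I₁ I₂ w₀ w₁ ((M₂.Y 𝒱.ω 0 ^ k) w₂) w₃)
        (fun k => VOA.iterate_eq_of_intertwines
        (f := fun w => VOA.prodSeries I₁ I₂ w₀ w₁ w w₃)
        (fun w => VOA.dY_prodSeries I₁ I₂ w₀ w₁ w w₃) k w₂) e₂⟩
  -- For the iterate `z₁ - z₂ = (x + y) - x = y`.
  · have h12 := (VOA.expand_z₁₂ (VOA.varX + VOA.varY) VOA.varX
      ((VOA.isUnit_varX_add_varY.mul VOA.isUnit_varX).mul (by simpa using VOA.isUnit_varY))).trans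
      (add_sub_cancel_left _ _)
    obtain ⟨e₁, e₂⟩ := hsol _ _ _ _ (VOA.iterCorrelator_relations _ I₃ I₄
      (VOA.expand_z₁ _ _ _) (VOA.expand_z₂ _ _ _) h12)
    exact ⟨VOA.satisfiesEquation_of_iterate
        (fun k => VOA.iterCorrelator _ _ _ I₃ I₄ w₀ ((M₁.Y 𝒱.ω 0 ^ k) w₁) w₂ w₃)
        (fun k => VOA.iterate_eq_of_intertwines
        (f := fun w => VOA.iterSeries I₃ I₄ w₀ w w₂ w₃)
        (fun w => VOA.dY_iterSeries I₃ I₄ w₀ w w₂ w₃) k w₁) e₁,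
      VOA.satisfiesEquation_of_iterate
        (fun k => VOA.iterCorrelator _ _ _ I₃ I₄ w₀ w₁ ((M₂.Y 𝒱.ω 0 ^ k) w₂) w₃)
        (fun k => VOA.iterate_eq_of_intertwines
        (D := fun ψ => VOA.dX ψ - VOA.dY ψ) (f := fun w => VOA.iterSeries I₃ I₄ w₀ w₁ w w₃)
        (fun w => VOA.dX_sub_dY_iterSeries I₃ I₄ w₀ w₁ w w₃) k w₂) e₂⟩
  -- The third series is a product whose left insertion is `w₂` at `z₂`, so the relations hold first
  -- with the difference `z₂ - z₁ = -z₁₂`; `swap` restores the order.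
  · have h12 : VOA.expand VOA.varY VOA.varX
        ((VOA.isUnit_varY.mul VOA.isUnit_varX).mul (by simpa using VOA.isUnit_varX_sub_varY.neg))
        ((-VOA.z₁₂ : VOA.CoeffRingˣ) : VOA.CoeffRing) = VOA.varX - VOA.varY := by
      rw [Units.val_neg, map_neg, VOA.expand_z₁₂, neg_sub]
    have hrel := (VOA.prodCorrelator_relations _ I₅ I₆ (VOA.expand_z₂ _ _ _)
      (VOA.expand_z₁ _ _ _) h12).swap
    rw [neg_neg] at hrel
    obtain ⟨e₁, e₂⟩ := hsol _ _ _ _ hrel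
    exact ⟨VOA.satisfiesEquation_of_iterate
        (fun k => VOA.prodCorrelator _ _ _ I₅ I₆ w₀ w₂ ((M₁.Y 𝒱.ω 0 ^ k) w₁) w₃)
        (fun k => VOA.iterate_eq_of_intertwines
        (f := fun w => VOA.prodSeries I₅ I₆ w₀ w₂ w w₃)
        (fun w => VOA.dY_prodSeries I₅ I₆ w₀ w₂ w w₃) k w₁) e₁,
      VOA.satisfiesEquation_of_iterate
        (fun k => VOA.prodCorrelator _ _ _ I₅ I₆ w₀ ((M₂.Y 𝒱.ω 0 ^ k) w₂) w₁ w₃)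
        (fun k => VOA.iterate_eq_of_intertwines
        (f := fun w => VOA.prodSeries I₅ I₆ w₀ w w₁ w₃)
        (fun w => VOA.dX_prodSeries I₅ I₆ w₀ w w₁ w₃) k w₂) e₂⟩
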